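/- **Conventions.** Manifolds and maps are smooth. Write $(ij)$, $[ij]$ for normalized symmetrization and skew-symmetrization. The curvature of a torsion-free connection $\nabla$ on an $n$-manifold is $R(X,Y)Z = \nabla_X\nabla_YZ-\nabla_Y\nabla_XZ-\nabla_{[X,Y]}Z$ with components $R_{ijk}{}^l$, where $R(\partial_i,\partial_j)\partial_k = R_{ijk}{}^l\partial_l$. Put $R_{ij}=R_{pij}{}^p$, $nF_{ij}=R_{ijp}{}^p$. For a metric $h$ put $R_{ijkl}=R_{ijk}{}^ph_{pl}$, $Q_{ij}=h^{pq}R_{ipqj}$, $H^{ij}=|\det h|^{1/n}h^{ij}$ and $R=H^{ij}R_{ij}$ (a density of weight $2/n$), and let $$T_{ijkl}=\tfrac12(R_{ij[kl]}+R_{kl[ij]}),\qquad T_{ijk}{}^l=h^{lp}T_{ijkp},\qquad U_{ijkl}=\tfrac34(B_{i(jkl)}-B_{j(ikl)}),$$ with $B_{ijkl}=R_{ijkl}-F_{ij}h_{kl}+F_{k[i}h_{j]l}-F_{l[i}h_{j]k}$. With $E_{ij}=-\tfrac1n h^{pq}U_{pijq}$, let $E_{ijkl}=U_{ijkl}+2h_{l[i}E_{j]k}+2h_{k[i}E_{j]l}$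 (the completely trace-free part of $U_{ijkl}$). Two connections are projectively equivalent if the symmetric part of their difference tensor is pure trace, i.e. of the form $2\sigma_{(i}\delta_{j)}{}^k$. A pair $([\nabla],[h])$ of a projective structure and a conformal structure has a unique torsion-free representative $\nabla\in[\nabla]$ which is aligned, i.e. satisfies $n h^{pq}\nabla_ph_{qi}=h^{pq}\nabla_ih_{pq}$; the curvature of the pair is that of $\nabla$. The pair is an *AH structure* if the completely trace-free part of $\tfrac23(\nabla_ih_{jk}-\nabla_jh_{ik})$ vanishes. It is *exact* if $\nabla|\det h|=0$ for some $h\in[h]$, which is then called a *distinguished* metric. It is *Einstein* if the symmetric trace-free parts of $R_{ij}$ and $Q_{ij}$ vanish and $\nabla_iR+nH^{pq}\nabla_qF_{ip}=0$. The *conjugate* AH structure is $([\nabla+\mathcal L],[h])$, where $\mathcal L_{ij}{}^k=h^{kp}\mathcal L_{ijp}$ and $\mathcal L_{ijk}$ is the completely trace-free part of $\nabla_{(i}h_{jk)}$. The pair is *projectively flat* if $[\nabla]$ is locally represented by flat torsion-free connections, and *conjugate projectively flat* if its conjugate is projectively flat. A *para-Kähler structure* on a $2n$-manifold $N$ is a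 pseudo-Riemannian metric $G$ and an integrable endomorphism field $A$ with $A^2=1$, whose $\pm1$ eigenbundles $T^\pm$ have equal rank, such that $\Omega(X,Y)=G(AX,Y)$ is skew-symmetric and closed; $\widehat\nabla$ is the Levi-Civita connection of $G$. It has *constant para-holomorphic sectional curvature $4c$* if $$\widehat R(X,Y)Z=c\,\big(G(Y,Z)X-G(X,Z)Y-\Omega(Y,Z)AX+\Omega(X,Z)AY+2\Omega(X,Y)AZ\big).$$ A Lagrangian immersion $i:M\to N$ of an $n$-manifold ($i^*\Omega=0$) is *positive definite* if $h=i^*G$ is positive definite. Its second fundamental form is $\Pi(X,Y,Z)=\Omega(\widehat\nabla_XTi(Y),Ti(Z))$, and it has *mean curvature zero* if $h^{jk}\Pi_{ijk}=0$. The AH structure *induced* on $M$ is $([\nabla],[h])$, where $Ti(\nabla_XY)$ is the projection of $\widehat\nabla_XTi(Y)$ onto $Ti(TM)$ along $T^-$. **Theorem.** Let $n\ge2$ and let $i:M\to N$ be a positive definite, mean curvature zero Lagrangian immersion of an $n$-manifold into a $2n$-dimensional para-Kähler manifold of constant para-holomorphic sectional curvature $4c$. Then the induced AH structure $([\nabla],[h])$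 on $M$ is exact and Einstein, the induced metric $h=i^*G$ is a distinguished metric, and $$R=n(n-1)\,c\,|\det h|^{1/n},\qquad T_{ijk}{}^l=2c\,\delta_{[i}{}^lh_{j]k},\qquad E_{ijkl}\equiv0 .$$ If $n>2$, then $([\nabla],[h])$ is projectively flat and conjugate projectively flat. -/

import Mathlib

set_option linter.unusedSectionVars false

open Bundle FiberBundle
open scoped Manifold ContDiff

noncomputable section

/-! ### Affine connections and coordinate frames -/

section Connections

variable {n : ℕ} {M : Type*} [TopologicalSpace M] [ChartedSpace (EuclideanSpace ℝ (Fin n)) M]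

/-- The tangent space at `x` of an `n`-dimensional manifold. -/
abbrev Tan (n : ℕ) {M : Type*} [TopologicalSpace M]
    [ChartedSpace (EuclideanSpace ℝ (Fin n)) M] (x : M) : Type :=
  TangentSpace (𝓡 n) x

/-- The `i`th coordinate vector at `x` of the preferred chart around `x`. -/
def coordVec (x : M) (i : Fin n) : Tan n x :=
  (EuclideanSpace.single i (1 : ℝ) : EuclideanSpace ℝ (Fin n))

/-- The `k`th component of a tangent vector at `x` in the preferred chart around `x`. -/
def coord (x : M) (k : Fin n) : Tan n x →L[ℝ] ℝ :=
  (EuclideanSpace.proj k : EuclideanSpace ℝ (Fin n) →L[ℝ] ℝ)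

/-- The `k`th partial derivative at `x` in the preferred chart around `x`. -/
def pderiv (f : M → ℝ) (x : M) (k : Fin n) : ℝ :=
  mvfderiv (𝓡 n) f x (coordVec x k)

variable [IsManifold (𝓡 n) ∞ M]

/-- An affine connection: a covariant derivative on the tangent bundle; `∇ Y x v` is `∇_v Y`. -/
abbrev AffineConnection (n : ℕ) (M : Type*) [TopologicalSpace M]
    [ChartedSpace (EuclideanSpace ℝ (Fin n)) M] [IsManifold (𝓡 n) ∞ M] :=
  CovariantDerivative (𝓡 n) (EuclideanSpace ℝ (Fin n)) (fun x : M => TangentSpace (𝓡 n) x)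

/-- A vector field extending `v`, constant in the preferred chart around the base point of `v`. -/
def extendVec {x : M} (v : Tan n x) : Π y : M, Tan n y :=
  extend (EuclideanSpace ℝ (Fin n)) v

/-- The `i`th coordinate vector field of the preferred chart around `x`. -/
def frame (x : M) (i : Fin n) : Π y : M, Tan n y := extendVec (coordVec x i)

/-- Differentiability of a vector field at a point. -/
def VDiffAt (Y : Π x : M, Tan n x) (x : M) : Prop :=
  MDifferentiableAt (𝓡 n) ((𝓡 n).prod 𝓘(ℝ, EuclideanSpace ℝ (Fin n)))
    (fun y => TotalSpace.mk' (EuclideanSpace ℝ (Fin n)) y (Y y)) x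

end Connections

/-! ### Vector fields along maps -/

section Along

variable {m d : ℕ} {P : Type*} [TopologicalSpace P] [ChartedSpace (EuclideanSpace ℝ (Fin m)) P]
  {N : Type*} [TopologicalSpace N] [ChartedSpace (EuclideanSpace ℝ (Fin d)) N]
  [IsManifold (𝓡 d) ∞ N]

/-- Differentiability at a point of a vector field along a map. -/
def VDiffAlongAt (m : ℕ) {d : ℕ} {P : Type*} [TopologicalSpace P]
    [ChartedSpace (EuclideanSpace ℝ (Fin m)) P] {N : Type*} [TopologicalSpace N]
    [ChartedSpace (EuclideanSpace ℝ (Fin d)) N] [IsManifold (𝓡 d) ∞ N] (f : P → N) (s : Π x : P, Tan d (f x)) (x : P) : Prop :=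
  MDifferentiableAt (𝓡 m) ((𝓡 d).prod 𝓘(ℝ, EuclideanSpace ℝ (Fin d)))
    (fun y => TotalSpace.mk' (EuclideanSpace ℝ (Fin d)) (f y) (s y)) x

/-- The derivative at `x` of the components, in the preferred chart around `f x`, of a vector
field along `f`. -/
def chartDerivAlong (m : ℕ) {d : ℕ} {P : Type*} [TopologicalSpace P]
    [ChartedSpace (EuclideanSpace ℝ (Fin m)) P] {N : Type*} [TopologicalSpace N]
    [ChartedSpace (EuclideanSpace ℝ (Fin d)) N] [IsManifold (𝓡 d) ∞ N] (f : P → N) (s : Π x : P, Tan d (f x)) (x : P) :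
    Tan m x →L[ℝ] Tan d (f x) :=
  mvfderiv (𝓡 m)
    (fun y => (trivializationAt (EuclideanSpace ℝ (Fin d)) (TangentSpace (𝓡 d) : N → Type _) (f x)
      ⟨f y, s y⟩).2) x

theorem trivializationAt_self (x : N) (v : Tan d x) :
    (trivializationAt (EuclideanSpace ℝ (Fin d)) (TangentSpace (𝓡 d) : N → Type _) x
      ⟨x, v⟩).2 = v := by
  rw [TangentBundle.trivializationAt_apply]
  exact tangentCoordChange_self (I := 𝓡 d) (mem_extChartAt_source x)

theorem chartDerivAlong_add {f : P → N} {s s' : Π x : P, Tan d (f x)} {x : P}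
    (hs : VDiffAlongAt m f s x) (hs' : VDiffAlongAt m f s' x) :
    chartDerivAlong m f (fun y => s y + s' y) x = chartDerivAlong m f s x + chartDerivAlong m f s' x := by
  have h1 := (mdifferentiableAt_totalSpace _ _).1 hs
  have h2 := (mdifferentiableAt_totalSpace _ _).1 hs'
  have hn : ∀ᶠ y in nhds x, f y ∈ (trivializationAt (EuclideanSpace ℝ (Fin d))
      (TangentSpace (𝓡 d) : N → Type _) (f x)).baseSet :=
    h1.1.continuousAt.eventually_mem ((trivializationAt (EuclideanSpace ℝ (Fin d))
      (TangentSpace (𝓡 d) : N → Type _) (f x)).open_baseSet.mem_nhds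
        (mem_baseSet_trivializationAt' (f x)))
  have := mvfderiv_add h1.2 h2.2
  refine Eq.trans ?_ this
  unfold chartDerivAlong mvfderiv
  have he := Filter.EventuallyEq.mfderiv_eq (I := 𝓡 m) (I' := 𝓘(ℝ, EuclideanSpace ℝ (Fin d)))
    (f := fun y => (trivializationAt (EuclideanSpace ℝ (Fin d))
      (TangentSpace (𝓡 d) : N → Type _) (f x) ⟨f y, s y + s' y⟩).2)
    (f₁ := (fun y => (trivializationAt (EuclideanSpace ℝ (Fin d))
      (TangentSpace (𝓡 d) : N → Type _) (f x) ⟨f y, s y⟩).2) + (fun y =>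
      (trivializationAt (EuclideanSpace ℝ (Fin d))
      (TangentSpace (𝓡 d) : N → Type _) (f x) ⟨f y, s' y⟩).2)) (x := x) (by
    filter_upwards [hn] with y hy
    exact (((trivializationAt (EuclideanSpace ℝ (Fin d))
      (TangentSpace (𝓡 d) : N → Type _) (f x)).linear ℝ hy).map_add (s y) (s' y)).symm)
  ext1 v
  exact (congrArg (fun L => L v) he).symm

theorem chartDerivAlong_smul {f : P → N} {s : Π x : P, Tan d (f x)} {g : P → ℝ} {x : P}
    (hs : VDiffAlongAt m f s x) (hg : MDifferentiableAt (𝓡 m) 𝓘(ℝ, ℝ) g x) :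
    chartDerivAlong m f (fun y => g y • s y) x
      = g x • chartDerivAlong m f s x + (mvfderiv (𝓡 m) g x).smulRight (s x) := by
  have h1 := (mdifferentiableAt_totalSpace _ _).1 hs
  have hn : ∀ᶠ y in nhds x, f y ∈ (trivializationAt (EuclideanSpace ℝ (Fin d))
      (TangentSpace (𝓡 d) : N → Type _) (f x)).baseSet :=
    h1.1.continuousAt.eventually_mem ((trivializationAt (EuclideanSpace ℝ (Fin d))
      (TangentSpace (𝓡 d) : N → Type _) (f x)).open_baseSet.mem_nhds
        (mem_baseSet_trivializationAt' (f x)))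
  have := mvfderiv_smul hg h1.2
  have he := Filter.EventuallyEq.mfderiv_eq (I := 𝓡 m) (I' := 𝓘(ℝ, EuclideanSpace ℝ (Fin d)))
    (f := fun y => (trivializationAt (EuclideanSpace ℝ (Fin d))
      (TangentSpace (𝓡 d) : N → Type _) (f x) ⟨f y, g y • s y⟩).2)
    (f₁ := g • (fun y => (trivializationAt (EuclideanSpace ℝ (Fin d))
      (TangentSpace (𝓡 d) : N → Type _) (f x) ⟨f y, s y⟩).2)) (x := x) (by
    filter_upwards [hn] with y hy
    exact (((trivializationAt (EuclideanSpace ℝ (Fin d))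
      (TangentSpace (𝓡 d) : N → Type _) (f x)).linear ℝ hy).map_smul (g y) (s y)).symm)
  ext1 v
  refine (congrArg (fun L => L v) he).symm.trans ?_
  refine (congrArg (fun L => L v) this).trans ?_
  have h3 := trivializationAt_self (f x) (s x)
  simp only [add_apply, smul_apply,
    ContinuousLinearMap.smulRight_apply]
  rw [h3]
  rfl

end Along

section Connections2

variable {n : ℕ} {M : Type*} [TopologicalSpace M] [ChartedSpace (EuclideanSpace ℝ (Fin n)) M]
  [IsManifold (𝓡 n) ∞ M]

/-- The bilinear map of `T_x M` with components `C i j k`, acting as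
`(w, v) ↦ v^i w^j C i j k ∂_k`. The first slot is the vector field being differentiated. -/
def bilinOfCoeff (x : M) (C : Fin n → Fin n → Fin n → ℝ) : Tan n x →L[ℝ] Tan n x →L[ℝ] Tan n x :=
  ∑ i, ∑ j, ∑ k, C i j k • (coord x j).smulRight ((coord x i).smulRight (coordVec x k))

/-- The directional derivative, at each `x`, of the components in the preferred chart
around `x`. -/
def chartConnection : AffineConnection n M where
  toFun Y x := chartDerivAlong n (fun y : M => y) Y x
  isCovariantDerivativeOnUniv :=
    { add := fun hσ hσ' _ => chartDerivAlong_add hσ hσ'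
      leibniz := fun hσ hg _ => chartDerivAlong_smul hσ hg }

/-- The curvature `R(u, v) w = ∇_u ∇_v w - ∇_v ∇_u w - ∇_{[u, v]} w`. -/
def curvature (D : AffineConnection n M) (x : M) (u v w : Tan n x) : Tan n x :=
  D (fun y => D (extendVec w) y (extendVec v y)) x u
    - D (fun y => D (extendVec w) y (extendVec u y)) x v
    - D (extendVec w) x (VectorField.mlieBracket (𝓡 n) (extendVec u) (extendVec v) x)

/-- The components `R_{ijk}^l`, where `R(∂_i, ∂_j) ∂_k = R_{ijk}^l ∂_l`. -/
def riem (D : AffineConnection n M) (x : M) (i j k l : Fin n) : ℝ :=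
  coord x l (curvature D x (coordVec x i) (coordVec x j) (coordVec x k))

end Connections2

/-! ### Induced connections -/

section Induced

variable {n d : ℕ} {M : Type*} [TopologicalSpace M] [ChartedSpace (EuclideanSpace ℝ (Fin n)) M]
  [IsManifold (𝓡 n) ∞ M]
  {N : Type*} [TopologicalSpace N] [ChartedSpace (EuclideanSpace ℝ (Fin d)) N]
  [IsManifold (𝓡 d) ∞ N]

instance instT2SpaceTan (x : M) : T2Space (Tan n x) :=
  FiberBundle.t2Space (EuclideanSpace ℝ (Fin n)) (TangentSpace (𝓡 n) : M → Type _) x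

instance instFiniteDimensionalTan (x : M) : FiniteDimensional ℝ (Tan n x) :=
  VectorBundle.finiteDimensional ℝ (EuclideanSpace ℝ (Fin n)) (TangentSpace (𝓡 n) : M → Type _) x

theorem vDiffAt_extendVec {x : M} (v : Tan n x) : VDiffAt (extendVec v) x :=
  mdifferentiableAt_extend (𝓡 n) (EuclideanSpace ℝ (Fin n)) v

theorem connection_extendVec_add (D : AffineConnection n M) (x : M) (v w : Tan n x) :
    D (extendVec (v + w)) x = D (extendVec v) x + D (extendVec w) x := by
  have h := D.isCovariantDerivativeOnUniv.add (vDiffAt_extendVec v) (vDiffAt_extendVec w)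
  rw [← h]
  refine D.isCovariantDerivativeOnUniv.congr_of_eventuallyEq (vDiffAt_extendVec (v + w))
    (mdifferentiableAt_add_section (vDiffAt_extendVec v) (vDiffAt_extendVec w))
    Filter.univ_mem ?_
  have hb := (trivializationAt (EuclideanSpace ℝ (Fin n))
      (TangentSpace (𝓡 n) : M → Type _) x).open_baseSet.mem_nhds
        (mem_baseSet_trivializationAt' x)
  filter_upwards [hb] with y hy
  simp only [extendVec, extend, Pi.add_apply]
  rw [← Trivialization.symmₗ_apply (R := ℝ) _ hy, ← Trivialization.symmₗ_apply (R := ℝ) _ hy,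
    ← Trivialization.symmₗ_apply (R := ℝ) _ hy, ← map_add]
  congr 1
  exact ((trivializationAt (EuclideanSpace ℝ (Fin n))
      (TangentSpace (𝓡 n) : M → Type _) x).linear ℝ
      (mem_baseSet_trivializationAt' x)).map_add v w

theorem connection_extendVec_smul (D : AffineConnection n M) (x : M) (a : ℝ) (v : Tan n x) :
    D (extendVec (a • v)) x = a • D (extendVec v) x := by
  have h := D.isCovariantDerivativeOnUniv.smul_const a (vDiffAt_extendVec v)
  rw [← h]
  refine D.isCovariantDerivativeOnUniv.congr_of_eventuallyEq (vDiffAt_extendVec (a • v))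
    (MDifferentiableAt.smul_const_section (a := a) (vDiffAt_extendVec v))
    Filter.univ_mem ?_
  have hb := (trivializationAt (EuclideanSpace ℝ (Fin n))
      (TangentSpace (𝓡 n) : M → Type _) x).open_baseSet.mem_nhds
        (mem_baseSet_trivializationAt' x)
  filter_upwards [hb] with y hy
  simp only [extendVec, extend, Pi.smul_apply]
  rw [← Trivialization.symmₗ_apply (R := ℝ) _ hy, ← Trivialization.symmₗ_apply (R := ℝ) _ hy,
    ← map_smul]
  congr 1
  exact ((trivializationAt (EuclideanSpace ℝ (Fin n))
      (TangentSpace (𝓡 n) : M → Type _) x).linear ℝ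
      (mem_baseSet_trivializationAt' x)).map_smul a v

/-- The derivative of a vector field `s` along `f` with respect to the connection induced by `D`
on the pullback of the tangent bundle: writing `s` as `s^a ∂_a` in a chart around `f x`, it is
`v ↦ v(s^a) ∂_a + s^a D_{df(v)} ∂_a`. -/
def alongDeriv (n : ℕ) {d : ℕ} {M : Type*} [TopologicalSpace M]
    [ChartedSpace (EuclideanSpace ℝ (Fin n)) M] {N : Type*} [TopologicalSpace N]
    [ChartedSpace (EuclideanSpace ℝ (Fin d)) N] [IsManifold (𝓡 d) ∞ N]
    (D : AffineConnection d N) (f : M → N) (s : Π x : M, Tan d (f x)) (x : M) :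
    Tan n x →L[ℝ] Tan d (f x) :=
  chartDerivAlong n f s x + (D (extendVec (s x)) (f x)).comp (mfderiv (𝓡 n) (𝓡 d) f x)

theorem alongDeriv_add (D : AffineConnection d N) {f : M → N} {s s' : Π x : M, Tan d (f x)} {x : M}
    (hs : VDiffAlongAt n f s x) (hs' : VDiffAlongAt n f s' x) :
    alongDeriv n D f (fun y => s y + s' y) x = alongDeriv n D f s x + alongDeriv n D f s' x := by
  unfold alongDeriv
  rw [chartDerivAlong_add hs hs', connection_extendVec_add, ContinuousLinearMap.add_comp]
  abel

theorem alongDeriv_smul (D : AffineConnection d N) {f : M → N} {s : Π x : M, Tan d (f x)}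
    {g : M → ℝ} {x : M}
    (hs : VDiffAlongAt n f s x) (hg : MDifferentiableAt (𝓡 n) 𝓘(ℝ, ℝ) g x) :
    alongDeriv n D f (fun y => g y • s y) x
      = g x • alongDeriv n D f s x + (mvfderiv (𝓡 n) g x).smulRight (s x) := by
  unfold alongDeriv
  rw [chartDerivAlong_smul hs hg, connection_extendVec_smul, ContinuousLinearMap.smul_comp,
    smul_add]
  abel

/-- The vector field along `f` which is the image of `Y` under the differential of `f`. -/
def pushAlong (n d : ℕ) {M : Type*} [TopologicalSpace M]
    [ChartedSpace (EuclideanSpace ℝ (Fin n)) M] {N : Type*} [TopologicalSpace N]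
    [ChartedSpace (EuclideanSpace ℝ (Fin d)) N]
    (f : M → N) (Y : Π x : M, Tan n x) : Π x : M, Tan d (f x) :=
  fun x => mfderiv (𝓡 n) (𝓡 d) f x (Y x)

theorem vDiffAlongAt_pushAlong {f : M → N} (hf : ContMDiff (𝓡 n) (𝓡 d) ∞ f)
    {Y : Π x : M, Tan n x} {x : M} (hY : VDiffAt Y x) : VDiffAlongAt n f (pushAlong n d f Y) x := by
  have h := hf.contMDiff_tangentMap (m := 1) (by norm_cast)
  exact (h.mdifferentiable one_ne_zero _).comp x hY

/-- The connection induced on `M` by a connection `D` on `N`, an immersion `f`, and subspaces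
`V x` complementary to the images of the differential: the derivative of the image of `Y` is
projected onto the image of the differential along `V`. -/
def inducedConnection (D : AffineConnection d N) (f : M → N) (hf : ContMDiff (𝓡 n) (𝓡 d) ∞ f)
    (hinj : ∀ x, Function.Injective (mfderiv (𝓡 n) (𝓡 d) f x))
    (V : Π x : M, Submodule ℝ (Tan d (f x)))
    (hV : ∀ x, IsCompl (LinearMap.range (mfderiv (𝓡 n) (𝓡 d) f x).toLinearMap) (V x)) :
    AffineConnection n M where
  toFun Y x := (LinearMap.toContinuousLinearMap (LinearMap.linearProjOfIsCompl (V x)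
    (mfderiv (𝓡 n) (𝓡 d) f x).toLinearMap (hinj x) (hV x))).comp
      (alongDeriv n D f (pushAlong n d f Y) x)
  isCovariantDerivativeOnUniv :=
    { add := by
        intro Y Y' x hY hY' _
        have h := alongDeriv_add D (vDiffAlongAt_pushAlong hf hY) (vDiffAlongAt_pushAlong hf hY')
        have e : pushAlong n d f (Y + Y') = fun y => pushAlong n d f Y y + pushAlong n d f Y' y := by
          funext y; exact map_add _ _ _
        rw [e, h, ContinuousLinearMap.comp_add]
      leibniz := by
        intro Y g x hY hg _
        have h := alongDeriv_smul D (vDiffAlongAt_pushAlong hf hY) hg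
        have e : pushAlong n d f (g • Y) = fun y => g y • pushAlong n d f Y y := by
          funext y; exact (mfderiv (𝓡 n) (𝓡 d) f y).map_smul (g y) (Y y)
        rw [e, h, ContinuousLinearMap.comp_add, ContinuousLinearMap.comp_smul]
        congr 1
        ext1 v
        simp only [ContinuousLinearMap.comp_apply, ContinuousLinearMap.smulRight_apply, map_smul]
        congr 1
        exact LinearMap.linearProjOfIsCompl_apply_left _ _ (hinj x) (hV x) (Y x) }

end Induced

/-! ### Pseudo-Riemannian metrics -/

section Metrics

/-- A smooth pseudo-Riemannian metric. -/
structure PseudoRiemannianMetric (n : ℕ) (M : Type*) [TopologicalSpace M]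
    [ChartedSpace (EuclideanSpace ℝ (Fin n)) M] [IsManifold (𝓡 n) ∞ M] where
  inner (x : M) : Tan n x →L[ℝ] Tan n x →L[ℝ] ℝ
  symm (x : M) (v w : Tan n x) : inner x v w = inner x w v
  nondegenerate (x : M) (v : Tan n x) (hv : ∀ w, inner x v w = 0) : v = 0
  contMDiff : ContMDiff (𝓡 n)
    ((𝓡 n).prod 𝓘(ℝ, EuclideanSpace ℝ (Fin n) →L[ℝ] EuclideanSpace ℝ (Fin n) →L[ℝ] ℝ)) ∞
    (fun x => TotalSpace.mk'
      (EuclideanSpace ℝ (Fin n) →L[ℝ] EuclideanSpace ℝ (Fin n) →L[ℝ] ℝ) x (inner x))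

variable {n d : ℕ} {M : Type*} [TopologicalSpace M] [ChartedSpace (EuclideanSpace ℝ (Fin n)) M]
  [IsManifold (𝓡 n) ∞ M]
  {N : Type*} [TopologicalSpace N] [ChartedSpace (EuclideanSpace ℝ (Fin d)) N]
  [IsManifold (𝓡 d) ∞ N]

theorem contMDiff_bilin_of_extendVec (B : Π x : M, Tan n x →L[ℝ] Tan n x →L[ℝ] ℝ)
    (hB : ∀ (x : M) (v w : Tan n x),
      ContMDiffAt (𝓡 n) 𝓘(ℝ, ℝ) ∞ (fun y => B y (extendVec v y) (extendVec w y)) x) :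
    ContMDiff (𝓡 n)
      ((𝓡 n).prod 𝓘(ℝ, EuclideanSpace ℝ (Fin n) →L[ℝ] EuclideanSpace ℝ (Fin n) →L[ℝ] ℝ)) ∞
      (fun x => TotalSpace.mk'
        (EuclideanSpace ℝ (Fin n) →L[ℝ] EuclideanSpace ℝ (Fin n) →L[ℝ] ℝ) x (B x)) := by
  intro x
  rw [contMDiffAt_hom_bundle]
  refine ⟨contMDiffAt_id, ?_⟩
  have key : ContMDiffAt (𝓡 n) 𝓘(ℝ, EuclideanSpace ℝ (Fin n) →L[ℝ] EuclideanSpace ℝ (Fin n) →L[ℝ] ℝ) ∞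
      (fun y : M => ∑ i, ∑ j, (B y (extendVec (coordVec x i) y) (extendVec (coordVec x j) y)) •
        ((EuclideanSpace.proj i : EuclideanSpace ℝ (Fin n) →L[ℝ] ℝ).smulRight
          (EuclideanSpace.proj j : EuclideanSpace ℝ (Fin n) →L[ℝ] ℝ))) x := by
    refine ContMDiffAt.sum fun i _ => ContMDiffAt.sum fun j _ => ?_
    exact (hB x _ _).smul contMDiffAt_const
  refine key.congr_of_eventuallyEq ?_
  have hb := (trivializationAt (EuclideanSpace ℝ (Fin n))
      (TangentSpace (𝓡 n) : M → Type _) x).open_baseSet.mem_nhds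
        (mem_baseSet_trivializationAt' x)
  filter_upwards [hb] with y hy
  ext v w
  refine (inCoordinates_apply_eq₂ hy hy (by simp)).trans ?_
  have hx := mem_baseSet_trivializationAt' (F := EuclideanSpace ℝ (Fin n))
    (E := (TangentSpace (𝓡 n) : M → Type _)) x
  have he : ∀ u : EuclideanSpace ℝ (Fin n),
      (trivializationAt (EuclideanSpace ℝ (Fin n)) (TangentSpace (𝓡 n) : M → Type _) x).symm y u
        = ∑ i, u i • extendVec (coordVec x i) y := by
    intro u
    have hu : u = ∑ i, u i • (EuclideanSpace.single i (1 : ℝ)) := by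
      ext k
      simp [Finset.sum_apply, Pi.single_apply]
    conv_lhs => rw [hu]
    rw [← Trivialization.symmₗ_apply (R := ℝ) _ hy, map_sum]
    refine Finset.sum_congr rfl fun i _ => ?_
    rw [map_smul, Trivialization.symmₗ_apply (R := ℝ) _ hy]
    congr 1
    simp only [extendVec, extend]
    rw [trivializationAt_self]
    rfl
  rw [he v, he w]
  refine (show _ = B y (∑ i, v i • extendVec (coordVec x i) y)
    (∑ j, w j • extendVec (coordVec x j) y) by simp).trans ?_
  simp only [map_sum, map_smul, sum_apply, smul_apply, ContinuousLinearMap.smulRight_apply,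
    smul_eq_mul, Finset.mul_sum]
  rw [Finset.sum_comm]
  refine Finset.sum_congr rfl fun i _ => Finset.sum_congr rfl fun j _ => ?_
  change w j * (v i * _) = _ * (v i * w j)
  ring

/-- The pullback of a covariant two-tensor. -/
def pullbackForm (n d : ℕ) {M : Type*} [TopologicalSpace M]
    [ChartedSpace (EuclideanSpace ℝ (Fin n)) M]
    {N : Type*} [TopologicalSpace N] [ChartedSpace (EuclideanSpace ℝ (Fin d)) N]
    (f : M → N) (B : Π p : N, Tan d p →L[ℝ] Tan d p →L[ℝ] ℝ)
    (x : M) : Tan n x →L[ℝ] Tan n x →L[ℝ] ℝ :=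
  (ContinuousLinearMap.precomp ℝ (mfderiv (𝓡 n) (𝓡 d) f x)).comp
    ((B (f x)).comp (mfderiv (𝓡 n) (𝓡 d) f x))

theorem pullbackForm_apply (f : M → N) (B : Π p : N, Tan d p →L[ℝ] Tan d p →L[ℝ] ℝ)
    (x : M) (v w : Tan n x) :
    pullbackForm n d f B x v w
      = B (f x) (mfderiv (𝓡 n) (𝓡 d) f x v) (mfderiv (𝓡 n) (𝓡 d) f x w) := rfl

/-- The metric induced by a nondegenerate map. -/
def PseudoRiemannianMetric.pullback (G : PseudoRiemannianMetric d N) (f : M → N)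
    (hf : ContMDiff (𝓡 n) (𝓡 d) ∞ f)
    (hnd : ∀ (x : M) (v : Tan n x), (∀ w, pullbackForm n d f G.inner x v w = 0) → v = 0) :
    PseudoRiemannianMetric n M where
  inner := pullbackForm n d f G.inner
  symm x v w := G.symm _ _ _
  nondegenerate := hnd
  contMDiff := by
    refine contMDiff_bilin_of_extendVec _ fun x v w => ?_
    have hT := hf.contMDiff_tangentMap (m := ∞) (by norm_cast)
    have hs : ∀ u : Tan n x, ContMDiffAt (𝓡 n) ((𝓡 d).prod 𝓘(ℝ, EuclideanSpace ℝ (Fin d))) ∞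
        (fun y => TotalSpace.mk' (EuclideanSpace ℝ (Fin d)) (f y)
          (mfderiv (𝓡 n) (𝓡 d) f y (extendVec u y))) x := fun u =>
      (hT _).comp x (contMDiffAt_extend (𝓡 n) (EuclideanSpace ℝ (Fin n)) u)
    have h := ContMDiffAt.clm_bundle_apply₂ (b := f) (E₃ := fun _ => ℝ) (F₃ := ℝ)
      ((G.contMDiff (f x)).comp x (hf x)) (hs v) (hs w)
    have := (contMDiffAt_totalSpace.1 h).2
    exact this

end Metrics

/-! ### Local components of a metric and the Levi-Civita connection -/

section LeviCivita

variable {n : ℕ} {M : Type*} [TopologicalSpace M] [ChartedSpace (EuclideanSpace ℝ (Fin n)) M]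
  [IsManifold (𝓡 n) ∞ M]

/-- The matrix of components of `g` at `y`, in the coordinate frame of the preferred chart
around `x`. -/
def gram (g : PseudoRiemannianMetric n M) (x y : M) : Matrix (Fin n) (Fin n) ℝ :=
  Matrix.of fun i j => g.inner y (frame x i y) (frame x j y)

/-- The components of `g` at `x` in the preferred chart around `x`. -/
def lower (g : PseudoRiemannianMetric n M) (x : M) (i j : Fin n) : ℝ := gram g x x i j

/-- The components at `x` of the inverse of `g` in the preferred chart around `x`. -/
def upper (g : PseudoRiemannianMetric n M) (x : M) (i j : Fin n) : ℝ := (gram g x x)⁻¹ i j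

/-- The Christoffel symbols `Γ_{ij}^k` at `x`, in the preferred chart around `x`. -/
def christoffel (g : PseudoRiemannianMetric n M) (x : M) (i j k : Fin n) : ℝ :=
  (1 / 2) * ∑ l, upper g x k l *
    (pderiv (fun y => gram g x y j l) x i + pderiv (fun y => gram g x y i l) x j
      - pderiv (fun y => gram g x y i j) x l)

/-- The Levi-Civita connection. -/
def leviCivita (g : PseudoRiemannianMetric n M) : AffineConnection n M :=
  chartConnection.addOneForm fun x => bilinOfCoeff x (christoffel g x)

end LeviCivita

/-! ### Tensors built from a connection and a metric -/

section Tensors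

variable {n : ℕ} {M : Type*} [TopologicalSpace M] [ChartedSpace (EuclideanSpace ℝ (Fin n)) M]
  [IsManifold (𝓡 n) ∞ M]

/-- The covariant derivative of a covariant two-tensor:
`(∇_u B)(v, w) = u (B(V, W)) - B(∇_u V, w) - B(v, ∇_u W)`. -/
def covDerivForm (D : AffineConnection n M) (B : Π y : M, Tan n y → Tan n y → ℝ) (x : M)
    (u v w : Tan n x) : ℝ :=
  mvfderiv (𝓡 n) (fun y => B y (extendVec v y) (extendVec w y)) x u
    - B x (D (extendVec v) x u) w - B x v (D (extendVec w) x u)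

/-- The components `∇_i h_{jk}`. -/
def nablaMetric (D : AffineConnection n M) (h : PseudoRiemannianMetric n M) (x : M)
    (i j k : Fin n) : ℝ :=
  covDerivForm D (fun y v w => h.inner y v w) x (coordVec x i) (coordVec x j) (coordVec x k)

/-- The covariant derivative `∇_i ρ` at `x` of a density of weight `a`, where `ρ` is the
component of the density with respect to the preferred chart around `x`. -/
def covDerivDensity (D : AffineConnection n M) (a : ℝ) (ρ : M → ℝ) (x : M) (i : Fin n) : ℝ :=
  pderiv ρ x i - a * (∑ p, coord x p (D (frame x p) x (coordVec x i))) * ρ x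

/-- The complete symmetrization of a three-index array. -/
def sym3 {n : ℕ} (A : Fin n → Fin n → Fin n → ℝ) (i j k : Fin n) : ℝ :=
  (A i j k + A i k j + A j i k + A j k i + A k i j + A k j i) / 6

/-- Alignment: `n h^{pq} ∇_p h_{qi} = h^{pq} ∇_i h_{pq}`. -/
def IsAligned (D : AffineConnection n M) (h : PseudoRiemannianMetric n M) : Prop :=
  ∀ (x : M) (i : Fin n),
    n * ∑ p, ∑ q, upper h x p q * nablaMetric D h x p q i
      = ∑ p, ∑ q, upper h x p q * nablaMetric D h x i p q

/-- The completely trace-free, completely symmetric part of `∇_i h_{jk}`. -/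
def cubicTorsionLower (D : AffineConnection n M) (h : PseudoRiemannianMetric n M) (x : M)
    (i j k : Fin n) : ℝ :=
  let S := sym3 (nablaMetric D h x)
  let t : Fin n → ℝ := fun a => ∑ p, ∑ q, upper h x p q * S a p q
  S i j k - (1 / ((n : ℝ) + 2)) *
    (lower h x i j * t k + lower h x j k * t i + lower h x k i * t j)

/-- The cubic torsion `𝓛_{ij}^k`. -/
def cubicTorsion (D : AffineConnection n M) (h : PseudoRiemannianMetric n M) (x : M)
    (i j k : Fin n) : ℝ :=
  ∑ p, upper h x k p * cubicTorsionLower D h x i j p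

/-- The conformal torsion (with lowered index): the completely trace-free part of
`(2/3)(A_{i(jk)} - A_{j(ik)})`, where `A_{ijk} = ∇_i h_{jk}`. -/
def conformalTorsionLower (D : AffineConnection n M) (h : PseudoRiemannianMetric n M) (x : M)
    (i j k : Fin n) : ℝ :=
  let A := nablaMetric D h x
  let b : Fin n → ℝ := fun a =>
    ∑ p, ∑ q, upper h x p q * (A a p q - A p a q)
  (2 / 3) * (A i j k - A j i k
    + (1 / ((n : ℝ) - 1)) * (lower h x k i * b j - lower h x k j * b i))

/-- The Ricci tensor, the trace of `u ↦ R(u, v) w`. -/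
def ricci (D : AffineConnection n M) (x : M) (v w : Tan n x) : ℝ :=
  ∑ p, coord x p (curvature D x (coordVec x p) v w)

/-- The components `R_{ij} = R_{pij}^p`. -/
def ricciComp (D : AffineConnection n M) (x : M) (i j : Fin n) : ℝ :=
  ricci D x (coordVec x i) (coordVec x j)

/-- The curvature with lowered last index, `R_{ijkl} = R_{ijk}^p h_{pl}`. -/
def riemLower (D : AffineConnection n M) (h : PseudoRiemannianMetric n M) (x : M)
    (i j k l : Fin n) : ℝ :=
  ∑ p, riem D x i j k p * lower h x p l

/-- The second trace `Q_{ij} = h^{pq} R_{ipqj}` of the curvature. -/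
def secondRicci (D : AffineConnection n M) (h : PseudoRiemannianMetric n M) (x : M)
    (i j : Fin n) : ℝ :=
  ∑ p, ∑ q, upper h x p q * riemLower D h x i p q j

/-- The Faraday form `F`, where `n F(u, v)` is the trace of `w ↦ R(u, v) w`. -/
def faraday (D : AffineConnection n M) (x : M) (u v : Tan n x) : ℝ :=
  (1 / (n : ℝ)) * ∑ p, coord x p (curvature D x u v (coordVec x p))

/-- The components `F_{ij}`. -/
def faradayComp (D : AffineConnection n M) (x : M) (i j : Fin n) : ℝ :=
  faraday D x (coordVec x i) (coordVec x j)

/-- The trace-free symmetric part `Z_{(ij)} - (1/n) h^{pq} Z_{pq} h_{ij}` of a two-tensor. -/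
def tracefreeSym (h : PseudoRiemannianMetric n M) (x : M) (Z : Fin n → Fin n → ℝ)
    (i j : Fin n) : ℝ :=
  (Z i j + Z j i) / 2 - (1 / (n : ℝ)) * (∑ p, ∑ q, upper h x p q * Z p q) * lower h x i j

/-- The density `|det h|^{1/n}` of weight `2/n`: its component at `y` in the preferred chart
around `x`. -/
def detRoot (h : PseudoRiemannianMetric n M) (x y : M) : ℝ :=
  |(gram h x y).det| ^ (1 / (n : ℝ))

/-- The weighted scalar curvature `R = H^{ij} R_{ij}`, where `H^{ij} = |det h|^{1/n} h^{ij}`; it is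
a density of weight `2/n`, and this is its component at `y` in the preferred chart around `x`. -/
def weightedScalar (D : AffineConnection n M) (h : PseudoRiemannianMetric n M) (x y : M) : ℝ :=
  detRoot h x y * ∑ i, ∑ j, (gram h x y)⁻¹ i j * ricci D y (frame x i y) (frame x j y)

/-- The tensor `T_{ijkl} = (1/2)(R_{ij[kl]} + R_{kl[ij]})`. -/
def tTensorLower (D : AffineConnection n M) (h : PseudoRiemannianMetric n M) (x : M)
    (i j k l : Fin n) : ℝ :=
  let B := riemLower D h x
  (1 / 2) * ((B i j k l - B i j l k) / 2 + (B k l i j - B k l j i) / 2)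

/-- The tensor `T_{ijk}^l`. -/
def tTensor (D : AffineConnection n M) (h : PseudoRiemannianMetric n M) (x : M)
    (i j k l : Fin n) : ℝ :=
  ∑ p, upper h x l p * tTensorLower D h x i j k p

/-- The tensor `U_{ijkl} = (3/4)(B_{i(jkl)} - B_{j(ikl)})`, where
`B_{ijkl} = R_{ijkl} - (F_{ij} h_{kl} - F_{k[i} h_{j]l} + F_{l[i} h_{j]k})`. -/
def uTensor (D : AffineConnection n M) (h : PseudoRiemannianMetric n M) (x : M)
    (i j k l : Fin n) : ℝ :=
  let F := faradayComp D x
  let g := lower h x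
  let B : Fin n → Fin n → Fin n → Fin n → ℝ := fun i j k l =>
    riemLower D h x i j k l
      - (F i j * g k l - (F k i * g j l - F k j * g i l) / 2 + (F l i * g j k - F l j * g i k) / 2)
  (3 / 4) * (sym3 (B i) j k l - sym3 (B j) i k l)

/-- The trace `E_{ij} = -(1/n) U_{pij}^p`. -/
def eTrace (D : AffineConnection n M) (h : PseudoRiemannianMetric n M) (x : M)
    (i j : Fin n) : ℝ :=
  -(1 / (n : ℝ)) * ∑ p, ∑ q, upper h x p q * uTensor D h x p i j q

/-- The completely trace-free part `E_{ijkl} = U_{ijkl} + 2 h_{l[i} E_{j]k} + 2 h_{k[i} E_{j]l}` of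
`U_{ijkl}`. -/
def eTensor (D : AffineConnection n M) (h : PseudoRiemannianMetric n M) (x : M)
    (i j k l : Fin n) : ℝ :=
  let e := eTrace D h x
  let g := lower h x
  uTensor D h x i j k l + (g l i * e j k - g l j * e i k) + (g k i * e j l - g k j * e i l)

end Tensors

/-! ### Projective structures, conformal structures and AH structures -/

section AHStructures

variable {n : ℕ} {M : Type*} [TopologicalSpace M] [ChartedSpace (EuclideanSpace ℝ (Fin n)) M]
  [IsManifold (𝓡 n) ∞ M]

/-- The difference tensor `(u, v) ↦ D'_u v - D_u v` of two connections. -/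
def diffTensor (D' D : AffineConnection n M) (x : M) (u v : Tan n x) : Tan n x :=
  D' (extendVec v) x u - D (extendVec v) x u

/-- Projective equivalence on a set `U`: the symmetric part of the difference tensor is pure
trace. -/
def ProjEquivOn (D D' : AffineConnection n M) (U : Set M) : Prop :=
  ∃ σ : Π x : M, Tan n x →L[ℝ] ℝ, ∀ x ∈ U, ∀ u v : Tan n x,
    diffTensor D' D x u v + diffTensor D' D x v u = (2 : ℝ) • (σ x u • v + σ x v • u)

/-- Projective equivalence of affine connections. -/
def projSetoid (n : ℕ) (M : Type*) [TopologicalSpace M]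
    [ChartedSpace (EuclideanSpace ℝ (Fin n)) M] [IsManifold (𝓡 n) ∞ M] :
    Setoid (AffineConnection n M) where
  r D D' := ProjEquivOn D D' Set.univ
  iseqv :=
    { refl := fun D => ⟨fun _ => 0, fun x _ u v => by simp [diffTensor]⟩
      symm := by
        rintro D D' ⟨σ, h⟩
        refine ⟨fun x => -σ x, fun x hx u v => ?_⟩
        have := h x hx u v
        have e : diffTensor D D' x u v + diffTensor D D' x v u
            = -(diffTensor D' D x u v + diffTensor D' D x v u) := by
          simp only [diffTensor]; abel
        rw [e, this]
        simp only [neg_apply]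
        module
      trans := by
        rintro D D' D'' ⟨σ, h⟩ ⟨σ', h'⟩
        refine ⟨fun x => σ x + σ' x, fun x hx u v => ?_⟩
        have e : diffTensor D'' D x u v + diffTensor D'' D x v u
            = (diffTensor D' D x u v + diffTensor D' D x v u)
              + (diffTensor D'' D' x u v + diffTensor D'' D' x v u) := by
          simp only [diffTensor]; abel
        rw [e, h x hx u v, h' x hx u v]
        simp only [add_apply]
        module }

/-- A projective structure: a projective equivalence class of affine connections. -/
abbrev ProjectiveStructure (n : ℕ) (M : Type*) [TopologicalSpace M]
    [ChartedSpace (EuclideanSpace ℝ (Fin n)) M] [IsManifold (𝓡 n) ∞ M] :=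
  Quotient (projSetoid n M)

/-- Conformal equivalence of metrics: they differ by a positive smooth factor. -/
def confSetoid (n : ℕ) (M : Type*) [TopologicalSpace M]
    [ChartedSpace (EuclideanSpace ℝ (Fin n)) M] [IsManifold (𝓡 n) ∞ M] :
    Setoid (PseudoRiemannianMetric n M) where
  r h h' := ∃ f : M → ℝ, ContMDiff (𝓡 n) 𝓘(ℝ, ℝ) ∞ f ∧ (∀ x, 0 < f x) ∧
    ∀ x, h'.inner x = f x • h.inner x
  iseqv :=
    { refl := fun h => ⟨fun _ => 1, contMDiff_const, fun _ => one_pos, fun x => by simp⟩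
      symm := by
        rintro h h' ⟨f, hf, hpos, e⟩
        refine ⟨fun x => (f x)⁻¹, fun x => (hf x).inv₀ (hpos x).ne', fun x => inv_pos.2 (hpos x),
          fun x => ?_⟩
        rw [e x, smul_smul, inv_mul_cancel₀ (hpos x).ne', one_smul]
      trans := by
        rintro h h' h'' ⟨f, hf, hpos, e⟩ ⟨f', hf', hpos', e'⟩
        refine ⟨fun x => f' x * f x, hf'.mul hf, fun x => mul_pos (hpos' x) (hpos x), fun x => ?_⟩
        rw [e' x, e x, smul_smul] }

/-- A conformal structure: a pseudo-Riemannian metric up to positive smooth factors. -/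
abbrev ConformalStructure (n : ℕ) (M : Type*) [TopologicalSpace M]
    [ChartedSpace (EuclideanSpace ℝ (Fin n)) M] [IsManifold (𝓡 n) ∞ M] :=
  Quotient (confSetoid n M)

/-- A conformal projective pair. -/
structure CPPair (n : ℕ) (M : Type*) [TopologicalSpace M]
    [ChartedSpace (EuclideanSpace ℝ (Fin n)) M] [IsManifold (𝓡 n) ∞ M] where
  proj : ProjectiveStructure n M
  conf : ConformalStructure n M

/-- The pair generated by a connection and a metric. -/
def CPPair.generatedBy (D : AffineConnection n M) (h : PseudoRiemannianMetric n M) : CPPair n M :=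
  ⟨Quotient.mk (projSetoid n M) D, Quotient.mk (confSetoid n M) h⟩

/-- `D` is the aligned representative of the pair `S`: smooth, torsion-free and aligned; and `h` is
a representative metric. -/
structure CPPair.IsRepresentedBy (S : CPPair n M) (D : AffineConnection n M)
    (h : PseudoRiemannianMetric n M) : Prop where
  smooth : CovariantDerivative.ContMDiffCovariantDerivative D ∞
  torsionFree : D.torsion = 0
  aligned : IsAligned D h
  generates : S = CPPair.generatedBy D h

/-- An AH structure: a pair with vanishing conformal torsion. -/
def CPPair.IsAH (S : CPPair n M) : Prop :=
  ∃ D h, S.IsRepresentedBy D h ∧ ∀ (x : M) (i j k : Fin n), conformalTorsionLower D h x i j k = 0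

/-- `h` is a distinguished metric of `S`: `|det h|` is parallel for the aligned representative. -/
def CPPair.IsDistinguished (S : CPPair n M) (h : PseudoRiemannianMetric n M) : Prop :=
  ∃ D, S.IsRepresentedBy D h ∧
    ∀ (x : M) (i : Fin n), covDerivDensity D 2 (fun y => |(gram h x y).det|) x i = 0

/-- A pair is exact if it has a distinguished metric. -/
def CPPair.IsExact (S : CPPair n M) : Prop := ∃ h, S.IsDistinguished h

/-- The Einstein condition: the trace-free symmetric parts of `R_{ij}` and `Q_{ij}` vanish, and
`∇_i R + n ∇^p F_{ip} = 0`, where `∇^p = H^{pq} ∇_q` and `H^{pq} = |det h|^{1/n} h^{pq}`. -/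
def CPPair.IsEinstein (S : CPPair n M) : Prop :=
  S.IsAH ∧ ∃ D h, S.IsRepresentedBy D h ∧
    (∀ (x : M) (i j : Fin n), tracefreeSym h x (ricciComp D x) i j = 0) ∧
    (∀ (x : M) (i j : Fin n), tracefreeSym h x (secondRicci D h x) i j = 0) ∧
    ∀ (x : M) (i : Fin n),
      covDerivDensity D (2 / (n : ℝ)) (weightedScalar D h x) x i
        + n * (detRoot h x x * ∑ p, ∑ q, upper h x p q *
            covDerivForm D (faraday D) x (coordVec x q) (coordVec x i) (coordVec x p)) = 0

/-- The connection is smooth, torsion-free and flat on the set `U`. -/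
def IsFlatOn (D : AffineConnection n M) (U : Set M) : Prop :=
  ContMDiffCovariantDerivativeOn (EuclideanSpace ℝ (Fin n)) ∞ D.toFun U ∧
    (∀ x ∈ U, D.torsion x = 0) ∧ ∀ x ∈ U, ∀ u v w : Tan n x, curvature D x u v w = 0

/-- A pair is projectively flat if its projective structure is locally that of a flat torsion-free
connection. -/
def CPPair.IsProjectivelyFlat (S : CPPair n M) : Prop :=
  ∃ D : AffineConnection n M, Quotient.mk (projSetoid n M) D = S.proj ∧
    CovariantDerivative.ContMDiffCovariantDerivative D ∞ ∧
    ∀ x : M, ∃ U : Set M, IsOpen U ∧ x ∈ U ∧ ∃ D', IsFlatOn D' U ∧ ProjEquivOn D D' U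

/-- `S'` is the conjugate of `S`: generated by `[h]` and `∇ + 𝓛`, for the aligned representative
`∇` and the cubic torsion `𝓛` of `S`. -/
def CPPair.IsConjugate (S S' : CPPair n M) : Prop :=
  ∃ D h, S.IsRepresentedBy D h ∧
    S' = CPPair.generatedBy (D.addOneForm fun x => bilinOfCoeff x (cubicTorsion D h x)) h

/-- A pair is conjugate projectively flat if its conjugate is projectively flat. -/
def CPPair.IsConjugateProjectivelyFlat (S : CPPair n M) : Prop :=
  ∃ S', S.IsConjugate S' ∧ S'.IsProjectivelyFlat

end AHStructures

/-! ### Para-Kähler structures and Lagrangian immersions -/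

section ParaKahler

/-- A para-Kähler structure: a metric `G` and an endomorphism field `A` with `A² = 1`, whose
eigenbundles have the same rank, integrable (its Nijenhuis tensor vanishes), such that
`Ω(X, Y) = G(A X, Y)` is skew-symmetric and closed. -/
structure ParaKahlerStructure (m : ℕ) (N : Type*) [TopologicalSpace N]
    [ChartedSpace (EuclideanSpace ℝ (Fin m)) N] [IsManifold (𝓡 m) ∞ N] where
  G : PseudoRiemannianMetric m N
  A (p : N) : Tan m p →L[ℝ] Tan m p
  smooth_A : ContMDiff (𝓡 m)
    ((𝓡 m).prod 𝓘(ℝ, EuclideanSpace ℝ (Fin m) →L[ℝ] EuclideanSpace ℝ (Fin m))) ∞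
    (fun p => TotalSpace.mk' (EuclideanSpace ℝ (Fin m) →L[ℝ] EuclideanSpace ℝ (Fin m)) p (A p))
  A_A (p : N) (v : Tan m p) : A p (A p v) = v
  rank_eq (p : N) :
    Module.finrank ℝ (LinearMap.ker ((A p).toLinearMap - LinearMap.id))
      = Module.finrank ℝ (LinearMap.ker ((A p).toLinearMap + LinearMap.id))
  skew (p : N) (v w : Tan m p) : G.inner p (A p v) w = -G.inner p (A p w) v
  nijenhuis (p : N) (X Y : Π q : N, Tan m q) (hX : VDiffAt X p) (hY : VDiffAt Y p) :
    VectorField.mlieBracket (𝓡 m) (fun q => A q (X q)) (fun q => A q (Y q)) p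
      - A p (VectorField.mlieBracket (𝓡 m) (fun q => A q (X q)) Y p)
      - A p (VectorField.mlieBracket (𝓡 m) X (fun q => A q (Y q)) p)
      + VectorField.mlieBracket (𝓡 m) X Y p = 0
  closed (p : N) (X Y Z : Π q : N, Tan m q) (hX : VDiffAt X p) (hY : VDiffAt Y p)
      (hZ : VDiffAt Z p) :
    mvfderiv (𝓡 m) (fun q => G.inner q (A q (Y q)) (Z q)) p (X p)
      - mvfderiv (𝓡 m) (fun q => G.inner q (A q (X q)) (Z q)) p (Y p)
      + mvfderiv (𝓡 m) (fun q => G.inner q (A q (X q)) (Y q)) p (Z p)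
      - G.inner p (A p (VectorField.mlieBracket (𝓡 m) X Y p)) (Z p)
      + G.inner p (A p (VectorField.mlieBracket (𝓡 m) X Z p)) (Y p)
      - G.inner p (A p (VectorField.mlieBracket (𝓡 m) Y Z p)) (X p) = 0

namespace ParaKahlerStructure

variable {m : ℕ} {N : Type*} [TopologicalSpace N]
  [ChartedSpace (EuclideanSpace ℝ (Fin m)) N] [IsManifold (𝓡 m) ∞ N]

/-- The symplectic form `Ω(v, w) = G(A v, w)`. -/
def form (K : ParaKahlerStructure m N) (p : N) (v w : Tan m p) : ℝ := K.G.inner p (K.A p v) w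

/-- The `-1` eigenspace of `A`. -/
def minusSpace (K : ParaKahlerStructure m N) (p : N) : Submodule ℝ (Tan m p) :=
  LinearMap.ker ((K.A p).toLinearMap + LinearMap.id)

/-- The canonical connection: the Levi-Civita connection of `G`. -/
def connection (K : ParaKahlerStructure m N) : AffineConnection m N := leviCivita K.G

/-- Constant para-holomorphic sectional curvature `κ`. -/
def HasConstantParaHolomorphicSectionalCurvature (K : ParaKahlerStructure m N) (κ : ℝ) : Prop :=
  ∀ (p : N) (u v w : Tan m p),
    curvature K.connection p u v w = (κ / 4) •
      (K.G.inner p v w • u - K.G.inner p u w • v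
        - K.form p v w • K.A p u + K.form p u w • K.A p v + (2 * K.form p u v) • K.A p w)

theorem finrank_minusSpace (K : ParaKahlerStructure m N) (p : N) :
    2 * Module.finrank ℝ (K.minusSpace p) = m := by
  have hc : IsCompl (LinearMap.ker ((K.A p).toLinearMap - LinearMap.id))
      (LinearMap.ker ((K.A p).toLinearMap + LinearMap.id)) := by
    constructor
    · rw [Submodule.disjoint_def]
      intro v h1 h2
      have h1' : K.A p v - v = 0 := h1
      have h2' : K.A p v + v = 0 := h2
      have : (2 : ℝ) • v = 0 := by
        rw [two_smul, show v + v = (K.A p v + v) - (K.A p v - v) by abel, h1', h2', sub_zero]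
      exact (smul_eq_zero.1 this).resolve_left two_ne_zero
    · rw [codisjoint_iff, eq_top_iff]
      intro v _
      rw [Submodule.mem_sup]
      refine ⟨(1 / 2 : ℝ) • (v + K.A p v), ?_, (1 / 2 : ℝ) • (v - K.A p v), ?_, by module⟩
      · change K.A p ((1 / 2 : ℝ) • (v + K.A p v)) - (1 / 2 : ℝ) • (v + K.A p v) = 0
        rw [map_smul, map_add, K.A_A]; module
      · change K.A p ((1 / 2 : ℝ) • (v - K.A p v)) + (1 / 2 : ℝ) • (v - K.A p v) = 0
        rw [map_smul, map_sub, K.A_A]; module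
  have h := Submodule.finrank_add_eq_of_isCompl hc
  have hm : Module.finrank ℝ (Tan m p) = m := finrank_euclideanSpace_fin (𝕜 := ℝ) (n := m)
  have hr := K.rank_eq p
  unfold minusSpace
  omega

end ParaKahlerStructure

variable {n : ℕ} {M : Type*} [TopologicalSpace M] [ChartedSpace (EuclideanSpace ℝ (Fin n)) M]
  [IsManifold (𝓡 n) ∞ M]
  {N : Type*} [TopologicalSpace N] [ChartedSpace (EuclideanSpace ℝ (Fin (2 * n))) N]
  [IsManifold (𝓡 (2 * n)) ∞ N]

/-- A Lagrangian immersion of an `n`-dimensional manifold. -/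
structure IsLagrangianImmersion (K : ParaKahlerStructure (2 * n) N) (f : M → N) : Prop where
  smooth : ContMDiff (𝓡 n) (𝓡 (2 * n)) ∞ f
  injective_mfderiv : ∀ x, Function.Injective (mfderiv (𝓡 n) (𝓡 (2 * n)) f x)
  isotropic : ∀ (x : M) (v w : Tan n x),
    K.form (f x) (mfderiv (𝓡 n) (𝓡 (2 * n)) f x v) (mfderiv (𝓡 n) (𝓡 (2 * n)) f x w) = 0

/-- The tensor induced on `M` by `G` is nondegenerate. -/
def IsNondegenerateImmersion (K : ParaKahlerStructure (2 * n) N) (f : M → N) : Prop :=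
  ∀ (x : M) (v : Tan n x), (∀ w, pullbackForm n (2 * n) f K.G.inner x v w = 0) → v = 0

/-- The tensor induced on `M` by `G` is positive definite. -/
def IsPositiveDefiniteImmersion (K : ParaKahlerStructure (2 * n) N) (f : M → N) : Prop :=
  ∀ (x : M) (v : Tan n x), v ≠ 0 → 0 < pullbackForm n (2 * n) f K.G.inner x v v

theorem IsPositiveDefiniteImmersion.nondegenerate {K : ParaKahlerStructure (2 * n) N} {f : M → N}
    (h : IsPositiveDefiniteImmersion K f) : IsNondegenerateImmersion K f := by
  intro x v hv
  by_contra h0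
  exact (h x v h0).ne' (hv v)

/-- The metric induced by a nondegenerate Lagrangian immersion. -/
def inducedMetric (K : ParaKahlerStructure (2 * n) N) (f : M → N)
    (hf : IsLagrangianImmersion K f) (hnd : IsNondegenerateImmersion K f) :
    PseudoRiemannianMetric n M :=
  K.G.pullback f hf.smooth hnd

theorem isCompl_minusSpace (K : ParaKahlerStructure (2 * n) N) (f : M → N)
    (hf : IsLagrangianImmersion K f) (hnd : IsNondegenerateImmersion K f) (x : M) :
    IsCompl (LinearMap.range (mfderiv (𝓡 n) (𝓡 (2 * n)) f x).toLinearMap)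
      (K.minusSpace (f x)) := by
  have hd : Disjoint (LinearMap.range (mfderiv (𝓡 n) (𝓡 (2 * n)) f x).toLinearMap)
      (K.minusSpace (f x)) := by
    rw [Submodule.disjoint_def]
    rintro _ ⟨v, rfl⟩ hv
    have hv' : K.A (f x) (mfderiv (𝓡 n) (𝓡 (2 * n)) f x v) + mfderiv (𝓡 n) (𝓡 (2 * n)) f x v = 0 :=
      hv
    have h0 : v = 0 := by
      refine hnd x v fun w => ?_
      rw [pullbackForm_apply]
      have hi := hf.isotropic x v w
      unfold ParaKahlerStructure.form at hi
      rw [eq_neg_of_add_eq_zero_left hv', map_neg] at hi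
      simpa using hi
    rw [h0]
    exact map_zero _
  have h1 : Module.finrank ℝ (LinearMap.range (mfderiv (𝓡 n) (𝓡 (2 * n)) f x).toLinearMap) = n :=
    (LinearMap.finrank_range_of_inj (hf.injective_mfderiv x)).trans
      (finrank_euclideanSpace_fin (𝕜 := ℝ) (n := n))
  have h2 := K.finrank_minusSpace (f x)
  have h3 : Module.finrank ℝ (Tan (2 * n) (f x)) = 2 * n :=
    finrank_euclideanSpace_fin (𝕜 := ℝ) (n := 2 * n)
  have h4 : Module.finrank ℝ (Tan (2 * n) (f x))
      ≤ Module.finrank ℝ (LinearMap.range (mfderiv (𝓡 n) (𝓡 (2 * n)) f x).toLinearMap)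
        + Module.finrank ℝ (K.minusSpace (f x)) := by
    rw [h1, h3]
    omega
  exact (Submodule.isCompl_iff_disjoint _ _ h4).2 hd

/-- The second fundamental form `Π(u, v, w) = Ω(∇_u Tf(v), Tf(w))`. -/
def secondFundamentalForm (K : ParaKahlerStructure (2 * n) N) (f : M → N) (x : M)
    (u v w : Tan n x) : ℝ :=
  K.form (f x) (alongDeriv n K.connection f (pushAlong n (2 * n) f (extendVec v)) x u)
    (mfderiv (𝓡 n) (𝓡 (2 * n)) f x w)

/-- Zero mean curvature: `h^{jk} Π_{ijk} = 0`. -/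
def HasZeroMeanCurvature (K : ParaKahlerStructure (2 * n) N) (f : M → N)
    (hf : IsLagrangianImmersion K f) (hnd : IsNondegenerateImmersion K f) : Prop :=
  ∀ (x : M) (i : Fin n), ∑ j, ∑ k, upper (inducedMetric K f hf hnd) x j k *
    secondFundamentalForm K f x (coordVec x i) (coordVec x j) (coordVec x k) = 0

/-- The structure induced by a nondegenerate Lagrangian immersion: the conformal class of the
induced metric, and the projective class of the connection induced by the canonical connection
and the `-1` eigenbundle of `A`. -/
def inducedAHStructure (K : ParaKahlerStructure (2 * n) N) (f : M → N)
    (hf : IsLagrangianImmersion K f) (hnd : IsNondegenerateImmersion K f) : CPPair n M :=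
  CPPair.generatedBy
    (inducedConnection K.connection f hf.smooth hf.injective_mfderiv
      (fun x => K.minusSpace (f x)) (isCompl_minusSpace K f hf hnd))
    (inducedMetric K f hf hnd)

end ParaKahler

end

/-! Write G for the ambient metric, Ω(X, Y) = G(AX, Y), ∇̂ for the Levi-Civita connection, ∇ for the
induced connection and h for the induced metric. The endomorphism 1 + A kills exactly T⁻, so
projection along T⁻ is governed by the identity (1 + A) df(∇_X Y) = (1 + A) ∇̂_X df(Y)
(`IsProjected.endo_eq`). Pairing with df(Z), and using that A df(TM) is orthogonal to df(TM), gives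
the working description h(∇_X Y, Z) = G(∇̂_X df Y, df Z) + G(A ∇̂_X df Y, df Z), which is
`IsProjected`.

Curvature. Closedness of Ω and integrability of A force ∇̂A = 0
(`ParaKahlerStructure.isParallelEndo`). Hence 1 + A commutes with differentiation along f, and using
the identity twice gives (1 + A) df(R(X, Y)Z) = (1 + A) R̂(df X, df Y) df Z. On a Lagrangian the
Ω-terms of R̂ vanish, so R(X, Y)Z = c (h(Y, Z) X - h(X, Z) Y) (`IsProjected.curvature`). The rest of
the curvature statement is algebra: Ricci and Q are multiples of h, F and U vanish, and T is the
curvature itself.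

Cubic form. Differentiating h gives ∇h = -2Π. The form Π is symmetric in its first two slots because
second derivatives of f commute, and in its last two because Ω(df Y, df Z) = 0 can be
differentiated. So ∇h is totally symmetric, and zero mean curvature makes it trace-free
(`HasTracefreeCubicForm`). This yields alignment and vanishing conformal torsion, identifies the
cubic torsion with ∇h, and makes |det h| parallel by Jacobi's formula. The scalar curvature is then
a constant multiple of the parallel density |det h|^{1/n}, which with F = 0 is the last Einstein
condition.

Projective flatness. Consider the linear equation ∇dφ = -c φ h as a first-order system for (φ, dφ).
Its integrability conditions follow from the constant curvature formula and the Codazzi symmetry of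
∇h (`isIntegrableAt_hessSystem`), so near any point there is a solution with φ = 1, dφ = 0 there.
The form σ = -d log φ satisfies ∇σ = c h + σ ⊗ σ, which is precisely what cancels the curvature of
the projectively equivalent connection ∇ + σ ⊗ 1 + 1 ⊗ σ (`projective_change_flat`). Existence for
integrable linear systems is proved by Picard iteration along rays (`exists_local_solution`).

Conjugate. Adding the cubic torsion subtracts 2Π and so reverses the sign of the A-term in
`IsProjected`: the conjugate connection is the projection along T⁺. Since (G, -A) satisfies the same
hypotheses (`IsParaComplexSpaceForm.neg`), the conjugate is projectively flat by the same argument.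

Connections, metrics and derivatives along maps are specified at each point through the preferred
chart of that very point. The chart calculus below re-expresses them in one fixed chart, where
smoothness and commutation of derivatives can be discussed. -/

set_option linter.unusedSectionVars false

noncomputable section

/-! ### Calculus in the preferred charts -/

section ChartCalculus

variable {n : ℕ} {M : Type*} [TopologicalSpace M] [ChartedSpace (EuclideanSpace ℝ (Fin n)) M]
  {V W : Type*} [NormedAddCommGroup V] [NormedSpace ℝ V] [NormedAddCommGroup W] [NormedSpace ℝ W]

/-- A vector valued function read in the preferred chart around `x`. -/
def inChart (x : M) (g : M → V) : EuclideanSpace ℝ (Fin n) → V :=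
  fun q => g ((extChartAt (𝓡 n) x).symm q)

theorem inChart_apply {x y : M} (hy : y ∈ (chartAt (EuclideanSpace ℝ (Fin n)) x).source)
    (g : M → V) : inChart x g (extChartAt (𝓡 n) x y) = g y := by
  unfold inChart
  rw [(extChartAt (𝓡 n) x).left_inv (by simpa using hy)]

theorem extChartAt_target_mem_nhds_of_mem {x y : M}
    (hy : y ∈ (chartAt (EuclideanSpace ℝ (Fin n)) x).source) :
    (extChartAt (𝓡 n) x).target ∈ nhds (extChartAt (𝓡 n) x y) := by
  refine (isOpen_extChartAt_target x).mem_nhds ?_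
  exact (extChartAt (𝓡 n) x).map_source (by simpa using hy)

theorem tendsto_extChartAt_symm {x y : M}
    (hy : y ∈ (chartAt (EuclideanSpace ℝ (Fin n)) x).source) :
    Filter.Tendsto (extChartAt (𝓡 n) x).symm (nhds (extChartAt (𝓡 n) x y)) (nhds y) := by
  have h := continuousAt_extChartAt_symm' (I := 𝓡 n) (x := x) (x' := y) (by simpa using hy)
  have := h.tendsto
  rwa [(extChartAt (𝓡 n) x).left_inv (by simpa using hy)] at this

theorem mem_source_self (x : M) : x ∈ (chartAt (EuclideanSpace ℝ (Fin n)) x).source :=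
  mem_chart_source _ x

theorem eventually_mem_source {x y : M}
    (hy : y ∈ (chartAt (EuclideanSpace ℝ (Fin n)) x).source) :
    ∀ᶠ z in nhds y, z ∈ (chartAt (EuclideanSpace ℝ (Fin n)) x).source :=
  (chartAt (EuclideanSpace ℝ (Fin n)) x).open_source.mem_nhds hy

theorem inChart_congr {x y : M} (hy : y ∈ (chartAt (EuclideanSpace ℝ (Fin n)) x).source)
    {g g' : M → V} (h : g =ᶠ[nhds y] g') :
    inChart x g =ᶠ[nhds (extChartAt (𝓡 n) x y)] inChart x g' :=
  (tendsto_extChartAt_symm hy).eventually h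

variable [IsManifold (𝓡 n) ∞ M]

theorem contMDiffAt_extChartAt_symm {x y : M}
    (hy : y ∈ (chartAt (EuclideanSpace ℝ (Fin n)) x).source) :
    ContMDiffAt 𝓘(ℝ, EuclideanSpace ℝ (Fin n)) (𝓡 n) ∞ (extChartAt (𝓡 n) x).symm
      (extChartAt (𝓡 n) x y) :=
  (contMDiffOn_extChartAt_symm x).contMDiffAt (extChartAt_target_mem_nhds_of_mem hy)

theorem differentiableAt_inChart {x y : M}
    (hy : y ∈ (chartAt (EuclideanSpace ℝ (Fin n)) x).source) {g : M → V}
    (hg : MDifferentiableAt (𝓡 n) 𝓘(ℝ, V) g y) :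
    DifferentiableAt ℝ (inChart x g) (extChartAt (𝓡 n) x y) := by
  rw [← mdifferentiableAt_iff_differentiableAt]
  refine MDifferentiableAt.comp _ (I' := 𝓡 n) ?_
    ((contMDiffAt_extChartAt_symm hy).mdifferentiableAt (by simp))
  rwa [(extChartAt (𝓡 n) x).left_inv (by simpa using hy)]

theorem contDiffAt_inChart {x y : M} {k : ℕ∞ω} (hk : k ≤ ∞)
    (hy : y ∈ (chartAt (EuclideanSpace ℝ (Fin n)) x).source) {g : M → V}
    (hg : ContMDiffAt (𝓡 n) 𝓘(ℝ, V) k g y) :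
    ContDiffAt ℝ k (inChart x g) (extChartAt (𝓡 n) x y) := by
  rw [← contMDiffAt_iff_contDiffAt]
  refine ContMDiffAt.comp _ (I' := 𝓡 n) ?_ ((contMDiffAt_extChartAt_symm hy).of_le hk)
  rwa [(extChartAt (𝓡 n) x).left_inv (by simpa using hy)]

theorem contMDiffAt_comp_extChartAt {x y : M} {k : ℕ∞ω} (hk : k ≤ ∞)
    (hy : y ∈ (chartAt (EuclideanSpace ℝ (Fin n)) x).source)
    {g : EuclideanSpace ℝ (Fin n) → V}
    (hg : ContDiffAt ℝ k g (extChartAt (𝓡 n) x y)) :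
    ContMDiffAt (𝓡 n) 𝓘(ℝ, V) k (fun z => g (extChartAt (𝓡 n) x z)) y :=
  (contMDiffAt_iff_contDiffAt.2 hg).comp y ((contMDiffAt_extChartAt' hy).of_le hk)

/-- The components, in the preferred chart around `x`, of a tangent vector at `y`. -/
def toCoord (x y : M) : Tan n y →L[ℝ] EuclideanSpace ℝ (Fin n) :=
  (trivializationAt (EuclideanSpace ℝ (Fin n)) (TangentSpace (𝓡 n) : M → Type _)
    x).continuousLinearMapAt ℝ y

/-- The tangent vector at `y` with given components in the preferred chart around `x`. -/
def fromCoord (x y : M) : EuclideanSpace ℝ (Fin n) →L[ℝ] Tan n y :=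
  (trivializationAt (EuclideanSpace ℝ (Fin n)) (TangentSpace (𝓡 n) : M → Type _) x).symmL ℝ y

theorem toCoord_fromCoord {x y : M} (hy : y ∈ (chartAt (EuclideanSpace ℝ (Fin n)) x).source)
    (v : EuclideanSpace ℝ (Fin n)) : toCoord x y (fromCoord x y v) = v :=
  Trivialization.continuousLinearMapAt_symmL _ hy v

theorem fromCoord_toCoord {x y : M} (hy : y ∈ (chartAt (EuclideanSpace ℝ (Fin n)) x).source)
    (v : Tan n y) : fromCoord x y (toCoord x y v) = v :=
  Trivialization.symmL_continuousLinearMapAt _ hy v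

theorem toCoord_eq_trivializationAt {x y : M}
    (hy : y ∈ (chartAt (EuclideanSpace ℝ (Fin n)) x).source) (v : Tan n y) :
    toCoord x y v = (trivializationAt (EuclideanSpace ℝ (Fin n))
      (TangentSpace (𝓡 n) : M → Type _) x ⟨y, v⟩).2 := by
  exact Trivialization.continuousLinearMapAt_apply_of_mem ℝ _ hy v

theorem toCoord_self (x : M) (v : Tan n x) : toCoord x x v = v := by
  rw [toCoord_eq_trivializationAt (mem_source_self x), trivializationAt_self]

theorem fromCoord_self (x : M) (v : EuclideanSpace ℝ (Fin n)) : fromCoord x x v = v := by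
  rw [← toCoord_self x (fromCoord x x v), toCoord_fromCoord (mem_source_self x)]

theorem fromCoord_toCoord_self (x : M) (v : Tan n x) : fromCoord x x (toCoord x x v) = v :=
  fromCoord_toCoord (mem_source_self x) v

theorem toCoord_fromCoord_self (x : M) (v : EuclideanSpace ℝ (Fin n)) :
    toCoord x x (fromCoord x x v) = v :=
  toCoord_fromCoord (mem_source_self x) v

theorem extendVec_eq {x y : M} (hy : y ∈ (chartAt (EuclideanSpace ℝ (Fin n)) x).source)
    (v : Tan n x) : extendVec v y = fromCoord x y (toCoord x x v) := by
  unfold extendVec extend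
  rw [toCoord_eq_trivializationAt (mem_source_self x)]
  exact (Trivialization.symmL_apply (R := ℝ) _ hy _).symm

theorem extendVec_self {x : M} (v : Tan n x) : extendVec v x = v := by
  rw [extendVec_eq (mem_source_self x), fromCoord_toCoord_self]

/-- The vector field with constant components in the preferred chart around `x`. -/
def coordField (x : M) (e : EuclideanSpace ℝ (Fin n)) : Π y : M, Tan n y :=
  fun y => fromCoord x y e

theorem extendVec_eventuallyEq {x y : M}
    (hy : y ∈ (chartAt (EuclideanSpace ℝ (Fin n)) x).source) (v : Tan n x) :
    ∀ᶠ z in nhds y, extendVec v z = coordField x (toCoord x x v) z := by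
  filter_upwards [eventually_mem_source hy] with z hz
  exact extendVec_eq hz v

theorem toCoord_injective {x y : M} (hy : y ∈ (chartAt (EuclideanSpace ℝ (Fin n)) x).source)
    {v w : Tan n y} (h : toCoord x y v = toCoord x y w) : v = w := by
  rw [← fromCoord_toCoord hy v, h, fromCoord_toCoord hy]

/-- Identifies the trivialization of the tangent bundle with the derivative of the inverse chart;
this is what makes coordinate fields act on functions as partial derivatives. -/
theorem mfderiv_extChartAt_symm {x y : M}
    (hy : y ∈ (chartAt (EuclideanSpace ℝ (Fin n)) x).source) (v : EuclideanSpace ℝ (Fin n)) :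
    mfderiv 𝓘(ℝ, EuclideanSpace ℝ (Fin n)) (𝓡 n) (extChartAt (𝓡 n) x).symm
      (extChartAt (𝓡 n) x y) v = fromCoord x y v := by
  have h := TangentBundle.symmL_trivializationAt (I := 𝓡 n) hy
  unfold fromCoord
  rw [h]
  have hr : Set.range (𝓡 n) = Set.univ := by simp
  rw [hr, mfderivWithin_univ]
  rfl

theorem mvfderiv_extChartAt {x y : M}
    (hy : y ∈ (chartAt (EuclideanSpace ℝ (Fin n)) x).source) (v : Tan n y) :
    mvfderiv (𝓡 n) (extChartAt (𝓡 n) x) y v = toCoord x y v := by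
  have h := TangentBundle.continuousLinearMapAt_trivializationAt (I := 𝓡 n) hy
  unfold toCoord
  rw [h]
  rfl

/-- Coordinate derivatives are derivatives in the chart. -/
theorem mvfderiv_fromCoord {x y : M} (hy : y ∈ (chartAt (EuclideanSpace ℝ (Fin n)) x).source)
    {g : M → V} (hg : MDifferentiableAt (𝓡 n) 𝓘(ℝ, V) g y) (v : EuclideanSpace ℝ (Fin n)) :
    mvfderiv (𝓡 n) g y (fromCoord x y v)
      = fderiv ℝ (inChart x g) (extChartAt (𝓡 n) x y) v := by
  rw [← mfderiv_extChartAt_symm hy]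
  have hl := (extChartAt (𝓡 n) x).left_inv (x := y) (by simpa using hy)
  have h := mfderiv_comp_of_eq (I := 𝓘(ℝ, EuclideanSpace ℝ (Fin n))) (I' := 𝓡 n)
    (I'' := 𝓘(ℝ, V)) (x := extChartAt (𝓡 n) x y) (f := (extChartAt (𝓡 n) x).symm) (g := g) hg
    ((contMDiffAt_extChartAt_symm hy).mdifferentiableAt (by simp)) hl
  rw [mfderiv_eq_fderiv, hl] at h
  exact (congrArg (fun L => L v) h).symm

theorem mvfderiv_eq_fderiv_toCoord {x y : M}
    (hy : y ∈ (chartAt (EuclideanSpace ℝ (Fin n)) x).source)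
    {g : M → V} (hg : MDifferentiableAt (𝓡 n) 𝓘(ℝ, V) g y) (v : Tan n y) :
    mvfderiv (𝓡 n) g y v = fderiv ℝ (inChart x g) (extChartAt (𝓡 n) x y) (toCoord x y v) := by
  rw [← mvfderiv_fromCoord hy hg, fromCoord_toCoord hy]

theorem mvfderiv_congr {x : M} {g g' : M → V} (h : g =ᶠ[nhds x] g') :
    mvfderiv (𝓡 n) g x = mvfderiv (𝓡 n) g' x := by
  have h2 := h.mfderiv_eq (I := 𝓡 n) (I' := 𝓘(ℝ, V))
  ext1 v
  exact congrArg (fun L => L v) h2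

theorem mvfderiv_clm_apply {x : M} {c : M → V →L[ℝ] W} {g : M → V}
    (hc : MDifferentiableAt (𝓡 n) 𝓘(ℝ, V →L[ℝ] W) c x)
    (hg : MDifferentiableAt (𝓡 n) 𝓘(ℝ, V) g x) (v : Tan n x) :
    mvfderiv (𝓡 n) (fun y => c y (g y)) x v
      = mvfderiv (𝓡 n) c x v (g x) + c x (mvfderiv (𝓡 n) g x v) := by
  have hx := mem_source_self (n := n) x
  rw [mvfderiv_eq_fderiv_toCoord hx (hc.clm_apply hg), mvfderiv_eq_fderiv_toCoord hx hc,
    mvfderiv_eq_fderiv_toCoord hx hg]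
  have h := fderiv_clm_apply (differentiableAt_inChart hx hc) (differentiableAt_inChart hx hg)
  rw [inChart_apply hx, inChart_apply hx] at h
  refine (congrArg (fun L => L (toCoord x x v)) h).trans ?_
  simp only [add_apply, ContinuousLinearMap.comp_apply, ContinuousLinearMap.flip_apply]
  exact add_comm _ _

/-- Second coordinate derivatives commute. -/
theorem fderiv_fderiv_comm {E : Type*} [NormedAddCommGroup E] [NormedSpace ℝ E] {g : E → V} {q : E}
    (hg : ContDiffAt ℝ ∞ g q) (u v : E) :
    fderiv ℝ (fderiv ℝ g) q u v = fderiv ℝ (fderiv ℝ g) q v u :=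
  (hg.isSymmSndFDerivAt (by simp; norm_cast)) u v

end ChartCalculus

/-! ### Connections in the preferred charts -/

section LocalConnections

variable {n : ℕ} {M : Type*} [TopologicalSpace M] [ChartedSpace (EuclideanSpace ℝ (Fin n)) M]
  [IsManifold (𝓡 n) ∞ M]

theorem vDiffAt_iff {x y : M} (hy : y ∈ (chartAt (EuclideanSpace ℝ (Fin n)) x).source)
    {Y : Π x : M, Tan n x} :
    VDiffAt Y y ↔
      MDifferentiableAt (𝓡 n) 𝓘(ℝ, EuclideanSpace ℝ (Fin n)) (fun z => toCoord x z (Y z)) y := by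
  unfold VDiffAt
  rw [Trivialization.mdifferentiableAt_section_iff (𝓡 n) (trivializationAt (EuclideanSpace ℝ (Fin n))
      (TangentSpace (𝓡 n) : M → Type _) x) _ hy]
  refine Filter.EventuallyEq.mdifferentiableAt_iff ?_
  filter_upwards [eventually_mem_source hy] with z hz
  exact (toCoord_eq_trivializationAt hz _).symm

theorem vDiffAt_coordField {x y : M} (hy : y ∈ (chartAt (EuclideanSpace ℝ (Fin n)) x).source)
    (e : EuclideanSpace ℝ (Fin n)) : VDiffAt (coordField x e) y := by
  rw [vDiffAt_iff hy]
  refine (mdifferentiableAt_const (c := e)).congr_of_eventuallyEq ?_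
  filter_upwards [eventually_mem_source hy] with z hz
  exact toCoord_fromCoord hz e

theorem VDiffAt.congr {x : M} {Y Y' : Π x : M, Tan n x} (hY : VDiffAt Y x)
    (h : ∀ᶠ y in nhds x, Y y = Y' y) : VDiffAt Y' x := by
  rw [vDiffAt_iff (mem_source_self x)] at hY ⊢
  refine hY.congr_of_eventuallyEq ?_
  filter_upwards [h] with z hz
  rw [hz]

theorem connection_congr (D : AffineConnection n M) {x : M} {Y Y' : Π x : M, Tan n x}
    (hY : VDiffAt Y x) (h : ∀ᶠ y in nhds x, Y y = Y' y) : D Y x = D Y' x :=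
  D.isCovariantDerivativeOnUniv.congr_of_eventuallyEq hY (hY.congr h) Filter.univ_mem h

theorem connection_extendVec (D : AffineConnection n M) {x y : M}
    (hy : y ∈ (chartAt (EuclideanSpace ℝ (Fin n)) x).source) (v : Tan n x) :
    D (extendVec v) y = D (coordField x (toCoord x x v)) y := by
  have h := extendVec_eventuallyEq hy v
  refine (connection_congr D (vDiffAt_coordField hy _) ?_).symm
  filter_upwards [h] with z hz
  exact hz.symm

theorem connection_coordField_add (D : AffineConnection n M) {x y : M}
    (hy : y ∈ (chartAt (EuclideanSpace ℝ (Fin n)) x).source) (e e' : EuclideanSpace ℝ (Fin n)) :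
    D (coordField x (e + e')) y = D (coordField x e) y + D (coordField x e') y := by
  rw [← D.isCovariantDerivativeOnUniv.add (vDiffAt_coordField hy e) (vDiffAt_coordField hy e')]
  congr 1
  funext z
  exact map_add _ _ _

theorem connection_coordField_smul (D : AffineConnection n M) {x y : M}
    (hy : y ∈ (chartAt (EuclideanSpace ℝ (Fin n)) x).source) (a : ℝ)
    (e : EuclideanSpace ℝ (Fin n)) :
    D (coordField x (a • e)) y = a • D (coordField x e) y := by
  rw [← D.isCovariantDerivativeOnUniv.smul_const a (vDiffAt_coordField hy e)]
  congr 1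
  funext z
  exact map_smul _ _ _

/-- The linear map with given values on the standard basis. -/
def clmOfBasis {V : Type*} [NormedAddCommGroup V] [NormedSpace ℝ V] (L : Fin n → V) :
    EuclideanSpace ℝ (Fin n) →L[ℝ] V :=
  ∑ i, (EuclideanSpace.proj i : EuclideanSpace ℝ (Fin n) →L[ℝ] ℝ).smulRight (L i)

theorem clmOfBasis_apply {V : Type*} [NormedAddCommGroup V] [NormedSpace ℝ V] (L : Fin n → V)
    (e : EuclideanSpace ℝ (Fin n)) : clmOfBasis L e = ∑ i, e i • L i := by
  simp [clmOfBasis]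

theorem euclidean_eq_sum (e : EuclideanSpace ℝ (Fin n)) :
    e = ∑ i, e i • EuclideanSpace.single i (1 : ℝ) := by
  ext k
  simp [Finset.sum_apply, Pi.single_apply]

theorem clmOfBasis_eq {V : Type*} [NormedAddCommGroup V] [NormedSpace ℝ V]
    (L : EuclideanSpace ℝ (Fin n) → V) (hadd : ∀ a b, L (a + b) = L a + L b)
    (hsmul : ∀ (r : ℝ) a, L (r • a) = r • L a) (e : EuclideanSpace ℝ (Fin n)) :
    clmOfBasis (fun i => L (EuclideanSpace.single i (1 : ℝ))) e = L e := by
  let L' : EuclideanSpace ℝ (Fin n) →ₗ[ℝ] V := ⟨⟨L, hadd⟩, hsmul⟩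
  rw [clmOfBasis_apply]
  change ∑ i, e i • L' (EuclideanSpace.single i (1 : ℝ)) = L' e
  conv_rhs => rw [euclidean_eq_sum e, map_sum]
  simp only [map_smul]

theorem contMDiffAt_clmOfBasis {V : Type*} [NormedAddCommGroup V] [NormedSpace ℝ V] {k : ℕ∞ω}
    {P : Type*} [TopologicalSpace P] [ChartedSpace (EuclideanSpace ℝ (Fin n)) P]
    {m : ℕ} {L : P → Fin m → V} {p : P}
    (h : ∀ i, ContMDiffAt (𝓡 n) 𝓘(ℝ, V) k (fun q => L q i) p) :
    ContMDiffAt (𝓡 n) 𝓘(ℝ, EuclideanSpace ℝ (Fin m) →L[ℝ] V) k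
      (fun q => clmOfBasis (L q)) p := by
  refine ContMDiffAt.sum fun i _ => ?_
  have h2 : ContDiff ℝ k (fun v : V =>
      (EuclideanSpace.proj i : EuclideanSpace ℝ (Fin m) →L[ℝ] ℝ).smulRight v) :=
    (ContinuousLinearMap.smulRightL ℝ (EuclideanSpace ℝ (Fin m)) V
      (EuclideanSpace.proj i : EuclideanSpace ℝ (Fin m) →L[ℝ] ℝ)).contDiff
  exact (h2.contMDiff.contMDiffAt (x := L p i)).comp p (h i)

/-- The coefficients of a connection in the preferred chart around `x`: the components at `y` of
the derivative in the direction of the second argument of the field with constant components the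
first argument. -/
def connCoeff (D : AffineConnection n M) (x y : M) :
    EuclideanSpace ℝ (Fin n) →L[ℝ] EuclideanSpace ℝ (Fin n) →L[ℝ] EuclideanSpace ℝ (Fin n) :=
  clmOfBasis fun i => (toCoord x y).comp
    ((D (coordField x (EuclideanSpace.single i (1 : ℝ))) y).comp (fromCoord x y))

theorem connCoeff_apply (D : AffineConnection n M) {x y : M}
    (hy : y ∈ (chartAt (EuclideanSpace ℝ (Fin n)) x).source) (w a : EuclideanSpace ℝ (Fin n)) :
    connCoeff D x y w a = toCoord x y (D (coordField x w) y (fromCoord x y a)) := by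
  have h := clmOfBasis_eq (fun e => (toCoord x y).comp
    ((D (coordField x e) y).comp (fromCoord x y)))
    (fun a b => by
      ext1 v
      simp only [connection_coordField_add D hy, ContinuousLinearMap.comp_apply, add_apply,
        map_add])
    (fun r a => by
      ext1 v
      simp only [connection_coordField_smul D hy, ContinuousLinearMap.comp_apply, smul_apply,
        map_smul]) w
  exact congrArg (fun L => L a) h

/-- The coefficients of the connection are smooth in the preferred charts. -/
def HasSmoothCoeff (D : AffineConnection n M) : Prop :=
  ∀ x y : M, y ∈ (chartAt (EuclideanSpace ℝ (Fin n)) x).source →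
    ContMDiffAt (𝓡 n) 𝓘(ℝ, EuclideanSpace ℝ (Fin n) →L[ℝ] EuclideanSpace ℝ (Fin n) →L[ℝ]
      EuclideanSpace ℝ (Fin n)) ∞ (connCoeff D x) y

/-- The model space is finite-dimensional, so smoothness of an operator-valued function can be
tested on basis vectors. -/
theorem hasSmoothCoeff_of_apply {D : AffineConnection n M} (h : ∀ (x y : M),
    y ∈ (chartAt (EuclideanSpace ℝ (Fin n)) x).source → ∀ w a : EuclideanSpace ℝ (Fin n),
    ContMDiffAt (𝓡 n) 𝓘(ℝ, EuclideanSpace ℝ (Fin n)) ∞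
      (fun z => toCoord x z (D (coordField x w) z (fromCoord x z a))) y) : HasSmoothCoeff D := by
  intro x y hy
  have h1 : ContMDiffAt (𝓡 n) 𝓘(ℝ, EuclideanSpace ℝ (Fin n) →L[ℝ] EuclideanSpace ℝ (Fin n) →L[ℝ]
      EuclideanSpace ℝ (Fin n)) ∞ (fun z => clmOfBasis fun i => clmOfBasis fun j =>
        toCoord x z (D (coordField x (EuclideanSpace.single i (1 : ℝ))) z
          (fromCoord x z (EuclideanSpace.single j (1 : ℝ))))) y :=
    contMDiffAt_clmOfBasis fun i => contMDiffAt_clmOfBasis fun j => h x y hy _ _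
  refine h1.congr_of_eventuallyEq (Filter.Eventually.of_forall fun z => ?_)
  unfold connCoeff
  congr 1
  funext i
  ext1 a
  rw [clmOfBasis_eq (fun a => toCoord x z (D (coordField x (EuclideanSpace.single i (1 : ℝ))) z
    (fromCoord x z a))) (fun a b => by simp only [map_add])
    (fun r a => by simp only [map_smul])]
  rfl

theorem chartDerivAlong_apply {m d : ℕ} {P : Type*} [TopologicalSpace P]
    [ChartedSpace (EuclideanSpace ℝ (Fin m)) P] {N : Type*} [TopologicalSpace N]
    [ChartedSpace (EuclideanSpace ℝ (Fin d)) N] [IsManifold (𝓡 d) ∞ N] {f : P → N}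
    {s : Π x : P, Tan d (f x)} {x : P} (hf : ContinuousAt f x) (v : Tan m x) :
    chartDerivAlong m f s x v = fromCoord (f x) (f x)
      (mvfderiv (𝓡 m) (fun y => toCoord (f x) (f y) (s y)) x v) := by
  have h1 : (fun y => toCoord (f x) (f y) (s y)) =ᶠ[nhds x]
      (fun y => (trivializationAt (EuclideanSpace ℝ (Fin d)) (TangentSpace (𝓡 d) : N → Type _) (f x)
      ⟨f y, s y⟩).2) := by
    filter_upwards [hf.eventually (eventually_mem_source (mem_source_self (n := d) (f x)))] with y hy
    exact toCoord_eq_trivializationAt hy _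
  have h2 : mvfderiv (𝓡 m) (fun y => toCoord (f x) (f y) (s y)) x = mvfderiv (𝓡 m)
      (fun y => (trivializationAt (EuclideanSpace ℝ (Fin d)) (TangentSpace (𝓡 d) : N → Type _) (f x)
      ⟨f y, s y⟩).2) x := by
    have h2 := h1.mfderiv_eq (I := 𝓡 m) (I' := 𝓘(ℝ, EuclideanSpace ℝ (Fin d)))
    ext1 v
    exact congrArg (fun L => L v) h2
  rw [h2, fromCoord_self]
  rfl

theorem chartConnection_extendVec (x : M) (w : Tan n x) :
    (chartConnection : AffineConnection n M) (extendVec w) x = 0 := by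
  ext1 v
  refine (chartDerivAlong_apply (f := fun y : M => y) continuousAt_id v).trans ?_
  have h : (fun y => toCoord x y (extendVec w y)) =ᶠ[nhds x] fun _ => toCoord x x w := by
    filter_upwards [eventually_mem_source (mem_source_self (n := n) x)] with y hy
    rw [extendVec_eq hy, toCoord_fromCoord hy]
  rw [mvfderiv_congr h, mvfderiv_const]
  simp

/-- The derivative of a vector field at the centre of a chart. -/
theorem connection_apply_center (D : AffineConnection n M) {Y : Π x : M, Tan n x} {x : M}
    (hY : VDiffAt Y x) (v : Tan n x) :
    D Y x v = fromCoord x x (mvfderiv (𝓡 n) (fun y => toCoord x y (Y y)) x v)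
      + D (extendVec (Y x)) x v := by
  -- The difference of two covariant derivatives is tensorial, so at x it does not distinguish Y
  -- from the extension of Y x, and on that extension the chart connection vanishes at x.
  have h1 := IsCovariantDerivativeOn.difference_apply D.isCovariantDerivativeOnUniv
    chartConnection.isCovariantDerivativeOnUniv (x := x) (σ := Y) trivial hY
  have h2 := IsCovariantDerivativeOn.difference_apply D.isCovariantDerivativeOnUniv
    chartConnection.isCovariantDerivativeOnUniv (x := x) (σ := extendVec (Y x)) trivial
    (vDiffAt_extendVec (Y x))
  rw [extendVec_self, h1] at h2
  have h3 := congrArg (fun L => L v) h2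
  have h4 := chartDerivAlong_apply (f := fun y : M => y) (s := Y) (x := x) continuousAt_id v
  rw [← h4]
  have h5 : chartConnection.toFun (extendVec (Y x)) x = 0 := chartConnection_extendVec x (Y x)
  rw [h5, sub_zero] at h3
  have h6 : D Y x v - chartDerivAlong n (fun y : M => y) Y x v = D (extendVec (Y x)) x v := h3
  rw [← h6]
  abel

end LocalConnections

/-! ### Derivatives of vector fields along maps, read in a fixed chart -/

section LocalAlong

variable {n d : ℕ} {M : Type*} [TopologicalSpace M] [ChartedSpace (EuclideanSpace ℝ (Fin n)) M]
  [IsManifold (𝓡 n) ∞ M]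
  {N : Type*} [TopologicalSpace N] [ChartedSpace (EuclideanSpace ℝ (Fin d)) N]
  [IsManifold (𝓡 d) ∞ N]

theorem vDiffAlongAt_iff {f : M → N} {s : Π x : M, Tan d (f x)} {p : N} {y : M}
    (hy : f y ∈ (chartAt (EuclideanSpace ℝ (Fin d)) p).source)
    (hf : MDifferentiableAt (𝓡 n) (𝓡 d) f y) :
    VDiffAlongAt n f s y ↔ MDifferentiableAt (𝓡 n) 𝓘(ℝ, EuclideanSpace ℝ (Fin d))
      (fun z => toCoord p (f z) (s z)) y := by
  unfold VDiffAlongAt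
  rw [Trivialization.mdifferentiableAt_totalSpace_iff (𝓡 d) (trivializationAt
    (EuclideanSpace ℝ (Fin d)) (TangentSpace (𝓡 d) : N → Type _) p)
    (fun z => TotalSpace.mk' (EuclideanSpace ℝ (Fin d)) (f z) (s z))
    ((Trivialization.mem_source _).2 hy)]
  refine (and_iff_right hf).trans ?_
  refine Filter.EventuallyEq.mdifferentiableAt_iff ?_
  filter_upwards [hf.continuousAt.eventually (eventually_mem_source hy)] with z hz
  exact (toCoord_eq_trivializationAt hz _).symm

theorem alongDeriv_apply_center (D : AffineConnection d N) {f : M → N} {s : Π x : M, Tan d (f x)}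
    {x : M} (hf : ContinuousAt f x) (v : Tan n x) :
    alongDeriv n D f s x v = fromCoord (f x) (f x)
      (mvfderiv (𝓡 n) (fun y => toCoord (f x) (f y) (s y)) x v)
        + D (extendVec (s x)) (f x) (mfderiv (𝓡 n) (𝓡 d) f x v) := by
  rw [← chartDerivAlong_apply hf]
  rfl

/-- The derivative of the restriction of a vector field. -/
theorem alongDeriv_comp (D : AffineConnection d N) {f : M → N} {x : M}
    (hf : MDifferentiableAt (𝓡 n) (𝓡 d) f x) {Y : Π p : N, Tan d p} (hY : VDiffAt Y (f x))
    (v : Tan n x) :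
    alongDeriv n D f (fun y => Y (f y)) x v = D Y (f x) (mfderiv (𝓡 n) (𝓡 d) f x v) := by
  rw [alongDeriv_apply_center D hf.continuousAt, connection_apply_center D hY]
  congr 2
  have hY' := (vDiffAt_iff (mem_source_self (f x))).1 hY
  exact mfderiv_comp_apply (I := 𝓡 n) (I' := 𝓡 d) (I'' := 𝓘(ℝ, EuclideanSpace ℝ (Fin d)))
    (g := fun z => toCoord (f x) z (Y z)) x hY' hf v

/-- The change of components between two preferred charts. -/
def coordChange (p p' q : N) : EuclideanSpace ℝ (Fin d) →L[ℝ] EuclideanSpace ℝ (Fin d) :=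
  (toCoord p' q).comp (fromCoord p q)

theorem contMDiffAt_coordChange {p p' q : N}
    (hq : q ∈ (chartAt (EuclideanSpace ℝ (Fin d)) p).source)
    (hq' : q ∈ (chartAt (EuclideanSpace ℝ (Fin d)) p').source) :
    ContMDiffAt (𝓡 d) 𝓘(ℝ, EuclideanSpace ℝ (Fin d) →L[ℝ] EuclideanSpace ℝ (Fin d)) ∞
      (fun z => coordChange (d := d) p p' z) q := by
  have h := contMDiffAt_coordChangeL (IB := 𝓡 d) (n := ∞)
    (e := trivializationAt (EuclideanSpace ℝ (Fin d)) (TangentSpace (𝓡 d) : N → Type _) p)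
    (e' := trivializationAt (EuclideanSpace ℝ (Fin d)) (TangentSpace (𝓡 d) : N → Type _) p') hq hq'
  refine h.congr_of_eventuallyEq ?_
  filter_upwards [eventually_mem_source hq, eventually_mem_source hq'] with z hz hz'
  ext1 v
  refine Eq.trans ?_ (Trivialization.coordChangeL_apply (R := ℝ) _ _
    (show z ∈ _ ∩ _ from ⟨hz, hz'⟩) v).symm
  rw [← Trivialization.symmL_apply (R := ℝ) _ hz, ← toCoord_eq_trivializationAt hz']
  rfl

/-- The derivative of a vector field along a map, in any preferred chart. -/
theorem toCoord_alongDeriv (D : AffineConnection d N) {f : M → N} {s : Π x : M, Tan d (f x)}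
    {p : N} {y : M} (hy : f y ∈ (chartAt (EuclideanSpace ℝ (Fin d)) p).source)
    (hf : MDifferentiableAt (𝓡 n) (𝓡 d) f y) (hs : VDiffAlongAt n f s y) (v : Tan n y) :
    toCoord p (f y) (alongDeriv n D f s y v)
      = mvfderiv (𝓡 n) (fun z => toCoord p (f z) (s z)) y v
        + connCoeff D p (f y) (toCoord p (f y) (s y))
          (toCoord p (f y) (mfderiv (𝓡 n) (𝓡 d) f y v)) := by
  have hyy := mem_source_self (n := d) (f y)
  set S : M → EuclideanSpace ℝ (Fin d) := fun z => toCoord p (f z) (s z) with hS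
  have hSd : MDifferentiableAt (𝓡 n) 𝓘(ℝ, EuclideanSpace ℝ (Fin d)) S y :=
    (vDiffAlongAt_iff hy hf).1 hs
  have hC : MDifferentiableAt (𝓡 n) 𝓘(ℝ, EuclideanSpace ℝ (Fin d) →L[ℝ] EuclideanSpace ℝ (Fin d))
      (fun z => coordChange p (f y) (f z)) y :=
    MDifferentiableAt.comp y (I' := 𝓡 d)
      ((contMDiffAt_coordChange hy hyy).mdifferentiableAt (by simp)) hf
  have hev := hf.continuousAt.eventually (eventually_mem_source hy)
  -- Passing from the chart around p to the chart around f y multiplies components by the transition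
  -- matrix, whose derivative is the term to be eliminated.
  have e1 : mvfderiv (𝓡 n) (fun z => toCoord (f y) (f z) (s z)) y v
      = mvfderiv (𝓡 n) (fun z => coordChange p (f y) (f z)) y v (S y)
        + coordChange p (f y) (f y) (mvfderiv (𝓡 n) S y v) := by
    rw [← mvfderiv_clm_apply hC hSd]
    refine congrArg (fun L : Tan n y →L[ℝ] EuclideanSpace ℝ (Fin d) => L v) (mvfderiv_congr ?_)
    filter_upwards [hev] with z hz
    simp only [coordChange, hS, ContinuousLinearMap.comp_apply, fromCoord_toCoord hz]
  -- The field with constant components S y in the chart around p produces the same transition term.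
  -- Its derivative is known from the restriction formula, and comparing the two leaves the
  -- connection coefficient.
  have e2 : mvfderiv (𝓡 n) (fun z => toCoord (f y) (f z) (coordField p (S y) (f z))) y v
      = mvfderiv (𝓡 n) (fun z => coordChange p (f y) (f z)) y v (S y) := by
    have := mvfderiv_clm_apply hC (mdifferentiableAt_const (c := S y)) v
    rw [mvfderiv_const] at this
    simpa [coordChange, coordField] using this
  have e3 := alongDeriv_comp D hf (vDiffAt_coordField hy (S y)) v
  rw [alongDeriv_apply_center D hf.continuousAt] at e3
  rw [e2] at e3
  have hSy : coordField p (S y) (f y) = s y := fromCoord_toCoord hy (s y)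
  rw [hSy] at e3
  rw [alongDeriv_apply_center D hf.continuousAt, e1, (fromCoord (f y) (f y)).map_add,
    add_right_comm, e3, (toCoord p (f y)).map_add, connCoeff_apply D hy, fromCoord_toCoord hy, add_comm]
  congr 1
  simp only [coordChange, ContinuousLinearMap.comp_apply]
  rw [fromCoord_toCoord hyy, toCoord_fromCoord hy]

theorem alongDeriv_congr (D : AffineConnection d N) {f : M → N} {s s' : Π x : M, Tan d (f x)}
    {x : M} (hf : ContinuousAt f x) (h : ∀ᶠ y in nhds x, s y = s' y) :
    alongDeriv n D f s x = alongDeriv n D f s' x := by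
  ext1 v
  rw [alongDeriv_apply_center D hf, alongDeriv_apply_center D hf, h.self_of_nhds]
  congr 3
  refine mvfderiv_congr ?_
  filter_upwards [h] with y hy
  rw [hy]

theorem alongDeriv_id (D : AffineConnection n M) {Y : Π x : M, Tan n x} {x : M}
    (hY : VDiffAt Y x) : alongDeriv n D (fun y : M => y) Y x = D Y x := by
  ext1 v
  have h := alongDeriv_comp D (f := fun y : M => y) (x := x) mdifferentiableAt_id hY v
  refine h.trans ?_
  congr 1
  exact congrArg (fun L => L v) (mfderiv_id (I := 𝓡 n) (x := x))

/-- The derivative of a vector field, in any preferred chart. -/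
theorem toCoord_connection (D : AffineConnection n M) {Y : Π x : M, Tan n x} {x y : M}
    (hy : y ∈ (chartAt (EuclideanSpace ℝ (Fin n)) x).source) (hY : VDiffAt Y y) (v : Tan n y) :
    toCoord x y (D Y y v) = mvfderiv (𝓡 n) (fun z => toCoord x z (Y z)) y v
      + connCoeff D x y (toCoord x y (Y y)) (toCoord x y v) := by
  have h := toCoord_alongDeriv D (f := fun y : M => y) (s := Y) hy mdifferentiableAt_id hY v
  rw [alongDeriv_id D hY] at h
  refine h.trans ?_
  congr 3
  exact congrArg (fun L => L v) (mfderiv_id (I := 𝓡 n) (x := y))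

end LocalAlong

/-! ### Curvature, torsion and smoothness in the preferred charts -/

section LocalCurvature

variable {n d : ℕ} {M : Type*} [TopologicalSpace M] [ChartedSpace (EuclideanSpace ℝ (Fin n)) M]
  [IsManifold (𝓡 n) ∞ M]
  {N : Type*} [TopologicalSpace N] [ChartedSpace (EuclideanSpace ℝ (Fin d)) N]
  [IsManifold (𝓡 d) ∞ N]

theorem mpullback_extChartAt_const {x y : M}
    (hy : y ∈ (chartAt (EuclideanSpace ℝ (Fin n)) x).source) (u : EuclideanSpace ℝ (Fin n)) :
    VectorField.mpullback (𝓡 n) 𝓘(ℝ, EuclideanSpace ℝ (Fin n)) (extChartAt (𝓡 n) x)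
      (fun _ => u) y = coordField x u y := by
  have hi : (mfderiv (𝓡 n) 𝓘(ℝ, EuclideanSpace ℝ (Fin n)) (extChartAt (𝓡 n) x) y).IsInvertible :=
    isInvertible_mfderiv_extChartAt (by simpa using hy)
  refine hi.inverse_apply_eq.2 ?_
  have h := mvfderiv_extChartAt hy (coordField x u y)
  have h2 : toCoord x y (coordField x u y) = u := toCoord_fromCoord hy u
  rw [h2] at h
  exact h.symm

/-- Coordinate fields are pullbacks of constant fields by the chart, and the bracket is natural
under pullback. -/
theorem mlieBracket_coordField {x y : M}
    (hy : y ∈ (chartAt (EuclideanSpace ℝ (Fin n)) x).source) (u v : EuclideanSpace ℝ (Fin n)) :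
    VectorField.mlieBracket (𝓡 n) (coordField x u) (coordField x v) y = 0 := by
  have hc : ∀ u : EuclideanSpace ℝ (Fin n), ∀ q : EuclideanSpace ℝ (Fin n),
      MDifferentiableAt 𝓘(ℝ, EuclideanSpace ℝ (Fin n))
        (𝓘(ℝ, EuclideanSpace ℝ (Fin n)).prod 𝓘(ℝ, EuclideanSpace ℝ (Fin n)))
        (fun z => TotalSpace.mk' (EuclideanSpace ℝ (Fin n))
          (E := (TangentSpace 𝓘(ℝ, EuclideanSpace ℝ (Fin n)) :
            EuclideanSpace ℝ (Fin n) → Type _)) z u) q := by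
    intro u q
    have := (contMDiffAt_vectorSpace_iff_contDiffAt (𝕜 := ℝ) (n := 1)
      (V := fun _ : EuclideanSpace ℝ (Fin n) => u) (x := q)).2 contDiffAt_const
    exact this.mdifferentiableAt one_ne_zero
  have : IsManifold (𝓡 n) (minSmoothness ℝ 2) M := by
    rw [minSmoothness_of_isRCLikeNormedField]
    infer_instance
  have h := VectorField.mpullback_mlieBracket (I := 𝓡 n) (I' := 𝓘(ℝ, EuclideanSpace ℝ (Fin n)))
    (f := extChartAt (𝓡 n) x) (x₀ := y) (n := ∞) (hc u _) (hc v _)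
    (contMDiffAt_extChartAt' hy)
    (by rw [minSmoothness_of_isRCLikeNormedField]; norm_cast)
  have h0 : VectorField.mlieBracket (M := EuclideanSpace ℝ (Fin n))
      𝓘(ℝ, EuclideanSpace ℝ (Fin n)) (fun _ => u) (fun _ => v)
      = fun _ => 0 := by
    funext q
    have h2 := congrFun (VectorField.mlieBracketWithin_eq_lieBracketWithin (𝕜 := ℝ)
      (E := EuclideanSpace ℝ (Fin n)) (V := fun _ => u) (W := fun _ => v) (s := Set.univ)) q
    refine h2.trans ?_
    have h3 : ∀ w : EuclideanSpace ℝ (Fin n),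
        fderivWithin ℝ (fun _ : EuclideanSpace ℝ (Fin n) => w) Set.univ q = 0 := fun w => by simp
    unfold VectorField.lieBracketWithin
    exact (congrArg₂ (fun a b : EuclideanSpace ℝ (Fin n) →L[ℝ] EuclideanSpace ℝ (Fin n) =>
      a u - b v) (h3 v) (h3 u)).trans (sub_self (0 : EuclideanSpace ℝ (Fin n)))
  rw [h0] at h
  have h1 : ∀ u : EuclideanSpace ℝ (Fin n), VectorField.mpullback (𝓡 n)
      𝓘(ℝ, EuclideanSpace ℝ (Fin n)) (extChartAt (𝓡 n) x) (fun _ => u)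
        =ᶠ[nhds y] coordField x u := by
    intro u
    filter_upwards [eventually_mem_source hy] with z hz
    exact mpullback_extChartAt_const hz u
  rw [← Filter.EventuallyEq.mlieBracket_vectorField_eq (h1 u) (h1 v), ← h]
  exact map_zero _

theorem mlieBracket_extendVec {x : M} (u v : Tan n x) :
    VectorField.mlieBracket (𝓡 n) (extendVec u) (extendVec v) x = 0 := by
  rw [Filter.EventuallyEq.mlieBracket_vectorField_eq
    (extendVec_eventuallyEq (mem_source_self x) u) (extendVec_eventuallyEq (mem_source_self x) v),
    mlieBracket_coordField (mem_source_self x)]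

/-- Torsion is tensorial, so it can be tested on the local extensions, whose bracket vanishes at x.
-/
theorem torsion_eq_zero_at {D : AffineConnection n M} {x : M}
    (h : ∀ u v : Tan n x, D (extendVec v) x u = D (extendVec u) x v) : D.torsion x = 0 := by
  ext1 u
  ext1 v
  have h1 := D.torsion_apply (vDiffAt_extendVec u) (vDiffAt_extendVec v)
  rw [mlieBracket_extendVec, extendVec_self, extendVec_self, h u v] at h1
  simpa using h1

theorem connCoeff_comm {D : AffineConnection n M} (hD : D.torsion = 0) {x y : M}
    (hy : y ∈ (chartAt (EuclideanSpace ℝ (Fin n)) x).source) (v w : EuclideanSpace ℝ (Fin n)) :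
    connCoeff D x y v w = connCoeff D x y w v := by
  have h1 := D.torsion_apply (vDiffAt_coordField hy w) (vDiffAt_coordField hy v)
  rw [mlieBracket_coordField hy, hD] at h1
  rw [connCoeff_apply D hy, connCoeff_apply D hy]
  congr 1
  have h2 : (0 : Tan n y) = D (coordField x v) y (coordField x w y)
    - D (coordField x w) y (coordField x v y) - 0 := h1
  rw [sub_zero] at h2
  exact sub_eq_zero.1 h2.symm

theorem connection_extendVec_comm {D : AffineConnection n M} (hD : D.torsion = 0) {x : M}
    (u v : Tan n x) : D (extendVec v) x u = D (extendVec u) x v := by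
  have h1 := D.torsion_apply (vDiffAt_extendVec u) (vDiffAt_extendVec v)
  rw [mlieBracket_extendVec, extendVec_self, extendVec_self, hD] at h1
  have h2 : (0 : Tan n x) = D (extendVec v) x u - D (extendVec u) x v - 0 := h1
  rw [sub_zero] at h2
  exact sub_eq_zero.1 h2.symm

theorem mvfderiv_clm_const {V W : Type*} [NormedAddCommGroup V] [NormedSpace ℝ V]
    [NormedAddCommGroup W] [NormedSpace ℝ W] {x : M} {c : M → V →L[ℝ] W}
    (hc : MDifferentiableAt (𝓡 n) 𝓘(ℝ, V →L[ℝ] W) c x) (e : V) (v : Tan n x) :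
    mvfderiv (𝓡 n) (fun y => c y e) x v = mvfderiv (𝓡 n) c x v e := by
  have h := mvfderiv_clm_apply hc (mdifferentiableAt_const (c := e)) v
  rw [mvfderiv_const] at h
  simpa using h

/-- The coefficients of the connection are smooth at `x` in the preferred chart around `x`. -/
def HasSmoothCoeffAt (D : AffineConnection n M) (x : M) : Prop :=
  ContMDiffAt (𝓡 n) 𝓘(ℝ, EuclideanSpace ℝ (Fin n) →L[ℝ] EuclideanSpace ℝ (Fin n) →L[ℝ]
    EuclideanSpace ℝ (Fin n)) ∞ (connCoeff D x) x

theorem HasSmoothCoeff.hasSmoothCoeffAt {D : AffineConnection n M} (hD : HasSmoothCoeff D) (x : M) :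
    HasSmoothCoeffAt D x := hD x x (mem_source_self x)

theorem HasSmoothCoeffAt.contMDiffAt {D : AffineConnection n M} {x : M}
    (hD : HasSmoothCoeffAt D x) :
    ContMDiffAt (𝓡 n) 𝓘(ℝ, EuclideanSpace ℝ (Fin n) →L[ℝ] EuclideanSpace ℝ (Fin n) →L[ℝ]
      EuclideanSpace ℝ (Fin n)) ∞ (connCoeff D x) x := hD

theorem connection_extendVec_vDiffAt {D : AffineConnection n M} {x : M} (hD : HasSmoothCoeffAt D x)
    (v w : Tan n x) : VDiffAt (fun y => D (extendVec w) y (extendVec v y)) x := by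
  rw [vDiffAt_iff (mem_source_self x)]
  have h : MDifferentiableAt (𝓡 n) 𝓘(ℝ, EuclideanSpace ℝ (Fin n))
      (fun y => connCoeff D x y (toCoord x x w) (toCoord x x v)) x :=
    ((hD.contMDiffAt.mdifferentiableAt (by simp)).clm_apply
      mdifferentiableAt_const).clm_apply mdifferentiableAt_const
  refine h.congr_of_eventuallyEq ?_
  filter_upwards [eventually_mem_source (mem_source_self (n := n) x)] with y hy
  rw [connCoeff_apply D hy, connection_extendVec D hy, extendVec_eq hy]

/-- The curvature at the centre of a chart. -/
theorem toCoord_curvature {D : AffineConnection n M} {x : M} (hD : HasSmoothCoeffAt D x)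
    (u v w : Tan n x) :
    toCoord x x (curvature D x u v w)
      = mvfderiv (𝓡 n) (connCoeff D x) x u (toCoord x x w) (toCoord x x v)
        - mvfderiv (𝓡 n) (connCoeff D x) x v (toCoord x x w) (toCoord x x u)
        + connCoeff D x x (connCoeff D x x (toCoord x x w) (toCoord x x v)) (toCoord x x u)
        - connCoeff D x x (connCoeff D x x (toCoord x x w) (toCoord x x u)) (toCoord x x v) := by
  have hx := mem_source_self (n := n) x
  have hΓ : MDifferentiableAt (𝓡 n) 𝓘(ℝ, EuclideanSpace ℝ (Fin n) →L[ℝ] EuclideanSpace ℝ (Fin n)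
      →L[ℝ] EuclideanSpace ℝ (Fin n)) (connCoeff D x) x := hD.contMDiffAt.mdifferentiableAt (by simp)
  have key : ∀ u v : Tan n x,
      toCoord x x (D (fun y => D (extendVec w) y (extendVec v y)) x u)
        = mvfderiv (𝓡 n) (connCoeff D x) x u (toCoord x x w) (toCoord x x v)
        + connCoeff D x x (connCoeff D x x (toCoord x x w) (toCoord x x v)) (toCoord x x u) := by
    intro u v
    have hev : (fun y => toCoord x y (D (extendVec w) y (extendVec v y))) =ᶠ[nhds x]
        fun y => connCoeff D x y (toCoord x x w) (toCoord x x v) := by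
      filter_upwards [eventually_mem_source hx] with y hy
      rw [connCoeff_apply D hy, connection_extendVec D hy, extendVec_eq hy]
    rw [toCoord_connection D hx (connection_extendVec_vDiffAt hD v w), mvfderiv_congr hev,
      mvfderiv_clm_const (hΓ.clm_apply mdifferentiableAt_const), mvfderiv_clm_const hΓ]
    congr 3
    exact hev.self_of_nhds
  unfold curvature
  rw [mlieBracket_extendVec, map_zero, sub_zero, map_sub, key, key]
  abel

/-- The components of the derivative of a vector field along `f` in a coordinate direction. -/
theorem toCoord_alongDeriv_fromCoord (D : AffineConnection d N) {f : M → N}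
    {s : Π x : M, Tan d (f x)} {p : N} {x y : M}
    (hy : y ∈ (chartAt (EuclideanSpace ℝ (Fin n)) x).source)
    (hfy : f y ∈ (chartAt (EuclideanSpace ℝ (Fin d)) p).source)
    (hf : MDifferentiableAt (𝓡 n) (𝓡 d) f y) (hs : VDiffAlongAt n f s y)
    (v : EuclideanSpace ℝ (Fin n)) :
    toCoord p (f y) (alongDeriv n D f s y (fromCoord x y v))
      = fderiv ℝ (inChart x fun z => toCoord p (f z) (s z)) (extChartAt (𝓡 n) x y) v
        + connCoeff D p (f y) (toCoord p (f y) (s y))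
          (fderiv ℝ (inChart x fun z => extChartAt (𝓡 d) p (f z)) (extChartAt (𝓡 n) x y) v) := by
  have hφ : MDifferentiableAt (𝓡 d) 𝓘(ℝ, EuclideanSpace ℝ (Fin d)) (extChartAt (𝓡 d) p) (f y) :=
    (contMDiffAt_extChartAt' (n := ∞) hfy).mdifferentiableAt (by simp)
  rw [toCoord_alongDeriv D hfy hf hs, mvfderiv_fromCoord hy ((vDiffAlongAt_iff hfy hf).1 hs),
    ← mvfderiv_fromCoord hy (g := fun z => extChartAt (𝓡 d) p (f z))
      (MDifferentiableAt.comp y hφ hf)]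
  congr 2
  refine Eq.trans ?_ (mfderiv_comp_apply (I := 𝓡 n) (I' := 𝓡 d)
    (I'' := 𝓘(ℝ, EuclideanSpace ℝ (Fin d))) (g := extChartAt (𝓡 d) p) y hφ hf
    (fromCoord x y v)).symm
  exact (mvfderiv_extChartAt hfy _).symm

/-- Smoothness at `y` of a vector field along `f`. -/
def SmoothAlongAt (n : ℕ) {d : ℕ} {M : Type*} [TopologicalSpace M]
    [ChartedSpace (EuclideanSpace ℝ (Fin n)) M] {N : Type*} [TopologicalSpace N]
    [ChartedSpace (EuclideanSpace ℝ (Fin d)) N] [IsManifold (𝓡 d) ∞ N] (f : M → N)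
    (s : Π x : M, Tan d (f x)) (y : M) : Prop :=
  ContMDiffAt (𝓡 n) 𝓘(ℝ, EuclideanSpace ℝ (Fin d)) ∞ (fun z => toCoord (f y) (f z) (s z)) y

/-- Transition matrices are smooth, so the choice of chart in the target is immaterial. -/
theorem smoothAlongAt_iff {f : M → N} {s : Π x : M, Tan d (f x)} {p : N} {y : M}
    (hy : f y ∈ (chartAt (EuclideanSpace ℝ (Fin d)) p).source)
    (hf : ContMDiffAt (𝓡 n) (𝓡 d) ∞ f y) :
    SmoothAlongAt n f s y ↔ ContMDiffAt (𝓡 n) 𝓘(ℝ, EuclideanSpace ℝ (Fin d)) ∞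
      (fun z => toCoord p (f z) (s z)) y := by
  have key : ∀ {p p' : N}, f y ∈ (chartAt (EuclideanSpace ℝ (Fin d)) p).source →
      f y ∈ (chartAt (EuclideanSpace ℝ (Fin d)) p').source →
      ContMDiffAt (𝓡 n) 𝓘(ℝ, EuclideanSpace ℝ (Fin d)) ∞ (fun z => toCoord p (f z) (s z)) y →
      ContMDiffAt (𝓡 n) 𝓘(ℝ, EuclideanSpace ℝ (Fin d)) ∞ (fun z => toCoord p' (f z) (s z)) y := by
    intro p p' h h' hs
    have h1 := ((contMDiffAt_coordChange h h').comp y hf).clm_apply hs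
    refine h1.congr_of_eventuallyEq ?_
    filter_upwards [hf.continuousAt.eventually (eventually_mem_source h)] with z hz
    simp only [coordChange, Function.comp_apply, ContinuousLinearMap.comp_apply,
      fromCoord_toCoord hz]
  exact ⟨key (mem_source_self _) hy, key hy (mem_source_self _)⟩

theorem SmoothAlongAt.vDiffAlongAt {f : M → N} {s : Π x : M, Tan d (f x)} {y : M}
    (hs : SmoothAlongAt n f s y) (hf : ContMDiffAt (𝓡 n) (𝓡 d) ∞ f y) : VDiffAlongAt n f s y :=
  (vDiffAlongAt_iff (mem_source_self (f y)) (hf.mdifferentiableAt (by simp))).2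
    (ContMDiffAt.mdifferentiableAt hs (by simp))

/-- The derivative in a coordinate direction of a smooth vector field along `f` is smooth. -/
theorem SmoothAlongAt.alongDeriv {D : AffineConnection d N}
    {f : M → N} (hf : ContMDiff (𝓡 n) (𝓡 d) ∞ f) {s : Π x : M, Tan d (f x)} {x y : M}
    (hD : HasSmoothCoeffAt D (f y))
    (hy : y ∈ (chartAt (EuclideanSpace ℝ (Fin n)) x).source)
    (hs : ∀ᶠ z in nhds y, SmoothAlongAt n f s z) (v : EuclideanSpace ℝ (Fin n)) :
    SmoothAlongAt n f (fun z => alongDeriv n D f s z (fromCoord x z v)) y := by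
  have hfy := mem_source_self (n := d) (f y)
  have hF : ContMDiffAt (𝓡 n) 𝓘(ℝ, EuclideanSpace ℝ (Fin d)) ∞
      (fun z => extChartAt (𝓡 d) (f y) (f z)) y := (contMDiffAt_extChartAt' hfy).comp y (hf y)
  have hS : ContMDiffAt (𝓡 n) 𝓘(ℝ, EuclideanSpace ℝ (Fin d)) ∞
      (fun z => toCoord (f y) (f z) (s z)) y := hs.self_of_nhds
  have hd : ∀ {g : M → EuclideanSpace ℝ (Fin d)},
      ContMDiffAt (𝓡 n) 𝓘(ℝ, EuclideanSpace ℝ (Fin d)) ∞ g y →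
      ContMDiffAt (𝓡 n) 𝓘(ℝ, EuclideanSpace ℝ (Fin d)) ∞
        (fun z => fderiv ℝ (inChart x g) (extChartAt (𝓡 n) x z) v) y := by
    intro g hg
    have h1 : ContDiffAt ℝ ∞ (fderiv ℝ (inChart x g)) (extChartAt (𝓡 n) x y) :=
      (contDiffAt_inChart le_rfl hy hg).fderiv_right (by simp)
    exact contMDiffAt_comp_extChartAt le_rfl hy (h1.clm_apply contDiffAt_const)
  have h1 := (hd hS).add (((hD.contMDiffAt.comp y (hf y)).clm_apply hS).clm_apply (hd hF))
  refine h1.congr_of_eventuallyEq ?_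
  filter_upwards [eventually_mem_source hy, hf.continuous.continuousAt.eventually
    (eventually_mem_source hfy), hs] with z hz hfz hsz
  exact toCoord_alongDeriv_fromCoord D hz hfz ((hf z).mdifferentiableAt (by simp))
    (hsz.vDiffAlongAt (hf z)) v

/-- Derivatives along a map in coordinate directions commute up to the curvature. -/
theorem alongDeriv_comm {D : AffineConnection d N}
    {f : M → N} (hf : ContMDiff (𝓡 n) (𝓡 d) ∞ f) {s : Π x : M, Tan d (f x)} {x y : M}
    (hD : HasSmoothCoeffAt D (f y))
    (hy : y ∈ (chartAt (EuclideanSpace ℝ (Fin n)) x).source)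
    (hs : ∀ᶠ z in nhds y, SmoothAlongAt n f s z) (u v : EuclideanSpace ℝ (Fin n)) :
    alongDeriv n D f (fun z => alongDeriv n D f s z (fromCoord x z v)) y (fromCoord x y u)
      - alongDeriv n D f (fun z => alongDeriv n D f s z (fromCoord x z u)) y (fromCoord x y v)
      = curvature D (f y) (mfderiv (𝓡 n) (𝓡 d) f y (fromCoord x y u))
          (mfderiv (𝓡 n) (𝓡 d) f y (fromCoord x y v)) (s y) := by
  have hfy := mem_source_self (n := d) (f y)
  have hfd : ∀ z, MDifferentiableAt (𝓡 n) (𝓡 d) f z := fun z => (hf z).mdifferentiableAt (by simp)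
  refine toCoord_injective hfy ?_
  rw [toCoord_curvature hD, map_sub]
  set S : M → EuclideanSpace ℝ (Fin d) := fun z => toCoord (f y) (f z) (s z) with hSdef
  set F : M → EuclideanSpace ℝ (Fin d) := fun z => extChartAt (𝓡 d) (f y) (f z) with hFdef
  set q := extChartAt (𝓡 n) x y with hq
  have hF : ContMDiffAt (𝓡 n) 𝓘(ℝ, EuclideanSpace ℝ (Fin d)) ∞ F y :=
    (contMDiffAt_extChartAt' hfy).comp y (hf y)
  have hS : ContMDiffAt (𝓡 n) 𝓘(ℝ, EuclideanSpace ℝ (Fin d)) ∞ S y := hs.self_of_nhds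
  have hF' := contDiffAt_inChart le_rfl hy hF
  have hS' := contDiffAt_inChart le_rfl hy hS
  have hdf : ∀ u, toCoord (f y) (f y) (mfderiv (𝓡 n) (𝓡 d) f y (fromCoord x y u))
      = fderiv ℝ (inChart x F) q u := by
    intro u
    have hφ : MDifferentiableAt (𝓡 d) 𝓘(ℝ, EuclideanSpace ℝ (Fin d)) (extChartAt (𝓡 d) (f y))
      (f y) := (contMDiffAt_extChartAt' (n := ∞) hfy).mdifferentiableAt (by simp)
    rw [← mvfderiv_fromCoord hy (g := F) (MDifferentiableAt.comp y hφ (hfd y))]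
    refine Eq.trans ?_ (mfderiv_comp_apply (I := 𝓡 n) (I' := 𝓡 d)
      (I'' := 𝓘(ℝ, EuclideanSpace ℝ (Fin d))) (g := extChartAt (𝓡 d) (f y)) y hφ (hfd y)
      (fromCoord x y u)).symm
    exact (mvfderiv_extChartAt hfy _).symm
  set G : M → EuclideanSpace ℝ (Fin d) →L[ℝ] EuclideanSpace ℝ (Fin d) →L[ℝ]
    EuclideanSpace ℝ (Fin d) := fun z => connCoeff D (f y) (f z) with hGdef
  have hG : ContMDiffAt (𝓡 n) 𝓘(ℝ, EuclideanSpace ℝ (Fin d) →L[ℝ] EuclideanSpace ℝ (Fin d) →L[ℝ]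
    EuclideanSpace ℝ (Fin d)) ∞ G y := hD.contMDiffAt.comp y (hf y)
  have hG' := contDiffAt_inChart le_rfl hy hG
  have hdG : ∀ u, mvfderiv (𝓡 d) (connCoeff D (f y)) (f y)
      (mfderiv (𝓡 n) (𝓡 d) f y (fromCoord x y u)) = fderiv ℝ (inChart x G) q u := by
    intro u
    rw [← mvfderiv_fromCoord hy (hG.mdifferentiableAt (by simp))]
    exact (mfderiv_comp_apply (I := 𝓡 n) (I' := 𝓡 d)
      (g := connCoeff D (f y)) y (hD.contMDiffAt.mdifferentiableAt (by simp)) (hfd y)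
      (fromCoord x y u)).symm
  have hev : ∀ v, (inChart x fun z => toCoord (f y) (f z)
        (alongDeriv n D f s z (fromCoord x z v))) =ᶠ[nhds q]
      fun r => fderiv ℝ (inChart x S) r v
        + inChart x G r (inChart x S r) (fderiv ℝ (inChart x F) r v) := by
    intro v
    have h1 : (fun z => toCoord (f y) (f z) (alongDeriv n D f s z (fromCoord x z v))) =ᶠ[nhds y]
        fun z => fderiv ℝ (inChart x S) (extChartAt (𝓡 n) x z) v
          + G z (S z) (fderiv ℝ (inChart x F) (extChartAt (𝓡 n) x z) v) := by
      filter_upwards [eventually_mem_source hy, hf.continuous.continuousAt.eventually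
        (eventually_mem_source hfy), hs] with z hz hfz hsz
      exact toCoord_alongDeriv_fromCoord D hz hfz (hfd z) (hsz.vDiffAlongAt (hf z)) v
    refine (inChart_congr hy h1).trans ?_
    filter_upwards [extChartAt_target_mem_nhds_of_mem hy] with r hr
    simp only [inChart, (extChartAt (𝓡 n) x).right_inv hr]
  -- Leibniz rule for dS + G(S, dF). After skew-symmetrization in u, v the second derivatives of S
  -- and F drop out, the terms G(dS, dF) cancel against those from the outer coefficient, and what
  -- remains is the coordinate expression of the curvature.
  have hd1 : ∀ u v, fderiv ℝ (inChart x fun z => toCoord (f y) (f z)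
        (alongDeriv n D f s z (fromCoord x z v))) q u
      = fderiv ℝ (fderiv ℝ (inChart x S)) q u v
        + (fderiv ℝ (inChart x G) q u (S y) (fderiv ℝ (inChart x F) q v)
          + G y (fderiv ℝ (inChart x S) q u) (fderiv ℝ (inChart x F) q v)
          + G y (S y) (fderiv ℝ (fderiv ℝ (inChart x F)) q u v)) := by
    intro u v
    rw [(hev v).fderiv_eq]
    have a1 : HasFDerivAt (fderiv ℝ (inChart x S)) (fderiv ℝ (fderiv ℝ (inChart x S)) q) q :=
      ((hS'.fderiv_right (m := ∞) (by simp)).differentiableAt (by simp)).hasFDerivAt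
    have a2 : HasFDerivAt (fderiv ℝ (inChart x F)) (fderiv ℝ (fderiv ℝ (inChart x F)) q) q :=
      ((hF'.fderiv_right (m := ∞) (by simp)).differentiableAt (by simp)).hasFDerivAt
    have a3 := (hS'.differentiableAt (by simp)).hasFDerivAt
    have a4 := (hG'.differentiableAt (by simp)).hasFDerivAt
    have a5 := (a1.clm_apply (hasFDerivAt_const v q)).add
      ((a4.clm_apply a3).clm_apply (a2.clm_apply (hasFDerivAt_const v q)))
    refine (congrArg (fun L => L u) a5.fderiv).trans ?_
    have e1 : inChart x G q = G y := inChart_apply hy G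
    have e2 : inChart x S q = S y := inChart_apply hy S
    rw [← hq, e1, e2]
    simp
    abel
  have hsm : ∀ v, VDiffAlongAt n f (fun z => alongDeriv n D f s z (fromCoord x z v)) y :=
    fun v => (SmoothAlongAt.alongDeriv hf hD hy hs v).vDiffAlongAt (hf y)
  have hT : ∀ v, toCoord (f y) (f y) (alongDeriv n D f s y (fromCoord x y v))
      = fderiv ℝ (inChart x S) q v + G y (S y) (fderiv ℝ (inChart x F) q v) :=
    fun v => toCoord_alongDeriv_fromCoord D hy hfy (hfd y) (hs.self_of_nhds.vDiffAlongAt (hf y)) v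
  rw [toCoord_alongDeriv_fromCoord D hy hfy (hfd y) (hsm v) u,
    toCoord_alongDeriv_fromCoord D hy hfy (hfd y) (hsm u) v, hT, hT, hd1, hd1, hdf, hdf, hdG, hdG,
    fderiv_fderiv_comm hS' v u, fderiv_fderiv_comm hF' v u]
  simp only [map_add, add_apply]
  abel

end LocalCurvature

/-! ### From smooth coefficients to smooth connections -/

section Smoothness

variable {n : ℕ} {M : Type*} [TopologicalSpace M] [ChartedSpace (EuclideanSpace ℝ (Fin n)) M]
  [IsManifold (𝓡 n) ∞ M]

/-- In a chart the covariant derivative of a field with components S is dS + Γ(S), so smoothness of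
Γ at the centres of charts is all that is needed. -/
theorem contMDiffCovariantDerivativeOn_of_connCoeff {D : AffineConnection n M} {U : Set M}
    (hU : IsOpen U) (hD : ∀ x ∈ U, HasSmoothCoeffAt D x) :
    ContMDiffCovariantDerivativeOn (EuclideanSpace ℝ (Fin n)) ∞ D.toFun U where
  contMDiff := by
    intro Y hY x hx
    refine ContMDiffAt.contMDiffWithinAt ?_
    have hxs := mem_source_self (n := n) x
    have hY1 : ∀ z ∈ U, ContMDiffAt (𝓡 n) ((𝓡 n).prod 𝓘(ℝ, EuclideanSpace ℝ (Fin n))) ∞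
        (fun z => TotalSpace.mk' (EuclideanSpace ℝ (Fin n)) z (Y z)) z := fun z hz =>
      ((hY z hz).contMDiffAt (hU.mem_nhds hz)).of_le (by simp)
    have hS : ContMDiffAt (𝓡 n) 𝓘(ℝ, EuclideanSpace ℝ (Fin n)) ∞ (fun z => toCoord x z (Y z)) x := by
      refine ((contMDiffAt_section x).1 (hY1 x hx)).congr_of_eventuallyEq ?_
      filter_upwards [eventually_mem_source hxs] with z hz
      exact toCoord_eq_trivializationAt hz _
    rw [contMDiffAt_hom_bundle]
    refine ⟨contMDiffAt_id, ?_⟩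
    have h1 : ContMDiffAt (𝓡 n) 𝓘(ℝ, EuclideanSpace ℝ (Fin n) →L[ℝ] EuclideanSpace ℝ (Fin n)) ∞
        (fun z => fderiv ℝ (inChart x fun z => toCoord x z (Y z)) (extChartAt (𝓡 n) x z)
          + connCoeff D x z (toCoord x z (Y z))) x := by
      refine ContMDiffAt.add ?_ ((hD x hx).contMDiffAt.clm_apply hS)
      exact contMDiffAt_comp_extChartAt le_rfl hxs
        ((contDiffAt_inChart le_rfl hxs hS).fderiv_right (by simp))
    refine h1.congr_of_eventuallyEq ?_
    filter_upwards [eventually_mem_source hxs, hU.mem_nhds hx] with z hz hzU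
    ext1 a
    have hYz : VDiffAt Y z := (hY1 z hzU).mdifferentiableAt (by simp)
    have h2 := toCoord_connection D hz hYz (fromCoord x z a)
    rw [mvfderiv_fromCoord hz ((vDiffAt_iff hz).1 hYz), toCoord_fromCoord hz] at h2
    exact h2

end Smoothness

/-! ### Metrics and endomorphism fields in the preferred charts -/

section FormCoord

variable {n d : ℕ} {M : Type*} [TopologicalSpace M] [ChartedSpace (EuclideanSpace ℝ (Fin n)) M]
  [IsManifold (𝓡 n) ∞ M]
  {N : Type*} [TopologicalSpace N] [ChartedSpace (EuclideanSpace ℝ (Fin d)) N]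
  [IsManifold (𝓡 d) ∞ N]

/-- The components at `y` of a metric in the preferred chart around `x`, as a bilinear form. -/
def formCoord (g : PseudoRiemannianMetric n M) (x y : M) :
    EuclideanSpace ℝ (Fin n) →L[ℝ] EuclideanSpace ℝ (Fin n) →L[ℝ] ℝ :=
  clmOfBasis fun i => clmOfBasis fun j =>
    g.inner y (fromCoord x y (EuclideanSpace.single i (1 : ℝ)))
      (fromCoord x y (EuclideanSpace.single j (1 : ℝ)))

theorem formCoord_apply (g : PseudoRiemannianMetric n M) (x y : M)
    (v w : EuclideanSpace ℝ (Fin n)) :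
    formCoord g x y v w = g.inner y (fromCoord x y v) (fromCoord x y w) := by
  unfold formCoord
  rw [clmOfBasis_apply]
  simp only [sum_apply, smul_apply]
  have h : ∀ i : Fin n, clmOfBasis (fun j => g.inner y
      (fromCoord x y (EuclideanSpace.single i (1 : ℝ)))
      (fromCoord x y (EuclideanSpace.single j (1 : ℝ)))) w
      = g.inner y (fromCoord x y (EuclideanSpace.single i (1 : ℝ))) (fromCoord x y w) := by
    intro i
    rw [clmOfBasis_apply]
    conv_rhs => rw [euclidean_eq_sum w]
    simp only [map_sum, map_smul]
  simp only [h]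
  conv_rhs => rw [euclidean_eq_sum v]
  simp only [map_sum, map_smul, sum_apply, smul_apply]

theorem formCoord_symm (g : PseudoRiemannianMetric n M) (x y : M)
    (v w : EuclideanSpace ℝ (Fin n)) : formCoord g x y v w = formCoord g x y w v := by
  rw [formCoord_apply, formCoord_apply, g.symm]

theorem formCoord_toCoord (g : PseudoRiemannianMetric n M) {x y : M}
    (hy : y ∈ (chartAt (EuclideanSpace ℝ (Fin n)) x).source) (v w : Tan n y) :
    formCoord g x y (toCoord x y v) (toCoord x y w) = g.inner y v w := by
  rw [formCoord_apply, fromCoord_toCoord hy, fromCoord_toCoord hy]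

theorem formCoord_nondegenerate (g : PseudoRiemannianMetric n M) {x y : M}
    (hy : y ∈ (chartAt (EuclideanSpace ℝ (Fin n)) x).source) (v : EuclideanSpace ℝ (Fin n))
    (hv : ∀ w, formCoord g x y v w = 0) : v = 0 := by
  have h := g.nondegenerate y (fromCoord x y v) fun w => by
    have := hv (toCoord x y w)
    rwa [formCoord_apply, fromCoord_toCoord hy] at this
  rw [← toCoord_fromCoord hy v, h, map_zero]

theorem contMDiffAt_formCoord (g : PseudoRiemannianMetric n M) {x y : M}
    (hy : y ∈ (chartAt (EuclideanSpace ℝ (Fin n)) x).source) :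
    ContMDiffAt (𝓡 n) 𝓘(ℝ, EuclideanSpace ℝ (Fin n) →L[ℝ] EuclideanSpace ℝ (Fin n) →L[ℝ] ℝ) ∞
      (formCoord g x) y := by
  refine contMDiffAt_clmOfBasis fun i => contMDiffAt_clmOfBasis fun j => ?_
  have hs : ∀ e : EuclideanSpace ℝ (Fin n), ContMDiffAt (𝓡 n)
      ((𝓡 n).prod 𝓘(ℝ, EuclideanSpace ℝ (Fin n))) ∞
      (fun z => TotalSpace.mk' (EuclideanSpace ℝ (Fin n)) z (fromCoord x z e)) y := by
    intro e
    rw [(trivializationAt (EuclideanSpace ℝ (Fin n))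
      (TangentSpace (𝓡 n) : M → Type _) x).contMDiffAt_section_iff hy]
    refine (contMDiffAt_const (c := e)).congr_of_eventuallyEq ?_
    filter_upwards [eventually_mem_source hy] with z hz
    rw [← toCoord_eq_trivializationAt hz, toCoord_fromCoord hz]
  have h := ContMDiffAt.clm_bundle_apply₂ (b := fun z : M => z) (E₃ := fun _ => ℝ) (F₃ := ℝ)
      (g.contMDiff y) (hs (EuclideanSpace.single i (1 : ℝ))) (hs (EuclideanSpace.single j (1 : ℝ)))
  exact (contMDiffAt_totalSpace.1 h).2

/-- Raising an index preserves smoothness. -/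
theorem contMDiffAt_of_form {k : ℕ}
    {G : M → EuclideanSpace ℝ (Fin k) →L[ℝ] EuclideanSpace ℝ (Fin k) →L[ℝ] ℝ}
    {S : M → EuclideanSpace ℝ (Fin k)} {y : M}
    (hG : ContMDiffAt (𝓡 n) 𝓘(ℝ, EuclideanSpace ℝ (Fin k) →L[ℝ] EuclideanSpace ℝ (Fin k) →L[ℝ] ℝ) ∞
      G y)
    (hnd : ∀ v, (∀ w, G y v w = 0) → v = 0)
    (hS : ∀ e, ContMDiffAt (𝓡 n) 𝓘(ℝ, ℝ) ∞ (fun z => G z (S z) e) y) :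
    ContMDiffAt (𝓡 n) 𝓘(ℝ, EuclideanSpace ℝ (Fin k)) ∞ S y := by
  have hinj : Function.Injective (G y).toLinearMap := by
    rw [injective_iff_map_eq_zero]
    intro v hv
    refine hnd v fun w => ?_
    have : G y v = 0 := hv
    rw [this]
    rfl
  have hdim : Module.finrank ℝ (EuclideanSpace ℝ (Fin k))
      = Module.finrank ℝ (EuclideanSpace ℝ (Fin k) →L[ℝ] ℝ) := by
    rw [← (LinearMap.toContinuousLinearMap :
      (EuclideanSpace ℝ (Fin k) →ₗ[ℝ] ℝ) ≃ₗ[ℝ] _).finrank_eq]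
    exact (Subspace.dual_finrank_eq (K := ℝ) (V := EuclideanSpace ℝ (Fin k))).symm
  let e : EuclideanSpace ℝ (Fin k) ≃L[ℝ] (EuclideanSpace ℝ (Fin k) →L[ℝ] ℝ) :=
    (LinearEquiv.ofInjectiveOfFinrankEq (G y).toLinearMap hinj hdim).toContinuousLinearEquiv
  have he : (e : EuclideanSpace ℝ (Fin k) →L[ℝ] (EuclideanSpace ℝ (Fin k) →L[ℝ] ℝ)) = G y := by
    ext1 v
    rfl
  -- At y the form is an isomorphism onto the dual space, and inversion of operators is smooth
  -- there. Near y, S is the inverse of G applied to the smooth covector field G(S, ·).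
  have h1 : ContDiffAt ℝ ∞ (ContinuousLinearMap.inverse :
      (EuclideanSpace ℝ (Fin k) →L[ℝ] (EuclideanSpace ℝ (Fin k) →L[ℝ] ℝ)) → _) (G y) := by
    rw [← he]
    exact contDiffAt_map_inverse e
  have h2 := (contMDiffAt_iff_contDiffAt.2 h1).comp y hG
  have h3 : ContMDiffAt (𝓡 n) 𝓘(ℝ, EuclideanSpace ℝ (Fin k) →L[ℝ] ℝ) ∞
      (fun z => G z (S z)) y := by
    have := contMDiffAt_clmOfBasis (p := y) (L := fun z i => G z (S z) (EuclideanSpace.single i 1))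
      fun i => hS (EuclideanSpace.single i 1)
    refine this.congr_of_eventuallyEq (Filter.Eventually.of_forall fun z => ?_)
    ext1 e
    rw [clmOfBasis_eq (fun e => G z (S z) e) (fun a b => map_add _ _ _) fun r a => map_smul _ _ _]
  refine (h2.clm_apply h3).congr_of_eventuallyEq ?_
  have hopen : ∀ᶠ L in nhds (G y), L.IsInvertible := by
    rw [← he]
    exact e.nhds
  filter_upwards [hG.continuousAt.eventually hopen] with z hz
  simp only [Function.comp_apply]
  exact (hz.inverse_apply_eq.2 rfl).symm

/-- Compatibility of a connection with a metric, at the centres of the charts. -/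
def IsMetricConnection (D : AffineConnection n M) (g : PseudoRiemannianMetric n M) : Prop :=
  ∀ (x : M) (a v w : EuclideanSpace ℝ (Fin n)),
    mvfderiv (𝓡 n) (formCoord g x) x (fromCoord x x a) v w
      = formCoord g x x (connCoeff D x x v a) w + formCoord g x x v (connCoeff D x x w a)

theorem toCoord_alongDeriv_self (D : AffineConnection d N) {f : M → N} {s : Π x : M, Tan d (f x)}
    {y : M} (hf : MDifferentiableAt (𝓡 n) (𝓡 d) f y) (hs : VDiffAlongAt n f s y) (v : Tan n y) :
    toCoord (f y) (f y) (alongDeriv n D f s y v)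
      = mvfderiv (𝓡 n) (fun z => toCoord (f y) (f z) (s z)) y v
        + connCoeff D (f y) (f y) (toCoord (f y) (f y) (s y))
          (toCoord (f y) (f y) (mfderiv (𝓡 n) (𝓡 d) f y v)) :=
  toCoord_alongDeriv D (mem_source_self (f y)) hf hs v

/-- Compatibility is known only for components at the centres of charts. The chain rule for the
components of g along f turns it into the Leibniz rule for arbitrary fields along f. -/
theorem alongDeriv_metric {D : AffineConnection d N} {g : PseudoRiemannianMetric d N}
    (hg : IsMetricConnection D g) {f : M → N} {s s' : Π x : M, Tan d (f x)} {y : M}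
    (hf : MDifferentiableAt (𝓡 n) (𝓡 d) f y) (hs : VDiffAlongAt n f s y)
    (hs' : VDiffAlongAt n f s' y) (v : Tan n y) :
    mvfderiv (𝓡 n) (fun z => g.inner (f z) (s z) (s' z)) y v
      = g.inner (f y) (alongDeriv n D f s y v) (s' y)
        + g.inner (f y) (s y) (alongDeriv n D f s' y v) := by
  have hfy := mem_source_self (n := d) (f y)
  have hS := (vDiffAlongAt_iff hfy hf).1 hs
  have hS' := (vDiffAlongAt_iff hfy hf).1 hs'
  have hG0 : MDifferentiableAt (𝓡 d) 𝓘(ℝ, EuclideanSpace ℝ (Fin d) →L[ℝ] EuclideanSpace ℝ (Fin d)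
      →L[ℝ] ℝ) (formCoord g (f y)) (f y) :=
    (contMDiffAt_formCoord g hfy).mdifferentiableAt (by simp)
  have hG : MDifferentiableAt (𝓡 n) 𝓘(ℝ, EuclideanSpace ℝ (Fin d) →L[ℝ] EuclideanSpace ℝ (Fin d)
      →L[ℝ] ℝ) (fun z => formCoord g (f y) (f z)) y := hG0.comp y hf
  have hdG : mvfderiv (𝓡 n) (fun z => formCoord g (f y) (f z)) y v
      = mvfderiv (𝓡 d) (formCoord g (f y)) (f y) (mfderiv (𝓡 n) (𝓡 d) f y v) :=
    mfderiv_comp_apply (I := 𝓡 n) (I' := 𝓡 d) (g := formCoord g (f y)) y hG0 hf v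
  have hev : (fun z => g.inner (f z) (s z) (s' z)) =ᶠ[nhds y] fun z =>
      formCoord g (f y) (f z) (toCoord (f y) (f z) (s z)) (toCoord (f y) (f z) (s' z)) := by
    filter_upwards [hf.continuousAt.eventually (eventually_mem_source hfy)] with z hz
    rw [formCoord_toCoord g hz]
  have hm := hg (f y) (toCoord (f y) (f y) (mfderiv (𝓡 n) (𝓡 d) f y v))
    (toCoord (f y) (f y) (s y)) (toCoord (f y) (f y) (s' y))
  rw [fromCoord_toCoord_self] at hm
  rw [mvfderiv_congr hev, mvfderiv_clm_apply (hG.clm_apply hS) hS', mvfderiv_clm_apply hG hS, hdG,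
    ← formCoord_toCoord g hfy, ← formCoord_toCoord g hfy, toCoord_alongDeriv_self D hf hs,
    toCoord_alongDeriv_self D hf hs']
  simp only [add_apply, map_add, hm]
  ring

theorem connection_metric {D : AffineConnection n M} {g : PseudoRiemannianMetric n M}
    (hg : IsMetricConnection D g) {Y Z : Π x : M, Tan n x} {x : M} (hY : VDiffAt Y x)
    (hZ : VDiffAt Z x) (v : Tan n x) :
    mvfderiv (𝓡 n) (fun y => g.inner y (Y y) (Z y)) x v
      = g.inner x (D Y x v) (Z x) + g.inner x (Y x) (D Z x v) := by
  have h := alongDeriv_metric hg (f := fun y : M => y) (s := Y) (s' := Z) mdifferentiableAt_id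
    hY hZ v
  rwa [alongDeriv_id D hY, alongDeriv_id D hZ] at h

/-- Coordinate derivatives of smooth functions are smooth. -/
theorem contMDiffAt_fderiv_inChart {V : Type*} [NormedAddCommGroup V] [NormedSpace ℝ V] {x y : M}
    (hy : y ∈ (chartAt (EuclideanSpace ℝ (Fin n)) x).source) {g : M → V}
    (hg : ContMDiffAt (𝓡 n) 𝓘(ℝ, V) ∞ g y) (a : EuclideanSpace ℝ (Fin n)) :
    ContMDiffAt (𝓡 n) 𝓘(ℝ, V) ∞
      (fun z => fderiv ℝ (inChart x g) (extChartAt (𝓡 n) x z) a) y := by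
  have h1 : ContDiffAt ℝ ∞ (fderiv ℝ (inChart x g)) (extChartAt (𝓡 n) x y) :=
    (contDiffAt_inChart le_rfl hy hg).fderiv_right (by simp)
  exact contMDiffAt_comp_extChartAt le_rfl hy (h1.clm_apply contDiffAt_const)

/-- A torsion-free connection compatible with a metric has smooth coefficients. -/
theorem hasSmoothCoeff_of_metric {D : AffineConnection n M} {g : PseudoRiemannianMetric n M}
    (hg : IsMetricConnection D g) (ht : D.torsion = 0) : HasSmoothCoeff D := by
  refine hasSmoothCoeff_of_apply fun x y hy w a => ?_
  refine contMDiffAt_of_form (contMDiffAt_formCoord g hy) (formCoord_nondegenerate g hy) fun e => ?_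
  set K : EuclideanSpace ℝ (Fin n) → EuclideanSpace ℝ (Fin n) → EuclideanSpace ℝ (Fin n) → M → ℝ :=
    fun a b c z => fderiv ℝ (inChart x (formCoord g x)) (extChartAt (𝓡 n) x z) a b c with hK
  have hKs : ∀ a b c, ContMDiffAt (𝓡 n) 𝓘(ℝ, ℝ) ∞ (K a b c) y := by
    intro a b c
    exact ((contMDiffAt_fderiv_inChart hy (contMDiffAt_formCoord g hy) a).clm_apply
      contMDiffAt_const).clm_apply contMDiffAt_const
  have hKm : ∀ᶠ z in nhds y, ∀ a b c, K a b c z = formCoord g x z (connCoeff D x z b a) c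
      + formCoord g x z b (connCoeff D x z c a) := by
    filter_upwards [eventually_mem_source hy] with z hz a b c
    have hGd : MDifferentiableAt (𝓡 n) 𝓘(ℝ, EuclideanSpace ℝ (Fin n) →L[ℝ]
      EuclideanSpace ℝ (Fin n) →L[ℝ] ℝ) (formCoord g x) z :=
      (contMDiffAt_formCoord g hz).mdifferentiableAt (by simp)
    have h1 := connection_metric hg (vDiffAt_coordField hz b) (vDiffAt_coordField hz c)
      (fromCoord x z a)
    have h2 : (fun z => g.inner z (coordField x b z) (coordField x c z))
        = fun z => formCoord g x z b c := by
      funext z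
      rw [formCoord_apply]
      rfl
    rw [h2, mvfderiv_clm_const (hGd.clm_apply mdifferentiableAt_const), mvfderiv_clm_const hGd,
      mvfderiv_fromCoord hz hGd] at h1
    rw [hK, connCoeff_apply D hz, connCoeff_apply D hz, formCoord_apply, formCoord_apply,
      fromCoord_toCoord hz, fromCoord_toCoord hz]
    exact h1
  -- Koszul's formula in a fixed chart: K a b c is the derivative of g(b, c) in direction a, and by
  -- torsion-freeness this combination isolates g(Γ(w, a), e). Smoothness is obtained this way
  -- because the connection may be specified through a different chart at each point.
  have hfin : ContMDiffAt (𝓡 n) 𝓘(ℝ, ℝ) ∞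
      (fun z => (1 / 2 : ℝ) * (K a w e z + K w a e z - K e a w z)) y :=
    contMDiffAt_const.mul (((hKs a w e).add (hKs w a e)).sub (hKs e a w))
  refine hfin.congr_of_eventuallyEq ?_
  filter_upwards [hKm, eventually_mem_source hy] with z hz hzs
  rw [hz, hz, hz, ← connCoeff_apply D hzs, connCoeff_comm ht hzs a w, connCoeff_comm ht hzs e w,
    connCoeff_comm ht hzs e a, formCoord_symm g x z (connCoeff D x z a e) w,
    formCoord_symm g x z w (connCoeff D x z a e)]
  ring

end FormCoord

/-! ### The Levi-Civita connection -/

section LeviCivitaProperties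

variable {n : ℕ} {M : Type*} [TopologicalSpace M] [ChartedSpace (EuclideanSpace ℝ (Fin n)) M]
  [IsManifold (𝓡 n) ∞ M]

theorem euclidean_induction {P : EuclideanSpace ℝ (Fin n) → Prop}
    (hadd : ∀ a b, P a → P b → P (a + b)) (hsmul : ∀ (r : ℝ) a, P a → P (r • a)) (h0 : P 0)
    (hbasis : ∀ i, P (EuclideanSpace.single i (1 : ℝ))) (e : EuclideanSpace ℝ (Fin n)) : P e := by
  rw [euclidean_eq_sum e]
  exact Finset.sum_induction _ P hadd h0 fun i _ => hsmul _ _ (hbasis i)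

theorem coordVec_eq_fromCoord (x : M) (i : Fin n) :
    coordVec x i = fromCoord x x (EuclideanSpace.single i (1 : ℝ)) :=
  (fromCoord_self x _).symm

theorem toCoord_coordVec (x : M) (i : Fin n) :
    toCoord x x (coordVec x i) = EuclideanSpace.single i (1 : ℝ) := toCoord_self x _

theorem coord_eq_toCoord (x : M) (k : Fin n) (v : Tan n x) : coord x k v = toCoord x x v k := by
  rw [toCoord_self]
  rfl

theorem frame_eq {x y : M} (hy : y ∈ (chartAt (EuclideanSpace ℝ (Fin n)) x).source) (i : Fin n) :
    frame x i y = fromCoord x y (EuclideanSpace.single i (1 : ℝ)) := by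
  unfold frame
  rw [extendVec_eq hy, toCoord_coordVec]

theorem frame_self (x : M) (i : Fin n) : frame x i x = coordVec x i := extendVec_self _

theorem gram_eq (g : PseudoRiemannianMetric n M) {x y : M}
    (hy : y ∈ (chartAt (EuclideanSpace ℝ (Fin n)) x).source) (i j : Fin n) :
    gram g x y i j = formCoord g x y (EuclideanSpace.single i (1 : ℝ))
      (EuclideanSpace.single j (1 : ℝ)) := by
  rw [formCoord_apply, ← frame_eq hy, ← frame_eq hy]
  rfl

/-- A kernel vector of the Gram matrix would give the components of a nonzero vector orthogonal to
everything. -/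
theorem isUnit_det_gram (g : PseudoRiemannianMetric n M) {x y : M}
    (hy : y ∈ (chartAt (EuclideanSpace ℝ (Fin n)) x).source) : IsUnit (gram g x y).det := by
  rw [isUnit_iff_ne_zero]
  intro h
  obtain ⟨v, hv, hv0⟩ := Matrix.exists_mulVec_eq_zero_iff.2 h
  refine hv ?_
  have h1 : (∑ i, v i • EuclideanSpace.single i (1 : ℝ) : EuclideanSpace ℝ (Fin n)) = 0 := by
    refine formCoord_nondegenerate g hy _ fun w => ?_
    rw [euclidean_eq_sum w]
    simp only [map_sum, map_smul, sum_apply, smul_apply]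
    refine Finset.sum_eq_zero fun j _ => ?_
    have h2 := congrFun hv0 j
    simp only [Matrix.mulVec, dotProduct, gram_eq g hy] at h2
    have h3 : ∑ i, v i • formCoord g x y (EuclideanSpace.single i (1 : ℝ))
        (EuclideanSpace.single j (1 : ℝ)) = 0 := by
      refine Eq.trans ?_ h2
      refine Finset.sum_congr rfl fun i _ => ?_
      rw [formCoord_symm, smul_eq_mul, mul_comm]
    rw [h3, smul_zero]
  funext k
  have h4 := congrArg (fun e : EuclideanSpace ℝ (Fin n) => e k) h1
  simpa [Pi.single_apply] using h4

theorem gram_symm (g : PseudoRiemannianMetric n M) (x y : M) (i j : Fin n) :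
    gram g x y i j = gram g x y j i := g.symm _ _ _

theorem sum_upper_mul_lower (g : PseudoRiemannianMetric n M) (x : M) (i j : Fin n) :
    ∑ k, upper g x i k * lower g x k j = if i = j then 1 else 0 := by
  have h := congrFun (congrFun (Matrix.nonsing_inv_mul (gram g x x)
    (isUnit_det_gram g (mem_source_self x))) i) j
  rwa [Matrix.mul_apply, Matrix.one_apply] at h

theorem sum_lower_mul_upper (g : PseudoRiemannianMetric n M) (x : M) (i j : Fin n) :
    ∑ k, lower g x i k * upper g x k j = if i = j then 1 else 0 := by
  have h := congrFun (congrFun (Matrix.mul_nonsing_inv (gram g x x)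
    (isUnit_det_gram g (mem_source_self x))) i) j
  rwa [Matrix.mul_apply, Matrix.one_apply] at h

theorem lower_symm (g : PseudoRiemannianMetric n M) (x : M) (i j : Fin n) :
    lower g x i j = lower g x j i := gram_symm g x x i j

theorem upper_symm (g : PseudoRiemannianMetric n M) (x : M) (i j : Fin n) :
    upper g x i j = upper g x j i := by
  have h : (gram g x x).transpose = gram g x x := by
    ext i j
    exact gram_symm g x x j i
  have h2 := Matrix.transpose_nonsing_inv (gram g x x)
  rw [h] at h2
  exact congrFun (congrFun h2 j) i

theorem lower_eq_formCoord (g : PseudoRiemannianMetric n M) (x : M) (i j : Fin n) :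
    lower g x i j = formCoord g x x (EuclideanSpace.single i (1 : ℝ))
      (EuclideanSpace.single j (1 : ℝ)) := gram_eq g (mem_source_self x) i j

theorem lower_eq_inner (g : PseudoRiemannianMetric n M) (x : M) (i j : Fin n) :
    lower g x i j = g.inner x (coordVec x i) (coordVec x j) := by
  rw [← frame_self, ← frame_self]
  rfl

/-- The derivative of the components of a metric at the centre of a chart. -/
def formDeriv (g : PseudoRiemannianMetric n M) (x : M) (a v w : EuclideanSpace ℝ (Fin n)) : ℝ :=
  mvfderiv (𝓡 n) (formCoord g x) x (fromCoord x x a) v w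

theorem mdifferentiableAt_formCoord (g : PseudoRiemannianMetric n M) {x y : M}
    (hy : y ∈ (chartAt (EuclideanSpace ℝ (Fin n)) x).source) :
    MDifferentiableAt (𝓡 n) 𝓘(ℝ, EuclideanSpace ℝ (Fin n) →L[ℝ] EuclideanSpace ℝ (Fin n) →L[ℝ] ℝ)
      (formCoord g x) y := (contMDiffAt_formCoord g hy).mdifferentiableAt (by simp)

theorem mvfderiv_formCoord_apply (g : PseudoRiemannianMetric n M) {x y : M}
    (hy : y ∈ (chartAt (EuclideanSpace ℝ (Fin n)) x).source) (v w : EuclideanSpace ℝ (Fin n))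
    (u : Tan n y) :
    mvfderiv (𝓡 n) (fun z => formCoord g x z v w) y u = mvfderiv (𝓡 n) (formCoord g x) y u v w := by
  have hG := mdifferentiableAt_formCoord g hy
  rw [mvfderiv_clm_const (hG.clm_apply mdifferentiableAt_const), mvfderiv_clm_const hG]

theorem formDeriv_symm (g : PseudoRiemannianMetric n M) (x : M) (a v w : EuclideanSpace ℝ (Fin n)) :
    formDeriv g x a v w = formDeriv g x a w v := by
  unfold formDeriv
  rw [← mvfderiv_formCoord_apply g (mem_source_self x),
    ← mvfderiv_formCoord_apply g (mem_source_self x)]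
  refine congrArg (fun L : Tan n x →L[ℝ] ℝ => L _) (mvfderiv_congr ?_)
  exact Filter.Eventually.of_forall fun z => formCoord_symm g x z v w

theorem formDeriv_eq (g : PseudoRiemannianMetric n M) (x : M) (a v w : EuclideanSpace ℝ (Fin n)) :
    formDeriv g x a v w
      = mvfderiv (𝓡 n) (fun z => formCoord g x z v w) x (fromCoord x x a) :=
  (mvfderiv_formCoord_apply g (mem_source_self x) v w _).symm

theorem formDeriv_add_left (g : PseudoRiemannianMetric n M) (x : M)
    (a b v w : EuclideanSpace ℝ (Fin n)) :
    formDeriv g x (a + b) v w = formDeriv g x a v w + formDeriv g x b v w := by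
  simp only [formDeriv_eq, map_add]

theorem formDeriv_smul_left (g : PseudoRiemannianMetric n M) (x : M) (r : ℝ)
    (a v w : EuclideanSpace ℝ (Fin n)) :
    formDeriv g x (r • a) v w = r * formDeriv g x a v w := by
  simp only [formDeriv_eq, map_smul, smul_eq_mul]

theorem formDeriv_add_middle (g : PseudoRiemannianMetric n M) (x : M)
    (a v v' w : EuclideanSpace ℝ (Fin n)) :
    formDeriv g x a (v + v') w = formDeriv g x a v w + formDeriv g x a v' w := by
  unfold formDeriv
  generalize mvfderiv (𝓡 n) (formCoord g x) x (fromCoord x x a) = L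
  exact congrArg (fun L : EuclideanSpace ℝ (Fin n) →L[ℝ] ℝ => L w) (L.map_add v v')

theorem formDeriv_smul_middle (g : PseudoRiemannianMetric n M) (x : M) (r : ℝ)
    (a v w : EuclideanSpace ℝ (Fin n)) :
    formDeriv g x a (r • v) w = r * formDeriv g x a v w := by
  unfold formDeriv
  generalize mvfderiv (𝓡 n) (formCoord g x) x (fromCoord x x a) = L
  exact congrArg (fun L : EuclideanSpace ℝ (Fin n) →L[ℝ] ℝ => L w) (L.map_smul r v)

theorem formDeriv_add_right (g : PseudoRiemannianMetric n M) (x : M)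
    (a v w w' : EuclideanSpace ℝ (Fin n)) :
    formDeriv g x a v (w + w') = formDeriv g x a v w + formDeriv g x a v w' := by
  rw [formDeriv_symm, formDeriv_add_middle, formDeriv_symm g x a w, formDeriv_symm g x a w']

theorem formDeriv_smul_right (g : PseudoRiemannianMetric n M) (x : M) (r : ℝ)
    (a v w : EuclideanSpace ℝ (Fin n)) :
    formDeriv g x a v (r • w) = r * formDeriv g x a v w := by
  rw [formDeriv_symm, formDeriv_smul_middle, formDeriv_symm g x a w]

theorem pderiv_gram (g : PseudoRiemannianMetric n M) (x : M) (i j k : Fin n) :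
    pderiv (fun y => gram g x y j k) x i = formDeriv g x (EuclideanSpace.single i (1 : ℝ))
      (EuclideanSpace.single j (1 : ℝ)) (EuclideanSpace.single k (1 : ℝ)) := by
  unfold pderiv formDeriv
  rw [← mvfderiv_formCoord_apply g (mem_source_self x), coordVec_eq_fromCoord]
  refine congrArg (fun L : Tan n x →L[ℝ] ℝ => L _) (mvfderiv_congr ?_)
  filter_upwards [eventually_mem_source (mem_source_self (n := n) x)] with z hz
  exact gram_eq g hz j k

theorem sum_christoffel_mul_lower (g : PseudoRiemannianMetric n M) (x : M) (i j l : Fin n) :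
    ∑ k, christoffel g x i j k * lower g x k l
      = (1 / 2) * (pderiv (fun y => gram g x y j l) x i + pderiv (fun y => gram g x y i l) x j
        - pderiv (fun y => gram g x y i j) x l) := by
  unfold christoffel
  set c : Fin n → ℝ := fun l => pderiv (fun y => gram g x y j l) x i
    + pderiv (fun y => gram g x y i l) x j - pderiv (fun y => gram g x y i j) x l with hc
  calc ∑ k, (1 / 2 * ∑ m, upper g x k m * c m) * lower g x k l
      = (1 / 2) * ∑ m, c m * ∑ k, lower g x l k * upper g x k m := by
        simp only [Finset.mul_sum, Finset.sum_mul]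
        rw [Finset.sum_comm]
        refine Finset.sum_congr rfl fun m _ => Finset.sum_congr rfl fun k _ => ?_
        rw [lower_symm g x k l]
        ring
    _ = (1 / 2) * c l := by
        simp only [sum_lower_mul_upper, mul_ite, mul_one, mul_zero, Finset.sum_ite_eq,
          Finset.mem_univ, if_true]

theorem bilinOfCoeff_apply (x : M) (C : Fin n → Fin n → Fin n → ℝ) (w v : Tan n x) :
    bilinOfCoeff x C w v = ∑ i, ∑ j, ∑ k, (C i j k * (coord x j w * coord x i v)) • coordVec x k := by
  unfold bilinOfCoeff
  simp only [sum_apply, smul_apply, ContinuousLinearMap.smulRight_apply, smul_smul,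
    mul_assoc]

theorem bilinOfCoeff_coordVec (x : M) (C : Fin n → Fin n → Fin n → ℝ) (i j : Fin n) :
    bilinOfCoeff x C (coordVec x j) (coordVec x i) = ∑ k, C i j k • coordVec x k := by
  rw [bilinOfCoeff_apply]
  have h : ∀ i j : Fin n, coord x j (coordVec x i) = if j = i then 1 else 0 := by
    intro i j
    rw [coord_eq_toCoord, toCoord_coordVec]
    simp
  simp only [h]
  rw [Finset.sum_eq_single i, Finset.sum_eq_single j]
  · simp
  · intro b _ hb
    simp [hb]
  · simp
  · intro b _ hb
    simp [hb]
  · simp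

theorem addOneForm_extendVec (D : AffineConnection n M)
    (B : Π x : M, Tan n x →L[ℝ] Tan n x →L[ℝ] Tan n x) (x : M) (w v : Tan n x) :
    D.addOneForm B (extendVec w) x v = D (extendVec w) x v + B x w v := by
  have h : D.addOneForm B (extendVec w) x = D (extendVec w) x + B x (extendVec w x) := rfl
  rw [h, extendVec_self]
  rfl

theorem leviCivita_extendVec (g : PseudoRiemannianMetric n M) (x : M) (w a : Tan n x) :
    leviCivita g (extendVec w) x a = bilinOfCoeff x (christoffel g x) w a := by
  unfold leviCivita
  rw [addOneForm_extendVec, chartConnection_extendVec]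
  simp

theorem connCoeff_self (D : AffineConnection n M) (x : M) (w a : EuclideanSpace ℝ (Fin n)) :
    connCoeff D x x w a = toCoord x x (D (extendVec (fromCoord x x w)) x (fromCoord x x a)) := by
  rw [connCoeff_apply D (mem_source_self x), connection_extendVec D (mem_source_self x),
    toCoord_fromCoord_self]

/-- Two functions which are linear in each of three variables agree if they agree on the
standard basis. -/
theorem euclidean_trilinear_ext
    {T : EuclideanSpace ℝ (Fin n) → EuclideanSpace ℝ (Fin n) → EuclideanSpace ℝ (Fin n) → ℝ}
    (hadd1 : ∀ u u' v w, T (u + u') v w = T u v w + T u' v w)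
    (hsmul1 : ∀ (r : ℝ) u v w, T (r • u) v w = r * T u v w)
    (hadd2 : ∀ u v v' w, T u (v + v') w = T u v w + T u v' w)
    (hsmul2 : ∀ (r : ℝ) u v w, T u (r • v) w = r * T u v w)
    (hadd3 : ∀ u v w w', T u v (w + w') = T u v w + T u v w')
    (hsmul3 : ∀ (r : ℝ) u v w, T u v (r • w) = r * T u v w)
    (h : ∀ i j k, T (EuclideanSpace.single i (1 : ℝ)) (EuclideanSpace.single j (1 : ℝ))
      (EuclideanSpace.single k (1 : ℝ)) = 0)
    (u v w : EuclideanSpace ℝ (Fin n)) : T u v w = 0 := by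
  have z1 : ∀ v w, T 0 v w = 0 := fun v w => by have := hsmul1 0 0 v w; simpa using this
  have z2 : ∀ u w, T u 0 w = 0 := fun u w => by have := hsmul2 0 u 0 w; simpa using this
  have z3 : ∀ u v, T u v 0 = 0 := fun u v => by have := hsmul3 0 u v 0; simpa using this
  have h3 : ∀ i j w, T (EuclideanSpace.single i (1 : ℝ)) (EuclideanSpace.single j (1 : ℝ)) w = 0 :=
    fun i j w => euclidean_induction (P := fun w => T _ _ w = 0)
      (fun a b ha hb => by rw [hadd3, ha, hb, add_zero])
      (fun r a ha => by rw [hsmul3, ha, mul_zero]) (z3 _ _) (h i j) w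
  have h2 : ∀ i v w, T (EuclideanSpace.single i (1 : ℝ)) v w = 0 :=
    fun i v w => euclidean_induction (P := fun v => T _ v w = 0)
      (fun a b ha hb => by rw [hadd2, ha, hb, add_zero])
      (fun r a ha => by rw [hsmul2, ha, mul_zero]) (z2 _ _) (fun j => h3 i j w) v
  exact euclidean_induction (P := fun u => T u v w = 0)
      (fun a b ha hb => by rw [hadd1, ha, hb, add_zero])
      (fun r a ha => by rw [hsmul1, ha, mul_zero]) (z1 _ _) (fun i => h2 i v w) u

/-- Koszul's formula. On coordinate vectors it is the definition of the Christoffel symbols with the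
index lowered, and both sides are trilinear. Metric compatibility and vanishing torsion both follow
from it. -/
theorem formCoord_connCoeff_leviCivita (g : PseudoRiemannianMetric n M) (x : M)
    (w a e : EuclideanSpace ℝ (Fin n)) :
    formCoord g x x (connCoeff (leviCivita g) x x w a) e
      = (1 / 2) * (formDeriv g x a w e + formDeriv g x w a e - formDeriv g x e a w) := by
  rw [← sub_eq_zero]
  refine euclidean_trilinear_ext (T := fun w a e =>
    formCoord g x x (connCoeff (leviCivita g) x x w a) e
      - (1 / 2) * (formDeriv g x a w e + formDeriv g x w a e - formDeriv g x e a w))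
    ?_ ?_ ?_ ?_ ?_ ?_ (fun j i l => ?_) w a e
  · intros
    simp only [formDeriv_add_left, formDeriv_add_middle, formDeriv_add_right, map_add, add_apply]
    ring
  · intros
    simp only [formDeriv_smul_left, formDeriv_smul_middle, formDeriv_smul_right, map_smul,
      smul_apply, smul_eq_mul]
    ring
  · intros
    simp only [formDeriv_add_left, formDeriv_add_middle, map_add, add_apply]
    ring
  · intros
    simp only [formDeriv_smul_left, formDeriv_smul_middle, map_smul, smul_apply,
      smul_eq_mul]
    ring
  · intros
    simp only [formDeriv_add_left, formDeriv_add_right, map_add]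
    ring
  · intros
    simp only [formDeriv_smul_left, formDeriv_smul_right, map_smul, smul_eq_mul]
    ring
  · rw [connCoeff_self, leviCivita_extendVec, ← coordVec_eq_fromCoord, ← coordVec_eq_fromCoord,
      bilinOfCoeff_coordVec, sub_eq_zero]
    simp only [map_sum, map_smul, sum_apply, smul_apply, toCoord_coordVec, smul_eq_mul,
      ← lower_eq_formCoord, sum_christoffel_mul_lower, pderiv_gram]

theorem isMetricConnection_leviCivita (g : PseudoRiemannianMetric n M) :
    IsMetricConnection (leviCivita g) g := by
  intro x a v w
  rw [formCoord_symm g x x v, formCoord_connCoeff_leviCivita, formCoord_connCoeff_leviCivita]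
  change formDeriv g x a v w = _
  rw [formDeriv_symm g x a w v]
  ring

theorem torsion_leviCivita (g : PseudoRiemannianMetric n M) : (leviCivita g).torsion = 0 := by
  funext x
  refine torsion_eq_zero_at fun u v => ?_
  have h : ∀ w a, connCoeff (leviCivita g) x x w a = connCoeff (leviCivita g) x x a w := by
    intro w a
    rw [← sub_eq_zero]
    refine formCoord_nondegenerate g (mem_source_self x) _ fun e => ?_
    rw [map_sub, sub_apply, formCoord_connCoeff_leviCivita, formCoord_connCoeff_leviCivita,
      formDeriv_symm g x e a w]
    ring
  have h2 := h (toCoord x x v) (toCoord x x u)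
  rw [connCoeff_self, connCoeff_self, fromCoord_toCoord_self, fromCoord_toCoord_self] at h2
  exact toCoord_injective (mem_source_self x) h2

end LeviCivitaProperties

/-! ### The para-complex structure is parallel -/

section Parallel

variable {n d : ℕ} {M : Type*} [TopologicalSpace M] [ChartedSpace (EuclideanSpace ℝ (Fin n)) M]
  [IsManifold (𝓡 n) ∞ M]
  {N : Type*} [TopologicalSpace N] [ChartedSpace (EuclideanSpace ℝ (Fin d)) N]
  [IsManifold (𝓡 d) ∞ N]

/-- Serves to rewrite the Nijenhuis tensor in terms of the covariant derivative of A. -/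
theorem mlieBracket_eq_of_torsion {D : AffineConnection d N} (hD : D.torsion = 0) {p : N}
    {X Y : Π q : N, Tan d q} (hX : VDiffAt X p) (hY : VDiffAt Y p) :
    VectorField.mlieBracket (𝓡 d) X Y p = D Y p (X p) - D X p (Y p) := by
  have h1 := D.torsion_apply hX hY
  rw [hD] at h1
  have h2 : (0 : Tan d p) = D Y p (X p) - D X p (Y p) - VectorField.mlieBracket (𝓡 d) X Y p := h1
  exact (sub_eq_zero.1 h2.symm).symm

/-- The components at `q` of an endomorphism field in the preferred chart around `p`. -/
def endoCoord (A : Π p : N, Tan d p →L[ℝ] Tan d p) (p q : N) :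
    EuclideanSpace ℝ (Fin d) →L[ℝ] EuclideanSpace ℝ (Fin d) :=
  (toCoord p q).comp ((A q).comp (fromCoord p q))

theorem endoCoord_toCoord (A : Π p : N, Tan d p →L[ℝ] Tan d p) {p q : N}
    (hq : q ∈ (chartAt (EuclideanSpace ℝ (Fin d)) p).source) (v : Tan d q) :
    endoCoord A p q (toCoord p q v) = toCoord p q (A q v) := by
  simp only [endoCoord, ContinuousLinearMap.comp_apply, fromCoord_toCoord hq]

theorem toCoord_endo_fromCoord (A : Π p : N, Tan d p →L[ℝ] Tan d p) (p q : N)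
    (v : EuclideanSpace ℝ (Fin d)) :
    toCoord p q (A q (fromCoord p q v)) = endoCoord A p q v := rfl

/-- Smoothness of an endomorphism field, at the centres of the charts. -/
def IsSmoothEndo (A : Π p : N, Tan d p →L[ℝ] Tan d p) : Prop :=
  ∀ p : N, ContMDiffAt (𝓡 d) 𝓘(ℝ, EuclideanSpace ℝ (Fin d) →L[ℝ] EuclideanSpace ℝ (Fin d)) ∞
    (endoCoord A p) p

theorem ParaKahlerStructure.isSmoothEndo (K : ParaKahlerStructure d N) : IsSmoothEndo K.A := by
  intro p
  have h := K.smooth_A p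
  rw [contMDiffAt_hom_bundle] at h
  exact h.2

/-- The components of the derivative of an endomorphism field. -/
def endoDeriv (D : AffineConnection d N) (A : Π p : N, Tan d p →L[ℝ] Tan d p) (p : N)
    (a w : EuclideanSpace ℝ (Fin d)) : EuclideanSpace ℝ (Fin d) :=
  mvfderiv (𝓡 d) (endoCoord A p) p (fromCoord p p a) w
    + connCoeff D p p (endoCoord A p p w) a - endoCoord A p p (connCoeff D p p w a)

/-- An endomorphism field is parallel. -/
def IsParallelEndo (D : AffineConnection d N) (A : Π p : N, Tan d p →L[ℝ] Tan d p) : Prop :=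
  ∀ (p : N) (a w : EuclideanSpace ℝ (Fin d)), endoDeriv D A p a w = 0

variable {A : Π p : N, Tan d p →L[ℝ] Tan d p}

theorem IsSmoothEndo.mdifferentiableAt (hA : IsSmoothEndo A) (p : N) :
    MDifferentiableAt (𝓡 d) 𝓘(ℝ, EuclideanSpace ℝ (Fin d) →L[ℝ] EuclideanSpace ℝ (Fin d))
      (endoCoord A p) p := (hA p).mdifferentiableAt (by simp)

theorem IsSmoothEndo.vDiffAlongAt (hA : IsSmoothEndo A) {f : M → N} {s : Π x : M, Tan d (f x)}
    {y : M} (hf : MDifferentiableAt (𝓡 n) (𝓡 d) f y) (hs : VDiffAlongAt n f s y) :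
    VDiffAlongAt n f (fun z => A (f z) (s z)) y := by
  have hfy := mem_source_self (n := d) (f y)
  rw [vDiffAlongAt_iff hfy hf] at hs ⊢
  have h := ((hA.mdifferentiableAt (f y)).comp y hf).clm_apply hs
  refine h.congr_of_eventuallyEq ?_
  filter_upwards [hf.continuousAt.eventually (eventually_mem_source hfy)] with z hz
  exact (endoCoord_toCoord A hz _).symm

theorem IsSmoothEndo.smoothAlongAt (hA : IsSmoothEndo A) {f : M → N} {s : Π x : M, Tan d (f x)}
    {y : M} (hf : ContMDiffAt (𝓡 n) (𝓡 d) ∞ f y) (hs : SmoothAlongAt n f s y) :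
    SmoothAlongAt n f (fun z => A (f z) (s z)) y := by
  have hfy := mem_source_self (n := d) (f y)
  have h := ((hA (f y)).comp y hf).clm_apply hs
  refine h.congr_of_eventuallyEq ?_
  filter_upwards [hf.continuousAt.eventually (eventually_mem_source hfy)] with z hz
  exact (endoCoord_toCoord A hz _).symm

/-- The Leibniz rule for A s before parallelism is known. It is needed in this generality in order
to express the Nijenhuis tensor through ∇A. -/
theorem toCoord_alongDeriv_endo (D : AffineConnection d N) (hA : IsSmoothEndo A) {f : M → N}
    {s : Π x : M, Tan d (f x)} {y : M} (hf : MDifferentiableAt (𝓡 n) (𝓡 d) f y)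
    (hs : VDiffAlongAt n f s y) (v : Tan n y) :
    toCoord (f y) (f y) (alongDeriv n D f (fun z => A (f z) (s z)) y v)
      = endoCoord A (f y) (f y) (toCoord (f y) (f y) (alongDeriv n D f s y v))
        + endoDeriv D A (f y) (toCoord (f y) (f y) (mfderiv (𝓡 n) (𝓡 d) f y v))
          (toCoord (f y) (f y) (s y)) := by
  have hfy := mem_source_self (n := d) (f y)
  have hS := (vDiffAlongAt_iff hfy hf).1 hs
  have hA0 := hA.mdifferentiableAt (f y)
  have hAf : MDifferentiableAt (𝓡 n) 𝓘(ℝ, EuclideanSpace ℝ (Fin d) →L[ℝ] EuclideanSpace ℝ (Fin d))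
      (fun z => endoCoord A (f y) (f z)) y := hA0.comp y hf
  have hdA : mvfderiv (𝓡 n) (fun z => endoCoord A (f y) (f z)) y v
      = mvfderiv (𝓡 d) (endoCoord A (f y)) (f y) (mfderiv (𝓡 n) (𝓡 d) f y v) :=
    mfderiv_comp_apply (I := 𝓡 n) (I' := 𝓡 d) (g := endoCoord A (f y)) y hA0 hf v
  have hev : (fun z => toCoord (f y) (f z) (A (f z) (s z))) =ᶠ[nhds y] fun z =>
      endoCoord A (f y) (f z) (toCoord (f y) (f z) (s z)) := by
    filter_upwards [hf.continuousAt.eventually (eventually_mem_source hfy)] with z hz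
    exact (endoCoord_toCoord A hz _).symm
  rw [toCoord_alongDeriv_self D hf (hA.vDiffAlongAt hf hs), toCoord_alongDeriv_self D hf hs,
    mvfderiv_congr hev, mvfderiv_clm_apply hAf hS, hdA, endoDeriv, fromCoord_toCoord_self,
    ← endoCoord_toCoord A hfy, map_add]
  abel

theorem alongDeriv_endo {D : AffineConnection d N} (hA : IsSmoothEndo A) (hP : IsParallelEndo D A)
    {f : M → N} {s : Π x : M, Tan d (f x)} {y : M} (hf : MDifferentiableAt (𝓡 n) (𝓡 d) f y)
    (hs : VDiffAlongAt n f s y) (v : Tan n y) :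
    alongDeriv n D f (fun z => A (f z) (s z)) y v = A (f y) (alongDeriv n D f s y v) := by
  have hfy := mem_source_self (n := d) (f y)
  refine toCoord_injective hfy ?_
  rw [toCoord_alongDeriv_endo D hA hf hs, hP, add_zero, endoCoord_toCoord A hfy]

theorem IsSmoothEndo.vDiffAt (hA : IsSmoothEndo A) {Y : Π q : N, Tan d q} {p : N}
    (hY : VDiffAt Y p) : VDiffAt (fun q => A q (Y q)) p :=
  hA.vDiffAlongAt (f := fun q : N => q) (s := Y) mdifferentiableAt_id hY

theorem toCoord_connection_endo (D : AffineConnection d N) (hA : IsSmoothEndo A)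
    {Y : Π q : N, Tan d q} {p : N} (hY : VDiffAt Y p) (v : Tan d p) :
    toCoord p p (D (fun q => A q (Y q)) p v)
      = endoCoord A p p (toCoord p p (D Y p v))
        + endoDeriv D A p (toCoord p p v) (toCoord p p (Y p)) := by
  have h := toCoord_alongDeriv_endo D hA (f := fun q : N => q) (s := Y) mdifferentiableAt_id hY v
  rw [alongDeriv_id D hY, alongDeriv_id D (hA.vDiffAt hY)] at h
  refine h.trans ?_
  congr 3
  exact congrArg (fun L => L v) (mfderiv_id (I := 𝓡 d) (x := p))

/-- Since g is parallel, a coordinate derivative of g(A·, ·) is its covariant derivative, which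
involves only ∇A, plus two connection terms that cancel in the exterior derivative. -/
theorem mvfderiv_formCoord_endo {D : AffineConnection d N} {g : PseudoRiemannianMetric d N}
    (hg : IsMetricConnection D g) (hA : IsSmoothEndo A) (p : N)
    (a w z : EuclideanSpace ℝ (Fin d)) :
    mvfderiv (𝓡 d) (fun q => formCoord g p q (endoCoord A p q w) z) p (fromCoord p p a)
      = formCoord g p p (endoDeriv D A p a w) z
        + formCoord g p p (endoCoord A p p (connCoeff D p p w a)) z
        + formCoord g p p (endoCoord A p p w) (connCoeff D p p z a) := by
  have hG := mdifferentiableAt_formCoord g (mem_source_self p)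
  have hAw : MDifferentiableAt (𝓡 d) 𝓘(ℝ, EuclideanSpace ℝ (Fin d)) (fun q => endoCoord A p q w) p :=
    (hA.mdifferentiableAt p).clm_apply mdifferentiableAt_const
  rw [mvfderiv_clm_const (hG.clm_apply hAw), mvfderiv_clm_apply hG hAw,
    mvfderiv_clm_const (hA.mdifferentiableAt p), add_apply, hg, endoDeriv]
  simp only [map_add, map_sub, add_apply, sub_apply]
  ring

end Parallel

/-! ### Closedness and integrability force the para-complex structure to be parallel -/

section ParallelParaKahler

variable {d : ℕ} {N : Type*} [TopologicalSpace N] [ChartedSpace (EuclideanSpace ℝ (Fin d)) N]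
  [IsManifold (𝓡 d) ∞ N]

theorem ParaKahlerStructure.formCoord_endo_skew (K : ParaKahlerStructure d N) {p q : N}
    (hq : q ∈ (chartAt (EuclideanSpace ℝ (Fin d)) p).source) (v w : EuclideanSpace ℝ (Fin d)) :
    formCoord K.G p q (endoCoord K.A p q v) w = -formCoord K.G p q (endoCoord K.A p q w) v := by
  have h := K.skew q (fromCoord p q v) (fromCoord p q w)
  rw [formCoord_apply, formCoord_apply, endoCoord, ContinuousLinearMap.comp_apply,
    ContinuousLinearMap.comp_apply, ContinuousLinearMap.comp_apply,
    ContinuousLinearMap.comp_apply, fromCoord_toCoord hq, fromCoord_toCoord hq, h]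

theorem ParaKahlerStructure.endoCoord_endoCoord (K : ParaKahlerStructure d N) {p q : N}
    (hq : q ∈ (chartAt (EuclideanSpace ℝ (Fin d)) p).source) (v : EuclideanSpace ℝ (Fin d)) :
    endoCoord K.A p q (endoCoord K.A p q v) = v := by
  simp only [endoCoord, ContinuousLinearMap.comp_apply]
  rw [fromCoord_toCoord hq, K.A_A, toCoord_fromCoord hq]

/-- Linear algebra behind the parallelism of the para-complex structure. -/
theorem trilinear_eq_zero {E : Type*} {P : E → E → E → ℝ} {A : E → E} (hA : ∀ v, A (A v) = v)
    (hskew : ∀ a w z, P a w z = -P a z w)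
    (hcyc : ∀ u v w, P u v w - P v u w + P w u v = 0)
    (hcomm : ∀ a w z, P a (A w) z = P a w (A z))
    (hN : ∀ u v z, P (A u) v z - P (A v) u z - P v (A u) z + P u (A v) z = 0) (a w z : E) :
    P a w z = 0 := by
  have key : ∀ z v u, P z v (A u) = 0 := by
    -- The Nijenhuis identity plus the cyclic identity at (v, A u, z) minus the one at (u, A v, z)
    -- gives P z v (A u) = P z u (A v). Moving A across and using skewness, the right side is -P z v
    -- (A u), so both vanish.
    intro z v u
    have h1 := hN u v z
    have h2 := hcyc v (A u) z
    have h3 := hcyc u (A v) z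
    have h4 := hcomm z u v
    have h5 := hskew (A u) v z
    have h6 := hskew (A v) u z
    have h7 := hskew z (A u) v
    linarith
  -- An involution is onto, so the last argument may be taken of the form A u.
  rw [← hA z]
  exact key a w (A z)

/-- With P(a, w, z) = G((∇_a A) w, z), differentiating the skewness of Ω and A² = 1, together with
dΩ = 0 and the vanishing Nijenhuis tensor, supplies the hypotheses of `trilinear_eq_zero`.
Nondegeneracy of G then gives ∇A = 0. -/
theorem ParaKahlerStructure.isParallelEndo (K : ParaKahlerStructure d N) :
    IsParallelEndo K.connection K.A := by
  intro p
  have hp := mem_source_self (n := d) p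
  have hA := K.isSmoothEndo
  have hg : IsMetricConnection K.connection K.G := isMetricConnection_leviCivita K.G
  have ht : K.connection.torsion = 0 := torsion_leviCivita K.G
  set D := K.connection with hD
  set A₀ := endoCoord K.A p p with hA₀
  have hAA : ∀ v, A₀ (A₀ v) = v := K.endoCoord_endoCoord hp
  have hsk : ∀ v w, formCoord K.G p p (A₀ v) w = -formCoord K.G p p (A₀ w) v :=
    K.formCoord_endo_skew hp
  set P : EuclideanSpace ℝ (Fin d) → EuclideanSpace ℝ (Fin d) → EuclideanSpace ℝ (Fin d) → ℝ :=
    fun a w z => formCoord K.G p p (endoDeriv D K.A p a w) z with hP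
  have hω := fun a w z => mvfderiv_formCoord_endo hg hA p a w z
  have hskew : ∀ a w z, P a w z = -P a z w := by
    intro a w z
    have hev : (fun q => formCoord K.G p q (endoCoord K.A p q w) z) =ᶠ[nhds p]
        -(fun q => formCoord K.G p q (endoCoord K.A p q z) w) := by
      filter_upwards [eventually_mem_source hp] with q hq
      exact K.formCoord_endo_skew hq w z
    have h1 := hω a w z
    rw [mvfderiv_congr hev, mvfderiv_neg] at h1
    have h2 := hω a z w
    rw [neg_apply, h2] at h1
    have h3 := hsk (connCoeff D p p w a) z
    have h4 := hsk (connCoeff D p p z a) w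
    simp only [hP]
    linarith
  have hcyc : ∀ u v w, P u v w - P v u w + P w u v = 0 := by
    intro u v w
    have h := K.closed p (coordField p u) (coordField p v) (coordField p w)
      (vDiffAt_coordField hp u) (vDiffAt_coordField hp v) (vDiffAt_coordField hp w)
    have hev : ∀ v w, (fun q => K.G.inner q (K.A q (coordField p v q)) (coordField p w q))
        =ᶠ[nhds p] fun q => formCoord K.G p q (endoCoord K.A p q v) w := by
      intro v w
      filter_upwards [eventually_mem_source hp] with q hq
      rw [formCoord_apply, ← toCoord_endo_fromCoord, fromCoord_toCoord hq]
      rfl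
    have hc : ∀ u : EuclideanSpace ℝ (Fin d), coordField p u p = fromCoord p p u := fun u => rfl
    simp only [mlieBracket_coordField hp, map_zero, zero_apply, mvfderiv_congr (hev _ _), hc,
      sub_zero, add_zero] at h
    rw [hω, hω, hω] at h
    -- Each connection term of dΩ occurs twice with its lower slots exchanged. Symmetry of the
    -- coefficients together with skewness of Ω cancels them in pairs.
    have c1 := connCoeff_comm ht hp u v
    have c2 := connCoeff_comm ht hp u w
    have c3 := connCoeff_comm ht hp v w
    rw [c1, c2, c3] at h
    have h3 := hsk (connCoeff D p p w u) v
    have h4 := hsk (connCoeff D p p w v) u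
    have h5 := hsk (connCoeff D p p v u) w
    simp only [hP]
    linarith
  -- This is the derivative of A² = 1: the covariant derivative of A anticommutes with A.
  have hcm : ∀ a w, endoDeriv D K.A p a (A₀ w) = -A₀ (endoDeriv D K.A p a w) := by
    intro a w
    have hev : (fun q => endoCoord K.A p q (endoCoord K.A p q w)) =ᶠ[nhds p] fun _ => w := by
      filter_upwards [eventually_mem_source hp] with q hq
      exact K.endoCoord_endoCoord hq w
    have h1 := mvfderiv_clm_apply (hA.mdifferentiableAt p)
      ((hA.mdifferentiableAt p).clm_apply (mdifferentiableAt_const (c := w))) (fromCoord p p a)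
    rw [mvfderiv_congr hev, mvfderiv_const, mvfderiv_clm_const (hA.mdifferentiableAt p)] at h1
    have h2 : (0 : EuclideanSpace ℝ (Fin d)) = _ := h1
    simp only [endoDeriv, map_add, map_sub, ← hA₀, hAA] at h2 ⊢
    rw [eq_neg_iff_add_eq_zero, h2]
    abel
  have hcomm : ∀ a w z, P a (A₀ w) z = P a w (A₀ z) := by
    intro a w z
    simp only [hP]
    rw [hcm, map_neg, neg_apply, hsk, neg_neg, formCoord_symm]
  have hN : ∀ u v z, P (A₀ u) v z - P (A₀ v) u z - P v (A₀ u) z + P u (A₀ v) z = 0 := by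
    intro u v z
    have hU : ∀ u, VDiffAt (coordField p u) p := fun u => vDiffAt_coordField hp u
    have h := K.nijenhuis p (coordField p u) (coordField p v) (hU u) (hU v)
    rw [mlieBracket_coordField hp, mlieBracket_eq_of_torsion ht (hA.vDiffAt (hU u))
      (hA.vDiffAt (hU v)), mlieBracket_eq_of_torsion ht (hA.vDiffAt (hU u)) (hU v),
      mlieBracket_eq_of_torsion ht (hU u) (hA.vDiffAt (hU v))] at h
    have h1 := congrArg (toCoord p p) h
    have hc : ∀ u : EuclideanSpace ℝ (Fin d), coordField p u p = fromCoord p p u := fun u => rfl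
    have hd : ∀ w (v : Tan d p), toCoord p p (D (coordField p w) p v)
        = connCoeff D p p w (toCoord p p v) := by
      intro w v
      rw [connCoeff_apply D hp, fromCoord_toCoord hp]
    simp only [map_add, map_sub, map_zero, add_zero, ← endoCoord_toCoord K.A hp,
      toCoord_connection_endo D hA (hU _), hd, hc, toCoord_fromCoord hp, ← hA₀, hAA] at h1
    rw [connCoeff_comm ht hp u v] at h1
    have h2 := congrArg (fun e => formCoord K.G p p e z) h1
    simp only [hP]
    rw [hcm, hcm]
    simp only [map_add, map_sub, map_zero, map_neg, add_apply, sub_apply, neg_apply,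
      zero_apply] at h2 ⊢
    linarith
  intro a w
  refine formCoord_nondegenerate K.G hp _ fun z => ?_
  exact trilinear_eq_zero hAA hskew hcyc hcomm hN a w z

end ParallelParaKahler

/-! ### The Gauss equations of Lagrangian immersions -/

section Gauss

variable {n d : ℕ} {M : Type*} [TopologicalSpace M] [ChartedSpace (EuclideanSpace ℝ (Fin n)) M]
  [IsManifold (𝓡 n) ∞ M]
  {N : Type*} [TopologicalSpace N] [ChartedSpace (EuclideanSpace ℝ (Fin d)) N]
  [IsManifold (𝓡 d) ∞ N]

theorem toCoord_mfderiv {f : M → N} {x y : M} {p : N}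
    (hy : y ∈ (chartAt (EuclideanSpace ℝ (Fin n)) x).source)
    (hfy : f y ∈ (chartAt (EuclideanSpace ℝ (Fin d)) p).source)
    (hf : MDifferentiableAt (𝓡 n) (𝓡 d) f y) (e : EuclideanSpace ℝ (Fin n)) :
    toCoord p (f y) (mfderiv (𝓡 n) (𝓡 d) f y (fromCoord x y e))
      = fderiv ℝ (inChart x fun z => extChartAt (𝓡 d) p (f z)) (extChartAt (𝓡 n) x y) e := by
  have hφ : MDifferentiableAt (𝓡 d) 𝓘(ℝ, EuclideanSpace ℝ (Fin d)) (extChartAt (𝓡 d) p) (f y) :=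
    (contMDiffAt_extChartAt' (n := ∞) hfy).mdifferentiableAt (by simp)
  rw [← mvfderiv_fromCoord hy (g := fun z => extChartAt (𝓡 d) p (f z))
    (MDifferentiableAt.comp y hφ hf)]
  refine Eq.trans ?_ (mfderiv_comp_apply (I := 𝓡 n) (I' := 𝓡 d)
    (I'' := 𝓘(ℝ, EuclideanSpace ℝ (Fin d))) (g := extChartAt (𝓡 d) p) y hφ hf
    (fromCoord x y e)).symm
  exact (mvfderiv_extChartAt hfy _).symm

theorem toCoord_push_eventuallyEq {f : M → N} (hf : ContMDiff (𝓡 n) (𝓡 d) ∞ f) {x y : M}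
    (hy : y ∈ (chartAt (EuclideanSpace ℝ (Fin n)) x).source) (e : EuclideanSpace ℝ (Fin n)) :
    (fun z => toCoord (f y) (f z) (pushAlong n d f (coordField x e) z)) =ᶠ[nhds y] fun z =>
      fderiv ℝ (inChart x fun z => extChartAt (𝓡 d) (f y) (f z)) (extChartAt (𝓡 n) x z) e := by
  filter_upwards [eventually_mem_source hy, hf.continuous.continuousAt.eventually
    (eventually_mem_source (mem_source_self (n := d) (f y)))] with z hz hfz
  exact toCoord_mfderiv hz hfz ((hf z).mdifferentiableAt (by simp)) e

theorem contMDiffAt_extChartAt_comp {f : M → N} (hf : ContMDiff (𝓡 n) (𝓡 d) ∞ f) (y : M) :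
    ContMDiffAt (𝓡 n) 𝓘(ℝ, EuclideanSpace ℝ (Fin d)) ∞ (fun z => extChartAt (𝓡 d) (f y) (f z)) y :=
  (contMDiffAt_extChartAt' (mem_source_self (n := d) (f y))).comp y (hf y)

theorem smoothAlongAt_push {f : M → N} (hf : ContMDiff (𝓡 n) (𝓡 d) ∞ f) {x y : M}
    (hy : y ∈ (chartAt (EuclideanSpace ℝ (Fin n)) x).source) (e : EuclideanSpace ℝ (Fin n)) :
    SmoothAlongAt n f (pushAlong n d f (coordField x e)) y :=
  (contMDiffAt_fderiv_inChart hy (contMDiffAt_extChartAt_comp hf y) e).congr_of_eventuallyEq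
    (toCoord_push_eventuallyEq hf hy e)

theorem eventually_smoothAlongAt_push {f : M → N} (hf : ContMDiff (𝓡 n) (𝓡 d) ∞ f) {x y : M}
    (hy : y ∈ (chartAt (EuclideanSpace ℝ (Fin n)) x).source) (e : EuclideanSpace ℝ (Fin n)) :
    ∀ᶠ z in nhds y, SmoothAlongAt n f (pushAlong n d f (coordField x e)) z := by
  filter_upwards [eventually_mem_source hy] with z hz
  exact smoothAlongAt_push hf hz e

/-- The second derivative of a map is symmetric. -/
theorem alongDeriv_push_comm {D : AffineConnection d N} (hD : D.torsion = 0) {f : M → N}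
    (hf : ContMDiff (𝓡 n) (𝓡 d) ∞ f) {x y : M}
    (hy : y ∈ (chartAt (EuclideanSpace ℝ (Fin n)) x).source) (u v : EuclideanSpace ℝ (Fin n)) :
    alongDeriv n D f (pushAlong n d f (coordField x v)) y (fromCoord x y u)
      = alongDeriv n D f (pushAlong n d f (coordField x u)) y (fromCoord x y v) := by
  have hfy := mem_source_self (n := d) (f y)
  have hfd := (hf y).mdifferentiableAt (by simp)
  have key : ∀ u v : EuclideanSpace ℝ (Fin n), toCoord (f y) (f y)
      (alongDeriv n D f (pushAlong n d f (coordField x v)) y (fromCoord x y u))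
      = fderiv ℝ (fderiv ℝ (inChart x fun z => extChartAt (𝓡 d) (f y) (f z)))
          (extChartAt (𝓡 n) x y) u v
        + connCoeff D (f y) (f y)
          (fderiv ℝ (inChart x fun z => extChartAt (𝓡 d) (f y) (f z)) (extChartAt (𝓡 n) x y) v)
          (fderiv ℝ (inChart x fun z => extChartAt (𝓡 d) (f y) (f z))
            (extChartAt (𝓡 n) x y) u) := by
    intro u v
    rw [toCoord_alongDeriv_fromCoord D hy hfy hfd
      ((smoothAlongAt_push hf hy v).vDiffAlongAt (hf y))]
    have hev := toCoord_push_eventuallyEq hf hy v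
    have h1 := inChart_congr hy hev
    rw [h1.fderiv_eq]
    have h2 : (inChart x fun z => fderiv ℝ (inChart x fun z => extChartAt (𝓡 d) (f y) (f z))
        (extChartAt (𝓡 n) x z) v) =ᶠ[nhds (extChartAt (𝓡 n) x y)]
        fun r => fderiv ℝ (inChart x fun z => extChartAt (𝓡 d) (f y) (f z)) r v := by
      filter_upwards [extChartAt_target_mem_nhds_of_mem hy] with r hr
      simp only [inChart, (extChartAt (𝓡 n) x).right_inv hr]
    have a1 := ((contDiffAt_inChart le_rfl hy (contMDiffAt_extChartAt_comp hf y)).fderiv_right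
      (m := ∞) (by simp)).differentiableAt (by simp)
    rw [h2.fderiv_eq, fderiv_clm_apply a1 (differentiableAt_const v),
      show toCoord (f y) (f y) (pushAlong n d f (coordField x v) y) = _ from hev.self_of_nhds]
    simp
  refine toCoord_injective hfy ?_
  rw [key, key, connCoeff_comm hD hfy,
    fderiv_fderiv_comm (contDiffAt_inChart le_rfl hy (contMDiffAt_extChartAt_comp hf y))]

theorem contMDiffAt_inner_along (g : PseudoRiemannianMetric d N) {f : M → N}
    {s s' : Π x : M, Tan d (f x)} {y : M} (hf : ContMDiffAt (𝓡 n) (𝓡 d) ∞ f y)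
    (hs : SmoothAlongAt n f s y) (hs' : SmoothAlongAt n f s' y) :
    ContMDiffAt (𝓡 n) 𝓘(ℝ, ℝ) ∞ (fun z => g.inner (f z) (s z) (s' z)) y := by
  have hfy := mem_source_self (n := d) (f y)
  have h : ContMDiffAt (𝓡 n) 𝓘(ℝ, EuclideanSpace ℝ (Fin d) →L[ℝ] EuclideanSpace ℝ (Fin d) →L[ℝ] ℝ)
      ∞ (fun z => formCoord g (f y) (f z)) y := (contMDiffAt_formCoord g hfy).comp y hf
  refine ((h.clm_apply hs).clm_apply hs').congr_of_eventuallyEq ?_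
  filter_upwards [hf.continuousAt.eventually (eventually_mem_source hfy)] with z hz
  exact (formCoord_toCoord g hz _ _).symm

/-- A metric with compatible torsion-free connection and parallel para-complex structure, of
constant para-holomorphic sectional curvature `4c`. -/
structure IsParaComplexSpaceForm (g : PseudoRiemannianMetric d N) (D : AffineConnection d N)
    (A : Π p : N, Tan d p →L[ℝ] Tan d p) (c : ℝ) : Prop where
  metric : IsMetricConnection D g
  torsion : D.torsion = 0
  smooth : IsSmoothEndo A
  parallel : IsParallelEndo D A
  sq : ∀ p v, A p (A p v) = v
  skew : ∀ p v w, g.inner p (A p v) w = -g.inner p (A p w) v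
  curv : ∀ (p : N) (u v w : Tan d p), curvature D p u v w = c •
      (g.inner p v w • u - g.inner p u w • v
        - g.inner p (A p v) w • A p u + g.inner p (A p u) w • A p v
        + (2 * g.inner p (A p u) v) • A p w)

/-- `f` is an isometric Lagrangian immersion. -/
structure IsLagrangian (g : PseudoRiemannianMetric d N) (A : Π p : N, Tan d p →L[ℝ] Tan d p)
    (f : M → N) (h : PseudoRiemannianMetric n M) : Prop where
  smooth : ContMDiff (𝓡 n) (𝓡 d) ∞ f
  isometric : ∀ x v w, h.inner x v w
    = g.inner (f x) (mfderiv (𝓡 n) (𝓡 d) f x v) (mfderiv (𝓡 n) (𝓡 d) f x w)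
  isotropic : ∀ x v w,
    g.inner (f x) (A (f x) (mfderiv (𝓡 n) (𝓡 d) f x v)) (mfderiv (𝓡 n) (𝓡 d) f x w) = 0
  spanning : ∀ (x : M) (p : Tan d (f x)),
    (∀ z, g.inner (f x) p (mfderiv (𝓡 n) (𝓡 d) f x z) = 0) →
    (∀ z, g.inner (f x) p (A (f x) (mfderiv (𝓡 n) (𝓡 d) f x z)) = 0) → p = 0

/-- `∇` is the projection of the ambient connection along the `-1` eigenbundle of `A`. -/
def IsProjected (g : PseudoRiemannianMetric d N) (D : AffineConnection d N)
    (A : Π p : N, Tan d p →L[ℝ] Tan d p) (f : M → N) (h : PseudoRiemannianMetric n M)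
    (D' : AffineConnection n M) : Prop :=
  ∀ (x : M) (Y : Π y : M, Tan n y), VDiffAt Y x → ∀ u z : Tan n x,
    h.inner x (D' Y x u) z
      = g.inner (f x) (alongDeriv n D f (pushAlong n d f Y) x u) (mfderiv (𝓡 n) (𝓡 d) f x z)
        + g.inner (f x) (A (f x) (alongDeriv n D f (pushAlong n d f Y) x u))
          (mfderiv (𝓡 n) (𝓡 d) f x z)

variable {g : PseudoRiemannianMetric d N} {D : AffineConnection d N}
  {A : Π p : N, Tan d p →L[ℝ] Tan d p} {c : ℝ} {f : M → N} {h : PseudoRiemannianMetric n M}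
  {D' : AffineConnection n M}

theorem IsParaComplexSpaceForm.hasSmoothCoeffAt (hK : IsParaComplexSpaceForm g D A c) (p : N) :
    HasSmoothCoeffAt D p := (hasSmoothCoeff_of_metric hK.metric hK.torsion).hasSmoothCoeffAt p

theorem pushAlong_extendVec_eventuallyEq (f : M → N) {x : M} (v : Tan n x) :
    ∀ᶠ y in nhds x, pushAlong n d f (extendVec v) y
      = pushAlong n d f (coordField x (toCoord x x v)) y := by
  filter_upwards [extendVec_eventuallyEq (mem_source_self x) v] with y hy
  unfold pushAlong
  rw [hy]

theorem alongDeriv_push_extendVec (D : AffineConnection d N) (hf : ContMDiff (𝓡 n) (𝓡 d) ∞ f)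
    {x : M} (v : Tan n x) :
    alongDeriv n D f (pushAlong n d f (extendVec v)) x
      = alongDeriv n D f (pushAlong n d f (coordField x (toCoord x x v))) x :=
  alongDeriv_congr D hf.continuous.continuousAt (pushAlong_extendVec_eventuallyEq f v)

theorem alongDeriv_push_extendVec_comm (hD : D.torsion = 0) (hf : ContMDiff (𝓡 n) (𝓡 d) ∞ f)
    {x : M} (u v : Tan n x) :
    alongDeriv n D f (pushAlong n d f (extendVec v)) x u
      = alongDeriv n D f (pushAlong n d f (extendVec u)) x v := by
  rw [alongDeriv_push_extendVec D hf, alongDeriv_push_extendVec D hf]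
  have := alongDeriv_push_comm hD hf (mem_source_self x) (toCoord x x u) (toCoord x x v)
  rwa [fromCoord_toCoord_self, fromCoord_toCoord_self] at this

/-- The defining formula writes h(∇_a w, e) through derivatives along f, which are smooth; raising
the index with h preserves smoothness. -/
theorem IsProjected.hasSmoothCoeff (hK : IsParaComplexSpaceForm g D A c)
    (hL : IsLagrangian g A f h) (hP : IsProjected g D A f h D') : HasSmoothCoeff D' := by
  refine hasSmoothCoeff_of_apply fun x y hy w a => ?_
  refine contMDiffAt_of_form (contMDiffAt_formCoord h hy) (formCoord_nondegenerate h hy) fun e => ?_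
  have hW : SmoothAlongAt n f (fun z => alongDeriv n D f (pushAlong n d f (coordField x w)) z
      (fromCoord x z a)) y :=
    SmoothAlongAt.alongDeriv hL.smooth (hK.hasSmoothCoeffAt _) hy
      (eventually_smoothAlongAt_push hL.smooth hy w) a
  have hE := smoothAlongAt_push hL.smooth hy e
  have h1 := (contMDiffAt_inner_along g (hL.smooth y) hW hE).add
    (contMDiffAt_inner_along g (hL.smooth y) (hK.smooth.smoothAlongAt (hL.smooth y) hW) hE)
  refine h1.congr_of_eventuallyEq ?_
  filter_upwards [eventually_mem_source hy] with z hz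
  rw [formCoord_apply, fromCoord_toCoord hz]
  exact hP z _ (vDiffAt_coordField hz w) _ _

/-- The second derivative of f with respect to a torsion-free connection is symmetric, and the
induced connection depends on it alone. -/
theorem IsProjected.torsion (hK : IsParaComplexSpaceForm g D A c)
    (hL : IsLagrangian g A f h) (hP : IsProjected g D A f h D') : D'.torsion = 0 := by
  funext x
  refine torsion_eq_zero_at fun u v => ?_
  rw [← sub_eq_zero]
  refine h.nondegenerate x _ fun z => ?_
  rw [map_sub, sub_apply, hP x _ (vDiffAt_extendVec v), hP x _ (vDiffAt_extendVec u),
    alongDeriv_push_extendVec_comm hK.torsion hL.smooth, sub_self]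

/-- The second fundamental form `(u, v, w) ↦ Ω(∇_u df(v), df(w))`. -/
def sff (g : PseudoRiemannianMetric d N) (D : AffineConnection d N)
    (A : Π p : N, Tan d p →L[ℝ] Tan d p) (f : M → N) (x : M) (u v w : Tan n x) : ℝ :=
  g.inner (f x) (A (f x) (alongDeriv n D f (pushAlong n d f (extendVec v)) x u))
    (mfderiv (𝓡 n) (𝓡 d) f x w)

theorem sff_comm (hD : D.torsion = 0) (hf : ContMDiff (𝓡 n) (𝓡 d) ∞ f) (x : M) (u v w : Tan n x) :
    sff g D A f x u v w = sff g D A f x v u w := by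
  unfold sff
  rw [alongDeriv_push_extendVec_comm hD hf]

/-- Differentiate Ω(df Y, df Z) = 0 and use that A is parallel and skew. Allowing arbitrary fields Y
and Z also shows that the left side depends only on the value of Y at x. -/
theorem IsLagrangian.inner_endo_comm (hK : IsParaComplexSpaceForm g D A c)
    (hL : IsLagrangian g A f h) {x : M} {Y Z : Π y : M, Tan n y} (hY : VDiffAt Y x)
    (hZ : VDiffAt Z x) (u : Tan n x) :
    g.inner (f x) (A (f x) (alongDeriv n D f (pushAlong n d f Y) x u))
        (mfderiv (𝓡 n) (𝓡 d) f x (Z x))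
      = g.inner (f x) (A (f x) (alongDeriv n D f (pushAlong n d f Z) x u))
        (mfderiv (𝓡 n) (𝓡 d) f x (Y x)) := by
  have hfd := (hL.smooth x).mdifferentiableAt (n := ∞) (by simp)
  have hv := vDiffAlongAt_pushAlong hL.smooth hY
  have hw := vDiffAlongAt_pushAlong hL.smooth hZ
  have h1 := alongDeriv_metric hK.metric hfd (hK.smooth.vDiffAlongAt hfd hv) hw u
  have hev : (fun z => g.inner (f z) (A (f z) (pushAlong n d f Y z)) (pushAlong n d f Z z))
      = fun _ => (0 : ℝ) := by
    funext z
    exact hL.isotropic z _ _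
  rw [hev, mvfderiv_const, alongDeriv_endo hK.smooth hK.parallel hfd hv] at h1
  have h2 := hK.skew (f x) (mfderiv (𝓡 n) (𝓡 d) f x (Y x))
    (alongDeriv n D f (pushAlong n d f Z) x u)
  have h3 : (0 : ℝ) = g.inner (f x) (A (f x) (alongDeriv n D f (pushAlong n d f Y) x u))
        (mfderiv (𝓡 n) (𝓡 d) f x (Z x)) + g.inner (f x) (A (f x) (mfderiv (𝓡 n) (𝓡 d) f x (Y x)))
        (alongDeriv n D f (pushAlong n d f Z) x u) := h1
  linarith

theorem sff_comm_right (hK : IsParaComplexSpaceForm g D A c) (hL : IsLagrangian g A f h) (x : M)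
    (u v w : Tan n x) : sff g D A f x u v w = sff g D A f x u w v := by
  have h1 := hL.inner_endo_comm hK (vDiffAt_extendVec v) (vDiffAt_extendVec w) u
  rwa [extendVec_self, extendVec_self] at h1

/-- This is ∇h = -2Π for general fields. In the derivative of h the terms G(∇̂ df Y, df Z) and their
mirror images are also present in the two ∇-terms; after subtraction only the two A-terms remain,
and they are equal by symmetry. -/
theorem IsProjected.mvfderiv_metric (hK : IsParaComplexSpaceForm g D A c)
    (hL : IsLagrangian g A f h) (hP : IsProjected g D A f h D') {x : M} {Y Z : Π y : M, Tan n y}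
    (hY : VDiffAt Y x) (hZ : VDiffAt Z x) (u : Tan n x) :
    mvfderiv (𝓡 n) (fun y => h.inner y (Y y) (Z y)) x u - h.inner x (D' Y x u) (Z x)
        - h.inner x (Y x) (D' Z x u)
      = -2 * g.inner (f x) (A (f x) (alongDeriv n D f (pushAlong n d f Y) x u))
        (mfderiv (𝓡 n) (𝓡 d) f x (Z x)) := by
  have hfd := (hL.smooth x).mdifferentiableAt (n := ∞) (by simp)
  have h1 := alongDeriv_metric hK.metric hfd (vDiffAlongAt_pushAlong hL.smooth hY)
    (vDiffAlongAt_pushAlong hL.smooth hZ) u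
  have hev : (fun y => h.inner y (Y y) (Z y))
      = fun y => g.inner (f y) (pushAlong n d f Y y) (pushAlong n d f Z y) := by
    funext y
    exact hL.isometric y _ _
  have h2 := hL.inner_endo_comm hK hY hZ u
  have h3 : mvfderiv (𝓡 n) (fun y => h.inner y (Y y) (Z y)) x u
      = g.inner (f x) (alongDeriv n D f (pushAlong n d f Y) x u) (mfderiv (𝓡 n) (𝓡 d) f x (Z x))
        + g.inner (f x) (alongDeriv n D f (pushAlong n d f Z) x u)
          (mfderiv (𝓡 n) (𝓡 d) f x (Y x)) := by
    rw [hev, h1, g.symm (f x) (pushAlong n d f Y x)]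
    rfl
  rw [h3, h.symm x (Y x), hP x _ hY, hP x _ hZ]
  linarith

theorem IsProjected.covDerivForm (hK : IsParaComplexSpaceForm g D A c)
    (hL : IsLagrangian g A f h) (hP : IsProjected g D A f h D') (x : M) (u v w : Tan n x) :
    covDerivForm D' (fun y v w => h.inner y v w) x u v w = -2 * sff g D A f x u v w := by
  have h1 := hP.mvfderiv_metric hK hL (vDiffAt_extendVec v) (vDiffAt_extendVec w) u
  rwa [extendVec_self, extendVec_self] at h1

/-- The error of the projection lies in the kernel of 1 + A. This identity is what carries the
induced connection to the ambient one and makes the Gauss equation a formality. -/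
theorem IsProjected.endo_eq (hK : IsParaComplexSpaceForm g D A c) (hL : IsLagrangian g A f h)
    (hP : IsProjected g D A f h D') {x : M} {Y : Π y : M, Tan n y} (hY : VDiffAt Y x)
    (u : Tan n x) :
    mfderiv (𝓡 n) (𝓡 d) f x (D' Y x u) + A (f x) (mfderiv (𝓡 n) (𝓡 d) f x (D' Y x u))
      = alongDeriv n D f (pushAlong n d f Y) x u
        + A (f x) (alongDeriv n D f (pushAlong n d f Y) x u) := by
  rw [← sub_eq_zero]
  set W := alongDeriv n D f (pushAlong n d f Y) x u with hW
  set a := mfderiv (𝓡 n) (𝓡 d) f x (D' Y x u) with ha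
  have hz : ∀ z, g.inner (f x) (a + A (f x) a - (W + A (f x) W)) (mfderiv (𝓡 n) (𝓡 d) f x z)
      = 0 := by
    intro z
    have h1 := hP x Y hY u z
    have h2 := hL.isotropic x (D' Y x u) z
    rw [hL.isometric] at h1
    simp only [map_sub, map_add, sub_apply, add_apply]
    linarith
  refine hL.spanning x _ hz fun z => ?_
  rw [g.symm, hK.skew]
  simp only [map_sub, map_add, hK.sq]
  have := hz z
  simp only [map_sub, map_add, sub_apply, add_apply] at this ⊢
  linarith

/-- The Codazzi equation for a connection and a metric, in the preferred charts. -/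
def IsCodazzi (D : AffineConnection n M) (h : PseudoRiemannianMetric n M) : Prop :=
  ∀ (x y : M), y ∈ (chartAt (EuclideanSpace ℝ (Fin n)) x).source →
    ∀ u v w : EuclideanSpace ℝ (Fin n),
    mvfderiv (𝓡 n) (formCoord h x) y (fromCoord x y u) v w
        - formCoord h x y v (connCoeff D x y w u)
      = mvfderiv (𝓡 n) (formCoord h x) y (fromCoord x y v) u w
        - formCoord h x y u (connCoeff D x y w v)

/-- Follows from ∇h = -2Π and the symmetry of Π in its first two arguments. The term of ∇h absent
from `IsCodazzi` is h(Γ(v, u), w), symmetric in u and v because the torsion vanishes. -/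
theorem IsProjected.isCodazzi (hK : IsParaComplexSpaceForm g D A c)
    (hL : IsLagrangian g A f h) (hP : IsProjected g D A f h D') : IsCodazzi D' h := by
  intro x y hy u v w
  have key : ∀ u v : EuclideanSpace ℝ (Fin n),
      mvfderiv (𝓡 n) (formCoord h x) y (fromCoord x y u) v w
        - formCoord h x y (connCoeff D' x y v u) w - formCoord h x y v (connCoeff D' x y w u)
      = -2 * g.inner (f y) (A (f y) (alongDeriv n D f (pushAlong n d f (coordField x v)) y
          (fromCoord x y u))) (mfderiv (𝓡 n) (𝓡 d) f y (fromCoord x y w)) := by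
    intro u v
    have h1 := hP.mvfderiv_metric hK hL (vDiffAt_coordField hy v) (vDiffAt_coordField hy w)
      (fromCoord x y u)
    have h2 : (fun z => h.inner z (coordField x v z) (coordField x w z))
        = fun z => formCoord h x z v w := by
      funext z
      rw [formCoord_apply]
      rfl
    rw [h2, mvfderiv_formCoord_apply h hy] at h1
    rw [formCoord_apply h x y _ w, formCoord_apply h x y v, connCoeff_apply D' hy,
      connCoeff_apply D' hy, fromCoord_toCoord hy, fromCoord_toCoord hy]
    exact h1
  have h1 := key u v
  have h2 := key v u
  rw [alongDeriv_push_comm hK.torsion hL.smooth hy] at h1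
  rw [connCoeff_comm (hP.torsion hK hL) hy] at h1
  linarith

/-- The Gauss equation. -/
theorem IsProjected.curvature (hK : IsParaComplexSpaceForm g D A c) (hL : IsLagrangian g A f h)
    (hP : IsProjected g D A f h D') (x : M) (u v w : Tan n x) :
    curvature D' x u v w = c • (h.inner x v w • u - h.inner x u w • v) := by
  have hfd := (hL.smooth x).mdifferentiableAt (n := ∞) (by simp)
  have hx := mem_source_self (n := n) x
  have hS := hP.hasSmoothCoeff hK hL
  have hWs : ∀ v : Tan n x, SmoothAlongAt n f (fun z => alongDeriv n D f
      (pushAlong n d f (coordField x (toCoord x x w))) z (fromCoord x z (toCoord x x v))) x :=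
    fun v => SmoothAlongAt.alongDeriv hL.smooth (hK.hasSmoothCoeffAt _) hx
      (eventually_smoothAlongAt_push hL.smooth hx _) _
  -- Because A is parallel, 1 + A passes through differentiation along f.
  have hadd : ∀ {s : Π y : M, Tan d (f y)}, VDiffAlongAt n f s x → ∀ u : Tan n x,
      alongDeriv n D f (fun y => s y + A (f y) (s y)) x u
        = alongDeriv n D f s x u + A (f x) (alongDeriv n D f s x u) := by
    intro s hs u
    rw [alongDeriv_add D hs (hK.smooth.vDiffAlongAt hfd hs), add_apply,
      alongDeriv_endo hK.smooth hK.parallel hfd hs]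
  have key : ∀ u v z : Tan n x,
      h.inner x (D' (fun y => D' (extendVec w) y (extendVec v y)) x u) z
      = g.inner (f x) (alongDeriv n D f (fun z => alongDeriv n D f
          (pushAlong n d f (coordField x (toCoord x x w))) z (fromCoord x z (toCoord x x v))) x u)
          (mfderiv (𝓡 n) (𝓡 d) f x z)
        + g.inner (f x) (A (f x) (alongDeriv n D f (fun z => alongDeriv n D f
          (pushAlong n d f (coordField x (toCoord x x w))) z (fromCoord x z (toCoord x x v))) x u))
          (mfderiv (𝓡 n) (𝓡 d) f x z) := by
    intro u v z
    have hY := connection_extendVec_vDiffAt (hS.hasSmoothCoeffAt x) v w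
    rw [hP x _ hY, ← add_apply, ← map_add, ← add_apply, ← map_add,
      ← hadd (vDiffAlongAt_pushAlong hL.smooth hY),
      ← hadd ((hWs v).vDiffAlongAt (hL.smooth x))]
    -- After applying 1 + A, the inner induced derivative may be replaced by the ambient derivative
    -- on a whole neighbourhood, so the iterated derivative becomes an iterated ambient one.
    have hev : ∀ᶠ y in nhds x,
        pushAlong n d f (fun y => D' (extendVec w) y (extendVec v y)) y
          + A (f y) (pushAlong n d f (fun y => D' (extendVec w) y (extendVec v y)) y)
        = alongDeriv n D f (pushAlong n d f (coordField x (toCoord x x w))) y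
            (fromCoord x y (toCoord x x v))
          + A (f y) (alongDeriv n D f (pushAlong n d f (coordField x (toCoord x x w))) y
            (fromCoord x y (toCoord x x v))) := by
      filter_upwards [eventually_mem_source hx] with y hy
      rw [← hP.endo_eq hK hL (vDiffAt_coordField hy _)]
      unfold pushAlong
      beta_reduce
      rw [connection_extendVec D' hy, extendVec_eq hy]
    rw [alongDeriv_congr D hL.smooth.continuous.continuousAt hev]
  rw [← sub_eq_zero]
  refine h.nondegenerate x _ fun z => ?_
  have hc := alongDeriv_comm hL.smooth (hK.hasSmoothCoeffAt _) hx
    (eventually_smoothAlongAt_push hL.smooth hx (toCoord x x w)) (toCoord x x u) (toCoord x x v)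
  rw [fromCoord_toCoord_self, fromCoord_toCoord_self, hK.curv] at hc
  have hw : pushAlong n d f (coordField x (toCoord x x w)) x = mfderiv (𝓡 n) (𝓡 d) f x w := by
    unfold pushAlong coordField
    rw [fromCoord_toCoord_self]
  rw [hw, ← hL.isometric, ← hL.isometric] at hc
  -- Ω vanishes on the tangent space of the Lagrangian, leaving only the two metric terms of the
  -- ambient curvature.
  simp only [hL.isotropic, zero_smul, mul_zero, sub_zero, add_zero] at hc
  have hk1 := key u v z
  have hk2 := key v u z
  have e1 := congrArg (fun e => g.inner (f x) e (mfderiv (𝓡 n) (𝓡 d) f x z)) hc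
  -- The remaining ambient curvature is tangent to M, so its image under A is orthogonal to df(z)
  -- and the A-part contributes nothing.
  have e2 := congrArg (fun e => g.inner (f x) (A (f x) e) (mfderiv (𝓡 n) (𝓡 d) f x z)) hc
  unfold _root_.curvature
  rw [mlieBracket_extendVec]
  simp only [map_sub, map_smul, map_zero, sub_apply, smul_apply, smul_eq_mul, sub_zero,
    hL.isotropic, mul_zero, ← hL.isometric] at e1 e2 ⊢
  linarith

end Gauss

/-! ### Integrable linear first-order systems -/

section IntegrableSystems

variable {E F : Type*} [NormedAddCommGroup E] [NormedSpace ℝ E] [FiniteDimensional ℝ E]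
  [NormedAddCommGroup F] [NormedSpace ℝ F] [CompleteSpace F]

/-- The derivative is jointly continuous, hence bounded on the compact product of a unit ball and
[0, 1]. That constant serves as the dominating function. -/
theorem hasFDerivAt_integral_of_continuous {G : E → ℝ → F} {G' : E → ℝ → E →L[ℝ] F}
    (hG : Continuous G.uncurry) (hG' : Continuous G'.uncurry)
    (hd : ∀ x t, HasFDerivAt (fun x => G x t) (G' x t) x) (x : E) :
    HasFDerivAt (fun x => ∫ t in (0 : ℝ)..1, G x t) (∫ t in (0 : ℝ)..1, G' x t) x := by
  have : ProperSpace E := FiniteDimensional.proper ℝ E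
  obtain ⟨C, hC⟩ := ((isCompact_closedBall x 1).prod
    (isCompact_Icc (a := (0 : ℝ)) (b := 1))).exists_bound_of_continuousOn hG'.continuousOn
  refine intervalIntegral.hasFDerivAt_integral_of_dominated_of_fderiv_le (bound := fun _ => C)
    (Metric.closedBall_mem_nhds x one_pos) (Filter.Eventually.of_forall fun y => ?_) ?_ ?_ ?_ ?_ ?_
  · exact (hG.comp (continuous_const.prodMk continuous_id)).aestronglyMeasurable
  · exact (hG.comp (continuous_const.prodMk continuous_id)).intervalIntegrable _ _
  · exact (hG'.comp (continuous_const.prodMk continuous_id)).aestronglyMeasurable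
  · refine Filter.Eventually.of_forall fun t ht y hy => ?_
    rw [Set.uIoc_of_le zero_le_one] at ht
    exact hC (y, t) ⟨hy, ht.1.le, ht.2⟩
  · exact intervalIntegrable_const
  · exact Filter.Eventually.of_forall fun t _ y _ => hd y t

/-- The Picard iterates of the system `dV(x) v = A(x) v V(x)` along rays from the origin. -/
def picardIter (A : E → E →L[ℝ] F →L[ℝ] F) (V₀ : F) : ℕ → E → F
  | 0 => fun _ => V₀
  | m + 1 => fun x => V₀ + ∫ t in (0 : ℝ)..1, A (t • x) x (picardIter A V₀ m (t • x))

/-- The derivative of `x ↦ A (t x) x (V (t x))`. -/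
def rayDeriv (A : E → E →L[ℝ] F →L[ℝ] F) (V : E → F) (x : E) (t : ℝ) : E →L[ℝ] F :=
  (A (t • x)).flip (V (t • x)) + t • (((fderiv ℝ A (t • x)).flip x).flip (V (t • x)))
    + t • ((A (t • x) x).comp (fderiv ℝ V (t • x)))

set_option maxHeartbeats 1000000 in
set_option synthInstance.maxHeartbeats 200000 in
theorem hasFDerivAt_ray {A : E → E →L[ℝ] F →L[ℝ] F} (hA : ContDiff ℝ 1 A) {V : E → F}
    (hV : ContDiff ℝ 1 V) (x : E) (t : ℝ) :
    HasFDerivAt (fun x => A (t • x) x (V (t • x))) (rayDeriv A V x t) x := by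
  have ht : HasFDerivAt (fun x : E => t • x) (t • ContinuousLinearMap.id ℝ E) x :=
    (hasFDerivAt_id x).const_smul t
  have h1 := ((hA.differentiable one_ne_zero (t • x)).hasFDerivAt).comp x ht
  have h2 := ((hV.differentiable one_ne_zero (t • x)).hasFDerivAt).comp x ht
  refine ((h1.clm_apply (hasFDerivAt_id x)).clm_apply h2).congr_fderiv ?_
  ext v
  simp [rayDeriv]
  abel

set_option maxHeartbeats 1000000 in
set_option synthInstance.maxHeartbeats 200000 in
theorem continuous_rayDeriv {A : E → E →L[ℝ] F →L[ℝ] F} (hA : ContDiff ℝ 1 A) {V : E → F}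
    (hV : ContDiff ℝ 1 V) : Continuous (rayDeriv A V).uncurry := by
  have hA0 := hA.continuous
  have hV0 := hV.continuous
  have hA1 := hA.continuous_fderiv one_ne_zero
  have hV1 := hV.continuous_fderiv one_ne_zero
  have hs : Continuous fun p : E × ℝ => p.2 • p.1 := continuous_snd.smul continuous_fst
  have hflip : Continuous (fun L : E →L[ℝ] F →L[ℝ] F => L.flip) :=
    (ContinuousLinearMap.flipₗᵢ ℝ E F F).continuous
  have hflip2 : Continuous (fun L : E →L[ℝ] E →L[ℝ] F →L[ℝ] F => L.flip) :=
    (ContinuousLinearMap.flipₗᵢ ℝ E E (F →L[ℝ] F)).continuous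
  refine ((Continuous.clm_apply (hflip.comp (hA0.comp hs)) (hV0.comp hs)).add
    (continuous_snd.smul ?_)).add (continuous_snd.smul ?_)
  · exact Continuous.clm_apply (hflip.comp (Continuous.clm_apply (hflip2.comp (hA1.comp hs))
      continuous_fst)) (hV0.comp hs)
  · exact Continuous.clm_comp (Continuous.clm_apply (hA0.comp hs) continuous_fst) (hV1.comp hs)

theorem continuous_ray {A : E → E →L[ℝ] F →L[ℝ] F} (hA : ContDiff ℝ 1 A) {V : E → F}
    (hV : ContDiff ℝ 1 V) : Continuous (fun x (t : ℝ) => A (t • x) x (V (t • x))).uncurry := by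
  have hs : Continuous fun p : E × ℝ => p.2 • p.1 := continuous_snd.smul continuous_fst
  exact Continuous.clm_apply (Continuous.clm_apply (hA.continuous.comp hs) continuous_fst)
    (hV.continuous.comp hs)

theorem hasFDerivAt_picardStep {A : E → E →L[ℝ] F →L[ℝ] F} (hA : ContDiff ℝ 1 A) {V : E → F}
    (hV : ContDiff ℝ 1 V) (V₀ : F) (x : E) :
    HasFDerivAt (fun x => V₀ + ∫ t in (0 : ℝ)..1, A (t • x) x (V (t • x)))
      (∫ t in (0 : ℝ)..1, rayDeriv A V x t) x :=
  (hasFDerivAt_integral_of_continuous (continuous_ray hA hV) (continuous_rayDeriv hA hV)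
    (hasFDerivAt_ray hA hV) x).const_add V₀

theorem contDiff_picardIter {A : E → E →L[ℝ] F →L[ℝ] F} (hA : ContDiff ℝ 1 A) (V₀ : F) (m : ℕ) :
    ContDiff ℝ 1 (picardIter A V₀ m) := by
  induction m with
  | zero => exact contDiff_const
  | succ m ih =>
    rw [contDiff_one_iff_hasFDerivAt]
    refine ⟨fun x => ∫ t in (0 : ℝ)..1, rayDeriv A (picardIter A V₀ m) x t, ?_,
      hasFDerivAt_picardStep hA ih V₀⟩
    exact intervalIntegral.continuous_parametric_intervalIntegral_of_continuous'
      (continuous_rayDeriv hA ih) 0 1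

/-- The defect of a function from being a solution. -/
def systemDefect (A : E → E →L[ℝ] F →L[ℝ] F) (V : E → F) (x v : E) : F :=
  fderiv ℝ V x v - A x v (V x)

/-- Integrability of a linear first-order system. -/
def IsIntegrableAt (A : E → E →L[ℝ] F →L[ℝ] F) (x : E) : Prop :=
  ∀ v w z, fderiv ℝ A x v w z + A x w (A x v z) = fderiv ℝ A x w v z + A x v (A x w z)

theorem hasDerivAt_ray {B : E → F →L[ℝ] F} (hB : ContDiff ℝ 1 B) {V : E → F}
    (hV : ContDiff ℝ 1 V) (x : E) (t : ℝ) :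
    HasDerivAt (fun t : ℝ => t • (B (t • x) (V (t • x))))
      (B (t • x) (V (t • x)) + t • (fderiv ℝ B (t • x) x (V (t • x))
        + B (t • x) (fderiv ℝ V (t • x) x))) t := by
  have ht : HasDerivAt (fun t : ℝ => t • x) x t := by
    simpa using (hasDerivAt_id t).smul_const x
  have h1 : HasDerivAt (fun t : ℝ => B (t • x)) (fderiv ℝ B (t • x) x) t :=
    ((hB.differentiable one_ne_zero (t • x)).hasFDerivAt).comp_hasDerivAt t ht
  have h2 : HasDerivAt (fun t : ℝ => V (t • x)) (fderiv ℝ V (t • x) x) t :=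
    ((hV.differentiable one_ne_zero (t • x)).hasFDerivAt).comp_hasDerivAt t ht
  refine ((hasDerivAt_id t).smul (h1.clm_apply h2)).congr_deriv ?_
  simp only [id_eq, one_smul, smul_add]
  abel

/-- The fundamental theorem of calculus for t B(tx) V(tx). The factor t removes the boundary
contribution at 0, so that an endpoint value becomes an integral over the ray. -/
theorem integral_ray {B : E → F →L[ℝ] F} (hB : ContDiff ℝ 1 B) {V : E → F}
    (hV : ContDiff ℝ 1 V) (x : E) :
    Continuous (fun t : ℝ => B (t • x) (V (t • x)) + t • (fderiv ℝ B (t • x) x (V (t • x))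
        + B (t • x) (fderiv ℝ V (t • x) x))) ∧
    ∫ t in (0 : ℝ)..1, (B (t • x) (V (t • x)) + t • (fderiv ℝ B (t • x) x (V (t • x))
        + B (t • x) (fderiv ℝ V (t • x) x))) = B x (V x) := by
  have hs : Continuous fun t : ℝ => t • x := continuous_id.smul continuous_const
  have hB0 := hB.continuous.comp hs
  have hV0 := hV.continuous.comp hs
  have hB1 := (hB.continuous_fderiv one_ne_zero).comp hs
  have hV1 := (hV.continuous_fderiv one_ne_zero).comp hs
  have hc : Continuous (fun t : ℝ => B (t • x) (V (t • x))
      + t • (fderiv ℝ B (t • x) x (V (t • x)) + B (t • x) (fderiv ℝ V (t • x) x))) :=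
    (hB0.clm_apply hV0).add (continuous_id.smul (((hB1.clm_apply continuous_const).clm_apply
      hV0).add (hB0.clm_apply (hV1.clm_apply continuous_const))))
  refine ⟨hc, ?_⟩
  have h := intervalIntegral.integral_eq_sub_of_hasDerivAt (fun t _ => hasDerivAt_ray hB hV x t)
    (hc.intervalIntegrable 0 1)
  rwa [one_smul, one_smul, zero_smul, sub_zero] at h

theorem fderiv_clm_const_apply {H H' : Type*} [NormedAddCommGroup H] [NormedSpace ℝ H]
    [NormedAddCommGroup H'] [NormedSpace ℝ H'] {A : E → H' →L[ℝ] H} {y : E}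
    (hA : DifferentiableAt ℝ A y) (v : H') (x : E) :
    fderiv ℝ (fun y => A y v) y x = fderiv ℝ A y x v := by
  refine (congrArg (fun L => L x) (hA.hasFDerivAt.clm_apply (hasFDerivAt_const v y)).fderiv).trans ?_
  simp

/-- The defect of a Picard iterate in terms of the defect of the previous one. -/
theorem systemDefect_picardStep {A : E → E →L[ℝ] F →L[ℝ] F} (hA : ContDiff ℝ 1 A) {V : E → F}
    (hV : ContDiff ℝ 1 V) (V₀ : F) {x : E}
    (hI : ∀ t ∈ Set.Icc (0 : ℝ) 1, IsIntegrableAt A (t • x)) (v : E) :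
    fderiv ℝ (fun x => V₀ + ∫ t in (0 : ℝ)..1, A (t • x) x (V (t • x))) x v - A x v (V x)
      = ∫ t in (0 : ℝ)..1, t • (A (t • x) x (systemDefect A V (t • x) v)
        - A (t • x) v (systemDefect A V (t • x) x)) := by
  have hR : Continuous (rayDeriv A V x) := (continuous_rayDeriv hA hV).uncurry_left x
  have hB : ContDiff ℝ 1 (fun y => A y v) := hA.clm_apply contDiff_const
  have hdB : ∀ y, fderiv ℝ (fun y => A y v) y x = fderiv ℝ A y x v := fun y =>
    fderiv_clm_const_apply (hA.differentiable one_ne_zero y) v x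
  obtain ⟨hc, hftc⟩ := integral_ray hB hV x
  -- The term A(x) v V(x) is written as the integral of the t-derivative of t A(tx) v V(tx), so that
  -- the two integrands can be compared pointwise.
  rw [(hasFDerivAt_picardStep hA hV V₀ x).fderiv,
    ContinuousLinearMap.intervalIntegral_apply (hR.intervalIntegrable 0 1), ← hftc,
    ← intervalIntegral.integral_sub ((hR.clm_apply continuous_const).intervalIntegrable 0 1)
      (hc.intervalIntegrable 0 1)]
  refine intervalIntegral.integral_congr fun t ht => ?_
  rw [Set.uIcc_of_le zero_le_one] at ht
  -- Integrability trades the derivative of A in direction v, contracted with x, for the derivative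
  -- along the ray, contracted with v. The derivative terms then match and only defects survive.
  have h := hI t ht v x (V (t • x))
  have h' : fderiv ℝ A (t • x) v x (V (t • x)) = fderiv ℝ A (t • x) x v (V (t • x))
      + A (t • x) v (A (t • x) x (V (t • x))) - A (t • x) x (A (t • x) v (V (t • x))) :=
    eq_sub_of_add_eq h
  simp only [rayDeriv, systemDefect, add_apply, smul_apply, ContinuousLinearMap.flip_apply,
    ContinuousLinearMap.comp_apply, map_sub, h', hdB]
  module

/-- The iterates converge geometrically, and by `systemDefect_picardStep` their defects also decay
geometrically. Hence the derivatives, which are A applied to the iterates plus the defect, converge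
uniformly, and the limit solves the system in all directions and not only along rays. -/
theorem exists_solution_of_bounded {A : E → E →L[ℝ] F →L[ℝ] F} (hA : ContDiff ℝ 1 A) {K r : ℝ}
    (hK : ∀ x, ‖A x‖ ≤ K) (hr1 : 2 * (K * r) ≤ 1 / 8)
    (hI : ∀ x ∈ Metric.ball (0 : E) r, IsIntegrableAt A x) (V₀ : F) :
    ∃ V : E → F, V 0 = V₀ ∧
      ∀ x ∈ Metric.ball (0 : E) r, HasFDerivAt V ((A x).flip (V x)) x := by
  have hK0 : 0 ≤ K := (norm_nonneg (A 0)).trans (hK 0)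
  set V : ℕ → E → F := picardIter A V₀ with hV
  have hVs : ∀ m x, V (m + 1) x = V₀ + ∫ t in (0 : ℝ)..1, A (t • x) x (V m (t • x)) :=
    fun m x => rfl
  have hVc : ∀ m, ContDiff ℝ 1 (V m) := contDiff_picardIter hA V₀
  have hball : ∀ {x : E} {t : ℝ}, x ∈ Metric.ball (0 : E) r → t ∈ Set.Icc (0 : ℝ) 1 →
      t • x ∈ Metric.ball (0 : E) r := by
    intro x t hx ht
    rw [mem_ball_zero_iff] at hx ⊢
    rw [norm_smul, Real.norm_eq_abs, abs_of_nonneg ht.1]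
    exact (mul_le_of_le_one_left (norm_nonneg x) ht.2).trans_lt hx
  -- The contraction constant 1/16 is the bound on K r given by the choice of radius.
  have hAx : ∀ {x y : E}, x ∈ Metric.ball (0 : E) r → ∀ z : F, ‖A y x z‖ ≤ (1 / 16) * ‖z‖ := by
    intro x y hx z
    rw [mem_ball_zero_iff] at hx
    calc ‖A y x z‖ ≤ ‖A y x‖ * ‖z‖ := (A y x).le_opNorm z
      _ ≤ (‖A y‖ * ‖x‖) * ‖z‖ := by gcongr; exact (A y).le_opNorm x
      _ ≤ (K * r) * ‖z‖ := by gcongr; exact hK y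
      _ ≤ (1 / 16) * ‖z‖ := by gcongr; linarith
  have hAv : ∀ (x v : E) (z : F), ‖A x v z‖ ≤ K * ‖v‖ * ‖z‖ := by
    intro x v z
    calc ‖A x v z‖ ≤ ‖A x v‖ * ‖z‖ := (A x v).le_opNorm z
      _ ≤ (‖A x‖ * ‖v‖) * ‖z‖ := by gcongr; exact (A x).le_opNorm v
      _ ≤ (K * ‖v‖) * ‖z‖ := by gcongr; exact hK x
  have hcont : ∀ m x, Continuous fun t : ℝ => A (t • x) x (V m (t • x)) := fun m x =>
    (continuous_ray hA (hVc m)).comp (continuous_const.prodMk continuous_id)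
  have hdiff : ∀ m, ∀ x ∈ Metric.ball (0 : E) r,
      ‖V (m + 1) x - V m x‖ ≤ ‖V₀‖ * (1 / 4) ^ (m + 1) := by
    intro m
    induction m with
    | zero =>
      intro x hx
      have h0 : V (0 + 1) x - V 0 x = ∫ t in (0 : ℝ)..1, A (t • x) x (V 0 (t • x)) := by
        rw [hVs]
        exact add_sub_cancel_left _ _
      rw [h0]
      refine (intervalIntegral.norm_integral_le_of_norm_le_const (C := (1 / 16) * ‖V₀‖)
        fun t ht => hAx hx _).trans ?_
      simp only [sub_zero, abs_one]
      nlinarith [norm_nonneg V₀]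
    | succ m ih =>
      intro x hx
      rw [hVs (m + 1), hVs m, add_sub_add_left_eq_sub, ← intervalIntegral.integral_sub
        ((hcont _ x).intervalIntegrable 0 1) ((hcont _ x).intervalIntegrable 0 1)]
      refine (intervalIntegral.norm_integral_le_of_norm_le_const
        (C := (1 / 16) * (‖V₀‖ * (1 / 4) ^ (m + 1))) fun t ht => ?_).trans ?_
      · rw [Set.uIoc_of_le zero_le_one] at ht
        rw [← map_sub]
        refine (hAx hx _).trans ?_
        gcongr
        exact ih _ (hball hx ⟨ht.1.le, ht.2⟩)
      · rw [sub_zero, abs_one, pow_succ _ (m + 1)]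
        have : 0 ≤ ‖V₀‖ * (1 / 4 : ℝ) ^ (m + 1) := by positivity
        linarith
  -- The defect shrinks by 1/4 at each step: the integral contributes 1/16 + 1/16 of the previous
  -- bound, and the change of iterate contributes a further 1/8, the factor 2 in the constant being
  -- there to make it so.
  have hdef : ∀ m, ∀ x ∈ Metric.ball (0 : E) r, ∀ v,
      ‖systemDefect A (V m) x v‖ ≤ 2 * K * ‖V₀‖ * (1 / 4) ^ m * ‖v‖ := by
    intro m
    induction m with
    | zero =>
      intro x hx v
      have h0 : systemDefect A (V 0) x v = -A x v V₀ := by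
        have : V 0 = fun _ => V₀ := rfl
        unfold systemDefect
        rw [this]
        simp
      rw [h0, norm_neg]
      refine (hAv x v V₀).trans ?_
      have : 0 ≤ K * ‖v‖ * ‖V₀‖ := by positivity
      simp only [pow_zero]
      nlinarith
    | succ m ih =>
      intro x hx v
      have h0 : systemDefect A (V (m + 1)) x v = (∫ t in (0 : ℝ)..1,
          t • (A (t • x) x (systemDefect A (V m) (t • x) v)
            - A (t • x) v (systemDefect A (V m) (t • x) x))) - A x v (V (m + 1) x - V m x) := by
        rw [← systemDefect_picardStep hA (hVc m) V₀ (fun t ht => hI _ (hball hx ht)) v, map_sub]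
        have : V (m + 1) = fun x => V₀ + ∫ t in (0 : ℝ)..1, A (t • x) x (V m (t • x)) := rfl
        unfold systemDefect
        rw [← this]
        abel
      rw [h0]
      set q : ℝ := 2 * K * ‖V₀‖ * (1 / 4) ^ m with hq
      have hq0 : 0 ≤ q := by positivity
      have hxr : ‖x‖ ≤ r := (mem_ball_zero_iff.1 hx).le
      have h1 : ‖∫ t in (0 : ℝ)..1, t • (A (t • x) x (systemDefect A (V m) (t • x) v)
            - A (t • x) v (systemDefect A (V m) (t • x) x))‖ ≤ (1 / 8) * (q * ‖v‖) := by
        refine (intervalIntegral.norm_integral_le_of_norm_le_const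
          (C := (1 / 8) * (q * ‖v‖)) fun t ht => ?_).trans (by simp)
        rw [Set.uIoc_of_le zero_le_one] at ht
        have hb := hball hx ⟨ht.1.le, ht.2⟩
        rw [norm_smul, Real.norm_eq_abs, abs_of_pos ht.1]
        have b1 : ‖A (t • x) x (systemDefect A (V m) (t • x) v)‖ ≤ (1 / 16) * (q * ‖v‖) := by
          refine (hAx hx _).trans ?_
          gcongr
          exact ih _ hb v
        have b2 : ‖A (t • x) v (systemDefect A (V m) (t • x) x)‖ ≤ (1 / 16) * (q * ‖v‖) := by
          calc ‖A (t • x) v (systemDefect A (V m) (t • x) x)‖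
              ≤ K * ‖v‖ * ‖systemDefect A (V m) (t • x) x‖ := hAv _ _ _
            _ ≤ K * ‖v‖ * (q * r) := by
              gcongr
              exact (ih _ hb x).trans (by gcongr)
            _ = (K * r) * (q * ‖v‖) := by ring
            _ ≤ (1 / 16) * (q * ‖v‖) := by gcongr; linarith
        calc t * ‖A (t • x) x (systemDefect A (V m) (t • x) v)
              - A (t • x) v (systemDefect A (V m) (t • x) x)‖
            ≤ 1 * ((1 / 16) * (q * ‖v‖) + (1 / 16) * (q * ‖v‖)) := by
              gcongr
              · exact ht.2
              · exact (norm_sub_le _ _).trans (add_le_add b1 b2)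
          _ = (1 / 8) * (q * ‖v‖) := by ring
      have h2 : ‖A x v (V (m + 1) x - V m x)‖ ≤ (1 / 8) * (q * ‖v‖) := by
        calc ‖A x v (V (m + 1) x - V m x)‖ ≤ K * ‖v‖ * ‖V (m + 1) x - V m x‖ := hAv _ _ _
          _ ≤ K * ‖v‖ * (‖V₀‖ * (1 / 4) ^ (m + 1)) := by gcongr; exact hdiff m x hx
          _ = (1 / 8) * (q * ‖v‖) := by rw [hq, pow_succ]; ring
      calc _ ≤ (1 / 8) * (q * ‖v‖) + (1 / 8) * (q * ‖v‖) := (norm_sub_le _ _).trans (add_le_add h1 h2)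
        _ = 2 * K * ‖V₀‖ * (1 / 4) ^ (m + 1) * ‖v‖ := by rw [hq, pow_succ]; ring
  have hsum : ∀ m, ‖V₀‖ * (1 / 4 : ℝ) ^ (m + 1) = (‖V₀‖ * (1 / 4)) * (1 / 4) ^ m := by
    intro m
    rw [pow_succ]
    ring
  have hcau : ∀ x ∈ Metric.ball (0 : E) r, ∀ m, dist (V m x) (V (m + 1) x)
      ≤ (‖V₀‖ * (1 / 4)) * (1 / 4) ^ m := by
    intro x hx m
    rw [dist_comm, dist_eq_norm, ← hsum]
    exact hdiff m x hx
  have hlim : ∀ x ∈ Metric.ball (0 : E) r, ∃ L, Filter.Tendsto (fun m => V m x) Filter.atTop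
      (nhds L) := fun x hx =>
    cauchySeq_tendsto_of_complete
      (cauchySeq_of_le_geometric (1 / 4) (‖V₀‖ * (1 / 4)) (by norm_num) (hcau x hx))
  classical
  -- The default V₀ outside the ball gives the right initial value even when the ball is empty.
  set W : E → F := fun x => if hx : x ∈ Metric.ball (0 : E) r then (hlim x hx).choose else V₀
    with hW
  have hWt : ∀ x ∈ Metric.ball (0 : E) r, Filter.Tendsto (fun m => V m x) Filter.atTop
      (nhds (W x)) := by
    intro x hx
    simp only [hW, dif_pos hx]
    exact (hlim x hx).choose_spec
  have hWd : ∀ x ∈ Metric.ball (0 : E) r, ∀ m, ‖V m x - W x‖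
      ≤ (‖V₀‖ * (1 / 4)) * (1 / 4) ^ m / (1 - 1 / 4) := by
    intro x hx m
    rw [← dist_eq_norm]
    exact dist_le_of_le_geometric_of_tendsto (1 / 4) (‖V₀‖ * (1 / 4)) (by norm_num) (hcau x hx)
      (hWt x hx) m
  refine ⟨W, ?_, fun x hx => ?_⟩
  · by_cases h0 : (0 : E) ∈ Metric.ball (0 : E) r
    · refine tendsto_nhds_unique (hWt 0 h0) ?_
      refine tendsto_const_nhds.congr fun m => ?_
      cases m with
      | zero => rfl
      | succ m =>
        rw [hVs]
        simp
    · simp only [hW, dif_neg h0]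
  · refine hasFDerivAt_of_tendstoUniformlyOn (f := V) (f' := fun m => fderiv ℝ (V m))
      (g' := fun x => (A x).flip (W x)) (l := Filter.atTop) Metric.isOpen_ball ?_
      (fun m y _ => ((hVc m).differentiable one_ne_zero y).hasFDerivAt) hWt hx
    rw [Metric.tendstoUniformlyOn_iff]
    intro ε hε
    have hT : Filter.Tendsto (fun m : ℕ => (2 * K * ‖V₀‖
        + K * ((‖V₀‖ * (1 / 4)) / (1 - 1 / 4))) * (1 / 4 : ℝ) ^ m) Filter.atTop (nhds 0) := by
      have := (tendsto_pow_atTop_nhds_zero_of_lt_one (r := (1 / 4 : ℝ)) (by norm_num)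
        (by norm_num)).const_mul (2 * K * ‖V₀‖ + K * ((‖V₀‖ * (1 / 4)) / (1 - 1 / 4)))
      rwa [mul_zero] at this
    filter_upwards [hT.eventually (gt_mem_nhds hε)] with m hm y hy
    refine lt_of_le_of_lt ?_ hm
    rw [dist_comm, dist_eq_norm]
    refine ContinuousLinearMap.opNorm_le_bound _ (by positivity) fun v => ?_
    -- The error of the derivative is the defect of the iterate plus A applied to the error of the
    -- iterate; both decay uniformly on the ball.
    have e : (fderiv ℝ (V m) y - (A y).flip (W y)) v
        = systemDefect A (V m) y v + A y v (V m y - W y) := by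
      simp only [systemDefect, sub_apply, ContinuousLinearMap.flip_apply, map_sub]
      abel
    rw [e]
    calc _ ≤ 2 * K * ‖V₀‖ * (1 / 4) ^ m * ‖v‖
          + K * ‖v‖ * ((‖V₀‖ * (1 / 4)) * (1 / 4) ^ m / (1 - 1 / 4)) :=
          (norm_add_le _ _).trans (add_le_add (hdef m y hy v)
            ((hAv _ _ _).trans (by gcongr; exact hWd y hy m)))
      _ = _ := by ring

end IntegrableSystems

/-! ### Localization and smoothness of solutions -/

section IntegrableSystemsLocal

variable {E F : Type*} [NormedAddCommGroup E] [NormedSpace ℝ E] [FiniteDimensional ℝ E]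
  [NormedAddCommGroup F] [NormedSpace ℝ F] [CompleteSpace F]

/-- The Picard scheme wants globally defined, bounded coefficients centred at the origin. A bump
function equal to 1 on the half-radius ball provides them without altering A or its derivative
there. -/
theorem exists_cutoff {H : Type*} [NormedAddCommGroup H] [NormedSpace ℝ H] {A : E → H} {U : Set E}
    (hU : IsOpen U) {x₀ : E} (hx : x₀ ∈ U) (hA : ContDiffOn ℝ ∞ A U) :
    ∃ (B : E → H) (r K : ℝ), 0 < r ∧ ContDiff ℝ ∞ B ∧ (∀ y, ‖B y‖ ≤ K) ∧
      ∀ y ∈ Metric.ball (0 : E) r, x₀ + y ∈ U ∧ B y = A (x₀ + y) ∧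
        fderiv ℝ B y = fderiv ℝ A (x₀ + y) := by
  have : ProperSpace E := FiniteDimensional.proper ℝ E
  obtain ⟨R, hR, hRU⟩ := Metric.nhds_basis_closedBall.mem_iff.1 (hU.mem_nhds hx)
  let ρ : ContDiffBump (0 : E) := ⟨R / 2, R, by positivity, by linarith⟩
  set B : E → H := fun y => ρ y • A (x₀ + y) with hB
  have hmem : ∀ y ∈ Metric.closedBall (0 : E) R, x₀ + y ∈ U := by
    intro y hy
    refine hRU ?_
    rw [mem_closedBall_zero_iff] at hy
    rw [Metric.mem_closedBall, dist_eq_norm, add_sub_cancel_left]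
    exact hy
  have hBc : ContDiff ℝ ∞ B := by
    rw [contDiff_iff_contDiffAt]
    intro y
    by_cases hy : y ∈ Metric.closedBall (0 : E) R
    · have h1 : ContDiffAt ℝ ∞ A (x₀ + y) := hA.contDiffAt (hU.mem_nhds (hmem y hy))
      have h2 : ContDiffAt ℝ ∞ (fun y => A (x₀ + y)) y :=
        h1.comp y (contDiffAt_const.add contDiffAt_id)
      exact ρ.contDiff.contDiffAt.smul h2
    · have h0 : B =ᶠ[nhds y] fun _ => 0 := by
        filter_upwards [Metric.isClosed_closedBall.isOpen_compl.mem_nhds hy] with z hz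
        have hz' : ρ.rOut ≤ dist z 0 := by
          rw [Set.mem_compl_iff, Metric.mem_closedBall, not_le] at hz
          exact hz.le
        simp only [hB, ρ.zero_of_le_dist hz', zero_smul]
      exact contDiffAt_const.congr_of_eventuallyEq h0
  have hsupp : HasCompactSupport B := ρ.hasCompactSupport.smul_right
  obtain ⟨K, hK⟩ := hsupp.exists_bound_of_continuous hBc.continuous
  refine ⟨B, R / 2, K, by positivity, hBc, hK, fun y hy => ?_⟩
  have key : ∀ z ∈ Metric.ball (0 : E) (R / 2), B z = A (x₀ + z) := by
    intro z hz
    simp only [hB, ρ.one_of_mem_closedBall (Metric.ball_subset_closedBall hz), one_smul]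
  refine ⟨hmem y (Metric.closedBall_subset_closedBall (by linarith)
    (Metric.ball_subset_closedBall hy)), key y hy, ?_⟩
  have hev : B =ᶠ[nhds y] fun y => A (x₀ + y) := by
    filter_upwards [Metric.isOpen_ball.mem_nhds hy] with z hz
    exact key z hz
  rw [hev.fderiv_eq, fderiv_comp_add_left]

-- Bootstrapping: the derivative is A applied to V, so it is as regular as V, and each step gains
-- one order of differentiability.
set_option maxHeartbeats 1000000 in
set_option synthInstance.maxHeartbeats 200000 in
theorem contDiffOn_of_system {A : E → E →L[ℝ] F →L[ℝ] F} {V : E → F} {W : Set E} (hW : IsOpen W)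
    (hA : ContDiffOn ℝ ∞ A W) (hV : ∀ x ∈ W, HasFDerivAt V ((A x).flip (V x)) x) :
    ContDiffOn ℝ ∞ V W := by
  rw [contDiffOn_infty]
  intro m
  induction m with
  | zero => exact contDiffOn_zero.2 fun x hx => (hV x hx).continuousAt.continuousWithinAt
  | succ m ih =>
    push_cast
    rw [contDiffOn_succ_iff_fderiv_of_isOpen hW]
    refine ⟨fun x hx => (hV x hx).differentiableAt.differentiableWithinAt, by simp, ?_⟩
    have h1 : ContDiffOn ℝ m (fun x => (A x).flip (V x)) W :=
      contDiffOn_clm_apply.2 fun v =>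
        ((contDiffOn_infty.1 hA m).clm_apply contDiffOn_const).clm_apply ih
    exact h1.congr fun x hx => (hV x hx).fderiv

set_option maxHeartbeats 1000000 in
set_option synthInstance.maxHeartbeats 200000 in
/-- An integrable linear system has local solutions with arbitrary initial values. -/
theorem exists_local_solution {A : E → E →L[ℝ] F →L[ℝ] F} {U : Set E} (hU : IsOpen U) {x₀ : E}
    (hx : x₀ ∈ U) (hA : ContDiffOn ℝ ∞ A U) (hI : ∀ x ∈ U, IsIntegrableAt A x) (V₀ : F) :
    ∃ W : Set E, IsOpen W ∧ x₀ ∈ W ∧ W ⊆ U ∧ ∃ V : E → F, V x₀ = V₀ ∧ ContDiffOn ℝ ∞ V W ∧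
      ∀ x ∈ W, HasFDerivAt V ((A x).flip (V x)) x := by
  obtain ⟨B, R, K, hR, hB, hK, hBA⟩ := exists_cutoff hU hx hA
  have hK0 : 0 ≤ K := (norm_nonneg (B 0)).trans (hK 0)
  -- The radius makes K r at most 1/16; using K + 1 keeps the denominator positive when K = 0.
  set r : ℝ := min R (1 / (16 * (K + 1))) with hr
  have hr0 : 0 < r := lt_min hR (by positivity)
  have hKr : 2 * (K * r) ≤ 1 / 8 := by
    have h1 : r ≤ 1 / (16 * (K + 1)) := min_le_right _ _
    rw [le_div_iff₀ (by positivity)] at h1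
    nlinarith
  have hbr : ∀ {y}, y ∈ Metric.ball (0 : E) r → y ∈ Metric.ball (0 : E) R := fun hy =>
    Metric.ball_subset_ball (min_le_left _ _) hy
  have hIB : ∀ y ∈ Metric.ball (0 : E) r, IsIntegrableAt B y := by
    intro y hy v w z
    rw [(hBA y (hbr hy)).2.2, (hBA y (hbr hy)).2.1]
    exact hI _ (hBA y (hbr hy)).1 v w z
  obtain ⟨V, hV0, hV⟩ := exists_solution_of_bounded (hB.of_le (by norm_cast)) hK hKr hIB V₀
  have hVA : ∀ x ∈ Metric.ball x₀ r,
      HasFDerivAt (fun x => V (x - x₀)) ((A x).flip (V (x - x₀))) x := by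
    intro x hxr
    have hx0 : x - x₀ ∈ Metric.ball (0 : E) r := by
      rwa [mem_ball_zero_iff, ← dist_eq_norm]
    have h1 := (hV _ hx0).comp x ((hasFDerivAt_id x).sub_const x₀)
    rw [(hBA _ (hbr hx0)).2.1, add_sub_cancel] at h1
    exact h1
  have hsub : Metric.ball x₀ r ⊆ U := by
    intro x hxr
    have hx0 : x - x₀ ∈ Metric.ball (0 : E) r := by
      rwa [mem_ball_zero_iff, ← dist_eq_norm]
    have := (hBA _ (hbr hx0)).1
    rwa [add_sub_cancel] at this
  refine ⟨Metric.ball x₀ r, Metric.isOpen_ball, Metric.mem_ball_self hr0, hsub,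
    fun x => V (x - x₀), by simp [hV0], ?_, hVA⟩
  exact contDiffOn_of_system Metric.isOpen_ball (hA.mono hsub) hVA

end IntegrableSystemsLocal

/-! ### Projective flatness -/

section CurvatureInCharts

variable {n : ℕ} {M : Type*} [TopologicalSpace M] [ChartedSpace (EuclideanSpace ℝ (Fin n)) M]
  [IsManifold (𝓡 n) ∞ M]

/-- The curvature in the preferred chart around `x`. -/
theorem toCoord_curvature_fromCoord {D : AffineConnection n M} {x y : M}
    (hD : HasSmoothCoeffAt D y) (hy : y ∈ (chartAt (EuclideanSpace ℝ (Fin n)) x).source)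
    (hx : MDifferentiableAt (𝓡 n) 𝓘(ℝ, EuclideanSpace ℝ (Fin n) →L[ℝ] EuclideanSpace ℝ (Fin n)
      →L[ℝ] EuclideanSpace ℝ (Fin n)) (connCoeff D x) y) (u v w : EuclideanSpace ℝ (Fin n)) :
    toCoord x y (curvature D y (fromCoord x y u) (fromCoord x y v) (fromCoord x y w))
      = mvfderiv (𝓡 n) (connCoeff D x) y (fromCoord x y u) w v
        - mvfderiv (𝓡 n) (connCoeff D x) y (fromCoord x y v) w u
        + connCoeff D x y (connCoeff D x y w v) u - connCoeff D x y (connCoeff D x y w u) v := by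
  have hid : ContMDiff (𝓡 n) (𝓡 n) ∞ (fun z : M => z) := contMDiff_id
  have hs : ∀ᶠ z in nhds y, SmoothAlongAt n (fun z : M => z) (coordField x w) z := by
    filter_upwards [eventually_mem_source hy] with z hz
    refine (smoothAlongAt_iff (f := fun z : M => z) hz (hid z)).2 ?_
    refine (contMDiffAt_const (c := w)).congr_of_eventuallyEq ?_
    filter_upwards [eventually_mem_source hz] with z' hz'
    exact toCoord_fromCoord hz' w
  have h := alongDeriv_comm (f := fun z : M => z) hid hD hy hs u v
  have hm : ∀ u : Tan n y, mfderiv (𝓡 n) (𝓡 n) (fun z : M => z) y u = u := fun u =>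
    congrArg (fun L => L u) (mfderiv_id (I := 𝓡 n) (x := y))
  have key : ∀ u v : EuclideanSpace ℝ (Fin n),
      toCoord x y (alongDeriv n D (fun z : M => z) (fun z => alongDeriv n D (fun z : M => z)
        (coordField x w) z (fromCoord x z v)) y (fromCoord x y u))
      = mvfderiv (𝓡 n) (connCoeff D x) y (fromCoord x y u) w v
        + connCoeff D x y (connCoeff D x y w v) u := by
    intro u v
    have hev : ∀ᶠ z in nhds y, alongDeriv n D (fun z : M => z) (coordField x w) z (fromCoord x z v)
        = fromCoord x z (connCoeff D x z w v) := by
      filter_upwards [eventually_mem_source hy] with z hz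
      rw [alongDeriv_id D (vDiffAt_coordField hz w), connCoeff_apply D hz, fromCoord_toCoord hz]
    have hc : (fun z => toCoord x z (fromCoord x z (connCoeff D x z w v))) =ᶠ[nhds y]
        fun z => connCoeff D x z w v := by
      filter_upwards [eventually_mem_source hy] with z hz
      exact toCoord_fromCoord hz _
    have hx1 := (hx.clm_apply (mdifferentiableAt_const (c := w)))
    have hV : VDiffAt (fun z => fromCoord x z (connCoeff D x z w v)) y :=
      (vDiffAt_iff hy).2 ((hx1.clm_apply (mdifferentiableAt_const (c := v))).congr_of_eventuallyEq
        hc)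
    rw [alongDeriv_congr D (f := fun z : M => z) continuousAt_id hev, alongDeriv_id D hV,
      toCoord_connection D hy hV, mvfderiv_congr hc, mvfderiv_clm_const hx1,
      mvfderiv_clm_const hx, toCoord_fromCoord hy, toCoord_fromCoord hy]
  rw [hm, hm] at h
  have h2 := congrArg (toCoord x y) h
  rw [map_sub, key, key] at h2
  refine h2.symm.trans ?_
  abel

theorem contMDiffAt_of_apply₂ {m : ℕ} {V : Type*} [NormedAddCommGroup V] [NormedSpace ℝ V]
    {L : M → EuclideanSpace ℝ (Fin m) →L[ℝ] EuclideanSpace ℝ (Fin m) →L[ℝ] V} {p : M}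
    (h : ∀ w a, ContMDiffAt (𝓡 n) 𝓘(ℝ, V) ∞ (fun z => L z w a) p) :
    ContMDiffAt (𝓡 n) 𝓘(ℝ, EuclideanSpace ℝ (Fin m) →L[ℝ] EuclideanSpace ℝ (Fin m) →L[ℝ] V) ∞
      L p := by
  have h1 : ContMDiffAt (𝓡 n) 𝓘(ℝ, EuclideanSpace ℝ (Fin m) →L[ℝ] EuclideanSpace ℝ (Fin m) →L[ℝ] V)
      ∞ (fun z => clmOfBasis fun i => clmOfBasis fun j =>
        L z (EuclideanSpace.single i (1 : ℝ)) (EuclideanSpace.single j (1 : ℝ))) p :=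
    contMDiffAt_clmOfBasis fun i => contMDiffAt_clmOfBasis fun j => h _ _
  refine h1.congr_of_eventuallyEq (Filter.Eventually.of_forall fun z => ?_)
  ext1 w
  beta_reduce
  rw [show (fun i => clmOfBasis fun j => L z (EuclideanSpace.single i (1 : ℝ))
      (EuclideanSpace.single j (1 : ℝ))) = fun i => L z (EuclideanSpace.single i (1 : ℝ)) from ?_]
  · exact (clmOfBasis_eq (fun w => L z w) (fun a b => map_add _ _ _) (fun r a => map_smul _ _ _)
      w).symm
  · funext i
    ext1 a
    exact clmOfBasis_eq (fun a => L z (EuclideanSpace.single i (1 : ℝ)) a)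
      (fun a b => map_add _ _ _) (fun r a => map_smul _ _ _) a

end CurvatureInCharts

/-! ### The equation ∇dφ = -c φ h as an integrable first-order system -/

section HessianSystem

variable {E : Type*} [NormedAddCommGroup E] [NormedSpace ℝ E] [FiniteDimensional ℝ E]

/-- Pairs of a value and a differential. -/
def HessJet (E : Type*) [NormedAddCommGroup E] [NormedSpace ℝ E] : Type _ := ℝ × (E →L[ℝ] ℝ)

instance : NormedAddCommGroup (HessJet E) := inferInstanceAs (NormedAddCommGroup (ℝ × (E →L[ℝ] ℝ)))

instance : NormedSpace ℝ (HessJet E) := inferInstanceAs (NormedSpace ℝ (ℝ × (E →L[ℝ] ℝ)))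

instance : FiniteDimensional ℝ (HessJet E) :=
  inferInstanceAs (FiniteDimensional ℝ (ℝ × (E →L[ℝ] ℝ)))

/-- The value of a pair. -/
def HessJet.value : HessJet E →L[ℝ] ℝ := ContinuousLinearMap.fst ℝ ℝ (E →L[ℝ] ℝ)

/-- The differential of a pair. -/
def HessJet.diff : HessJet E →L[ℝ] E →L[ℝ] ℝ := ContinuousLinearMap.snd ℝ ℝ (E →L[ℝ] ℝ)

/-- The pair with given value and differential. -/
def HessJet.mk (r : ℝ) (l : E →L[ℝ] ℝ) : HessJet E := (r, l)

theorem HessJet.value_mk (r : ℝ) (l : E →L[ℝ] ℝ) : HessJet.value (HessJet.mk r l) = r := rfl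

theorem HessJet.diff_mk (r : ℝ) (l : E →L[ℝ] ℝ) : HessJet.diff (HessJet.mk r l) = l := rfl

theorem HessJet.ext {z z' : HessJet E} (h : z.value = z'.value) (h' : ∀ k, z.diff k = z'.diff k) :
    z = z' :=
  Prod.ext h (ContinuousLinearMap.ext h')

theorem HessJet.contDiffOn_mk {r : E → ℝ} {l : E → E →L[ℝ] ℝ} {U : Set E}
    (hr : ContDiffOn ℝ ∞ r U) (hl : ContDiffOn ℝ ∞ l U) :
    ContDiffOn ℝ ∞ (fun q => HessJet.mk (r q) (l q)) U :=
  hr.prodMk hl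

/-- The first-order system for a function `φ` with Hessian `-c φ H`, in terms of the pair of `φ`
and its differential. -/
def hessSystem (Γ : E →L[ℝ] E →L[ℝ] E) (H : E →L[ℝ] E →L[ℝ] ℝ) (c : ℝ) :
    E →L[ℝ] HessJet E →L[ℝ] HessJet E :=
  LinearMap.toContinuousLinearMap
    { toFun := fun a => LinearMap.toContinuousLinearMap
        { toFun := fun z => HessJet.mk (z.diff a) (z.diff.comp (Γ.flip a) - (c * z.value) • H a)
          map_add' := by
            intro z z'
            refine HessJet.ext ?_ fun k => ?_
            · simp [HessJet.value_mk]
            · simp [HessJet.diff_mk]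
              ring
          map_smul' := by
            intro r z
            refine HessJet.ext ?_ fun k => ?_
            · simp [HessJet.value_mk]
            · simp [HessJet.diff_mk]
              ring }
      map_add' := by
        intro a a'
        ext1 z
        refine HessJet.ext ?_ fun k => ?_
        · simp [HessJet.value_mk]
        · simp [HessJet.diff_mk]
          ring
      map_smul' := by
        intro r a
        ext1 z
        refine HessJet.ext ?_ fun k => ?_
        · simp [HessJet.value_mk]
        · simp [HessJet.diff_mk]
          ring }

theorem value_hessSystem (Γ : E →L[ℝ] E →L[ℝ] E) (H : E →L[ℝ] E →L[ℝ] ℝ) (c : ℝ) (a : E)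
    (z : HessJet E) : (hessSystem Γ H c a z).value = z.diff a := rfl

theorem diff_hessSystem (Γ : E →L[ℝ] E →L[ℝ] E) (H : E →L[ℝ] E →L[ℝ] ℝ) (c : ℝ) (a : E)
    (z : HessJet E) (k : E) :
    (hessSystem Γ H c a z).diff k = z.diff (Γ k a) - c * z.value * H a k := rfl

theorem contDiffOn_hessSystem {Γ : E → E →L[ℝ] E →L[ℝ] E} {H : E → E →L[ℝ] E →L[ℝ] ℝ} {c : ℝ}
    {U : Set E} (hΓ : ContDiffOn ℝ ∞ Γ U) (hH : ContDiffOn ℝ ∞ H U) :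
    ContDiffOn ℝ ∞ (fun q => hessSystem (Γ q) (H q) c) U := by
  refine contDiffOn_clm_apply.2 fun a => contDiffOn_clm_apply.2 fun z => ?_
  have h1 : ContDiffOn ℝ ∞ (fun q => (hessSystem (Γ q) (H q) c a z).diff) U := by
    refine contDiffOn_clm_apply.2 fun k => ?_
    simp only [diff_hessSystem]
    exact (z.diff.contDiff.comp_contDiffOn ((hΓ.clm_apply contDiffOn_const).clm_apply
      contDiffOn_const)).sub (contDiffOn_const.mul ((hH.clm_apply contDiffOn_const).clm_apply
        contDiffOn_const))
  exact HessJet.contDiffOn_mk (contDiffOn_const (c := z.diff a)) h1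

theorem clm_fderiv_apply {G G' : Type*} [NormedAddCommGroup G] [NormedSpace ℝ G]
    [NormedAddCommGroup G'] [NormedSpace ℝ G'] (L : G →L[ℝ] G') {f : E → G} {q : E}
    (hf : DifferentiableAt ℝ f q) (v : E) :
    L (fderiv ℝ f q v) = fderiv ℝ (fun q => L (f q)) q v :=
  (congrArg (fun T => T v) (L.hasFDerivAt.comp q hf.hasFDerivAt).fderiv).symm

/-- Differentiating ∇dφ = -c φ h once more, equality of mixed derivatives asks for three things:
symmetry of Γ and H in the value component, and in the differential component the constant curvature
formula together with the Codazzi equation weighted by c φ. -/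
theorem isIntegrableAt_hessSystem {Γ : E → E →L[ℝ] E →L[ℝ] E} {H : E → E →L[ℝ] E →L[ℝ] ℝ} {c : ℝ}
    {U : Set E} (hU : IsOpen U) (hΓ : ContDiffOn ℝ ∞ Γ U) (hH : ContDiffOn ℝ ∞ H U) {q : E}
    (hq : q ∈ U) (hΓs : ∀ v w, Γ q v w = Γ q w v) (hHs : ∀ v w, H q v w = H q w v)
    (hR : ∀ u v w, fderiv ℝ Γ q u w v - fderiv ℝ Γ q v w u + Γ q (Γ q w v) u - Γ q (Γ q w u) v
      = c • (H q v w • u - H q u w • v))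
    (hC : ∀ u v w, fderiv ℝ H q u v w - H q v (Γ q w u) = fderiv ℝ H q v u w - H q u (Γ q w v)) :
    IsIntegrableAt (fun q => hessSystem (Γ q) (H q) c) q := by
  have hS : DifferentiableAt ℝ (fun q => hessSystem (Γ q) (H q) c) q :=
    ((contDiffOn_hessSystem hΓ hH).contDiffAt (hU.mem_nhds hq)).differentiableAt (by simp)
  have hΓ' : DifferentiableAt ℝ Γ q := (hΓ.contDiffAt (hU.mem_nhds hq)).differentiableAt (by simp)
  have hH' : DifferentiableAt ℝ H q := (hH.contDiffAt (hU.mem_nhds hq)).differentiableAt (by simp)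
  have hSw : ∀ w, DifferentiableAt ℝ (fun q => hessSystem (Γ q) (H q) c w) q := fun w =>
    hS.clm_apply (differentiableAt_const w)
  have hSz : ∀ w z, DifferentiableAt ℝ (fun q => hessSystem (Γ q) (H q) c w z) q := fun w z =>
    (hSw w).clm_apply (differentiableAt_const z)
  have hd : ∀ v w z, fderiv ℝ (fun q => hessSystem (Γ q) (H q) c) q v w z
      = fderiv ℝ (fun q => hessSystem (Γ q) (H q) c w z) q v := by
    intro v w z
    rw [fderiv_clm_const_apply (hSw w), fderiv_clm_const_apply hS]
  have hd1 : ∀ v w z, (fderiv ℝ (fun q => hessSystem (Γ q) (H q) c) q v w z).value = 0 := by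
    intro v w z
    rw [hd]
    refine (clm_fderiv_apply HessJet.value (hSz w z) v).trans ?_
    have : (fun q => HessJet.value (hessSystem (Γ q) (H q) c w z))
        = fun _ => z.diff w := rfl
    rw [this]
    simp
  have hd2 : ∀ v w z k, (fderiv ℝ (fun q => hessSystem (Γ q) (H q) c) q v w z).diff k
      = z.diff (fderiv ℝ Γ q v k w) - c * z.value * fderiv ℝ H q v w k := by
    intro v w z k
    rw [hd]
    have hΓk : DifferentiableAt ℝ (fun q => Γ q k) q := hΓ'.clm_apply (differentiableAt_const k)
    have hΓkw : DifferentiableAt ℝ (fun q => Γ q k w) q := hΓk.clm_apply (differentiableAt_const w)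
    have hHw : DifferentiableAt ℝ (fun q => H q w) q := hH'.clm_apply (differentiableAt_const w)
    have hHwk : DifferentiableAt ℝ (fun q => H q w k) q := hHw.clm_apply (differentiableAt_const k)
    refine (clm_fderiv_apply ((ContinuousLinearMap.apply ℝ ℝ k).comp
      HessJet.diff) (hSz w z) v).trans ?_
    have e : (fun q => ((ContinuousLinearMap.apply ℝ ℝ k).comp
        HessJet.diff) (hessSystem (Γ q) (H q) c w z))
        = fun q => z.diff (Γ q k w) - c * z.value * H q w k := rfl
    have h1 := (z.diff.hasFDerivAt.comp q hΓkw.hasFDerivAt).sub (hHwk.hasFDerivAt.const_mul (c * z.value))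
    rw [e]
    refine (congrArg (fun T => T v) h1.fderiv).trans ?_
    rw [← fderiv_clm_const_apply hΓ' k v, ← fderiv_clm_const_apply hΓk w v,
      ← fderiv_clm_const_apply hH' w v, ← fderiv_clm_const_apply hHw k v]
    rfl
  intro v w z
  refine HessJet.ext ?_ fun k => ?_
  · simp only [map_add, hd1, zero_add, value_hessSystem, diff_hessSystem]
    rw [hΓs w v, hHs v w]
  -- The differential z.diff sees the curvature of Γ, whose value h1 is cancelled by the terms c H
  -- z.diff; the part proportional to z.value is the Codazzi equation h2.
  · have h1 := congrArg z.diff (hR v w k)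
    have h2 := hC v w k
    have h3 := hHs v (Γ q k w)
    simp only [map_add, add_apply, hd2, value_hessSystem, diff_hessSystem]
    simp only [map_sub, map_add, map_smul, smul_eq_mul] at h1
    linear_combination h1 - c * z.value * h2

/-- The logarithmic derivative of a solution of the Hessian system. -/
theorem exists_projective_factor {Γ : E → E →L[ℝ] E →L[ℝ] E} {H : E → E →L[ℝ] E →L[ℝ] ℝ} {c : ℝ}
    {U : Set E} (hU : IsOpen U) {q₀ : E} (hq₀ : q₀ ∈ U) (hΓ : ContDiffOn ℝ ∞ Γ U)
    (hH : ContDiffOn ℝ ∞ H U)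
    (hI : ∀ q ∈ U, IsIntegrableAt (fun q => hessSystem (Γ q) (H q) c) q) :
    ∃ W : Set E, IsOpen W ∧ q₀ ∈ W ∧ W ⊆ U ∧ ∃ s : E → E →L[ℝ] ℝ, ContDiffOn ℝ ∞ s W ∧
      ∀ q ∈ W, ∀ a w, fderiv ℝ s q a w = s q (Γ q w a) + c * H q a w + s q a * s q w := by
  -- The initial value 1 for φ keeps φ nonzero near q₀, so its logarithmic derivative makes sense;
  -- the initial differential is immaterial and taken to be zero.
  obtain ⟨W, hW, hqW, hWU, V, hV0, hVs, hV⟩ := exists_local_solution hU hq₀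
    (contDiffOn_hessSystem hΓ hH) hI (HessJet.mk 1 0)
  set W' : Set E := W ∩ {q | (V q).value ≠ 0} with hW'
  have hW'o : IsOpen W' := by
    have h1 : ContinuousOn (fun q => (V q).value) W := HessJet.value.continuous.comp_continuousOn hVs.continuousOn
    exact h1.isOpen_inter_preimage hW isOpen_ne
  have hfst : ContDiffOn ℝ ∞ (fun q => (V q).value) W' :=
    HessJet.value.contDiff.comp_contDiffOn (hVs.mono Set.inter_subset_left)
  have hsnd : ContDiffOn ℝ ∞ (fun q => (V q).diff) W' :=
    HessJet.diff.contDiff.comp_contDiffOn (hVs.mono Set.inter_subset_left)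
  have hs : ContDiffOn ℝ ∞ (fun q => -((V q).value⁻¹ • (V q).diff)) W' :=
    ((hfst.inv fun q hq => hq.2).smul hsnd).neg
  refine ⟨W', hW'o, ⟨hqW, by simp [hV0, HessJet.value_mk]⟩, Set.inter_subset_left.trans hWU,
    fun q => -((V q).value⁻¹ • (V q).diff), hs, fun q hq a w => ?_⟩
  have hsd : DifferentiableAt ℝ (fun q => -((V q).value⁻¹ • (V q).diff)) q :=
    (hs.contDiffAt (hW'o.mem_nhds hq)).differentiableAt (by simp)
  have hne : (V q).value ≠ 0 := hq.2
  have hVq := hV q hq.1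
  have hd1 : HasFDerivAt (fun q => (V q).value) ((V q).diff) q := by
    refine ((HessJet.value.hasFDerivAt).comp q hVq).congr_fderiv ?_
    ext v
    rfl
  have hd2 : fderiv ℝ (fun q => (V q).diff w) q a = (V q).diff (Γ q w a) - c * (V q).value * H q a w := by
    have h1 := clm_fderiv_apply ((ContinuousLinearMap.apply ℝ ℝ w).comp
      HessJet.diff) hVq.differentiableAt a
    refine h1.symm.trans ?_
    rw [hVq.fderiv]
    rfl
  have hsw : DifferentiableAt ℝ (fun q => (-((V q).value⁻¹ • (V q).diff)) w) q :=
    hsd.clm_apply (differentiableAt_const w)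
  have hmul := hsw.hasFDerivAt.mul hd1
  -- Differentiating s φ = -dφ rather than the quotient itself avoids the derivative of the inverse.
  have hev : (fun q => (-((V q).value⁻¹ • (V q).diff)) w) * (fun q => (V q).value) =ᶠ[nhds q]
      fun q => -((V q).diff w) := by
    filter_upwards [hW'o.mem_nhds hq] with r hr
    have hr' : (V r).value ≠ 0 := hr.2
    simp only [Pi.mul_apply, neg_apply, smul_apply, smul_eq_mul]
    field_simp
  have h2 := congrArg (fun T => T a) hmul.fderiv
  rw [hev.fderiv_eq, fderiv_fun_neg] at h2
  rw [← fderiv_clm_const_apply hsd w a]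
  simp only [neg_apply, add_apply, smul_apply, smul_eq_mul, hd2] at h2 ⊢
  field_simp at h2 ⊢
  linear_combination -h2

end HessianSystem

/-! ### Curvature under a projective change of connection -/

section ProjectiveChange

variable {E : Type*} [NormedAddCommGroup E] [NormedSpace ℝ E] [FiniteDimensional ℝ E]

theorem fderiv_projective_change {Γ Γ' : E → E →L[ℝ] E →L[ℝ] E} {s : E → E →L[ℝ] ℝ} {q : E}
    (hΓ : DifferentiableAt ℝ Γ q) (hΓ' : DifferentiableAt ℝ Γ' q) (hs : DifferentiableAt ℝ s q)
    (h : ∀ᶠ r in nhds q, ∀ w a, Γ' r w a = Γ r w a + (s r a • w + s r w • a)) (u w v : E) :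
    fderiv ℝ Γ' q u w v = fderiv ℝ Γ q u w v + (fderiv ℝ s q u v • w + fderiv ℝ s q u w • v) := by
  have hw : DifferentiableAt ℝ (fun r => Γ r w) q := hΓ.clm_apply (differentiableAt_const w)
  have hw' : DifferentiableAt ℝ (fun r => Γ' r w) q := hΓ'.clm_apply (differentiableAt_const w)
  have hwv : DifferentiableAt ℝ (fun r => Γ r w v) q := hw.clm_apply (differentiableAt_const v)
  have hsw : DifferentiableAt ℝ (fun r => s r w) q := hs.clm_apply (differentiableAt_const w)
  have hsv : DifferentiableAt ℝ (fun r => s r v) q := hs.clm_apply (differentiableAt_const v)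
  rw [← fderiv_clm_const_apply hΓ' w u, ← fderiv_clm_const_apply hw' v u,
    ← fderiv_clm_const_apply hΓ w u, ← fderiv_clm_const_apply hw v u,
    ← fderiv_clm_const_apply hs v u, ← fderiv_clm_const_apply hs w u]
  have he : (fun r => Γ' r w v) =ᶠ[nhds q] fun r => Γ r w v + (s r v • w + s r w • v) := by
    filter_upwards [h] with r hr
    exact hr w v
  have h1 := hwv.hasFDerivAt.add ((hsv.hasFDerivAt.smul_const w).add (hsw.hasFDerivAt.smul_const v))
  rw [he.fderiv_eq]
  exact congrArg (fun T => T u) h1.fderiv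

/-- A projective change by s alters the curvature through ∇s - s ⊗ s. When this tensor equals c H,
the change removes exactly the constant curvature term, and its symmetry leaves no trace part
behind. -/
theorem projective_change_flat {Γ Γ' : E → E →L[ℝ] E →L[ℝ] E} {H : E →L[ℝ] E →L[ℝ] ℝ} {c : ℝ}
    {s : E → E →L[ℝ] ℝ} {q : E}
    (hΓ : DifferentiableAt ℝ Γ q) (hΓ' : DifferentiableAt ℝ Γ' q) (hs : DifferentiableAt ℝ s q)
    (h : ∀ᶠ r in nhds q, ∀ w a, Γ' r w a = Γ r w a + (s r a • w + s r w • a))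
    (hΓs : ∀ v w, Γ q v w = Γ q w v) (hHs : ∀ v w, H v w = H w v)
    (hds : ∀ a w, fderiv ℝ s q a w = s q (Γ q w a) + c * H a w + s q a * s q w)
    (hR : ∀ u v w, fderiv ℝ Γ q u w v - fderiv ℝ Γ q v w u + Γ q (Γ q w v) u - Γ q (Γ q w u) v
      = c • (H v w • u - H u w • v)) (u v w : E) :
    fderiv ℝ Γ' q u w v - fderiv ℝ Γ' q v w u + Γ' q (Γ' q w v) u - Γ' q (Γ' q w u) v = 0 := by
  have hq := h.self_of_nhds
  rw [fderiv_projective_change hΓ hΓ' hs h, fderiv_projective_change hΓ hΓ' hs h]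
  simp only [hq, hds, map_add, map_smul, add_apply, smul_apply]
  rw [hΓs v u, hHs v u]
  have h1 := hR u v w
  have e : fderiv ℝ Γ q u w v = fderiv ℝ Γ q v w u - Γ q (Γ q w v) u + Γ q (Γ q w u) v
      + c • (H v w • u - H u w • v) := by
    rw [← h1]; abel
  rw [e]
  module

end ProjectiveChange

/-! ### Constant curvature and Codazzi imply local projective flatness -/

section ProjectivelyFlat

variable {n : ℕ} {M : Type*} [TopologicalSpace M] [ChartedSpace (EuclideanSpace ℝ (Fin n)) M]
  [IsManifold (𝓡 n) ∞ M]

/-- The bilinear map `(w, v) ↦ l(v) w + l(w) v`. -/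
def projTensor {x : M} (l : Tan n x →L[ℝ] ℝ) : Tan n x →L[ℝ] Tan n x →L[ℝ] Tan n x :=
  LinearMap.toContinuousLinearMap
    { toFun := fun w => l.smulRight w + l w • ContinuousLinearMap.id ℝ (Tan n x)
      map_add' := by
        intro w w'
        ext1 v
        simp only [add_apply, ContinuousLinearMap.smulRight_apply, smul_apply, map_add,
          ContinuousLinearMap.id_apply]
        module
      map_smul' := by
        intro r w
        ext1 v
        simp only [add_apply, ContinuousLinearMap.smulRight_apply, smul_apply, map_smul,
          ContinuousLinearMap.id_apply, RingHom.id_apply, smul_eq_mul]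
        module }

theorem projTensor_apply {x : M} (l : Tan n x →L[ℝ] ℝ) (w v : Tan n x) :
    projTensor l w v = l v • w + l w • v := rfl

theorem projEquivOn_addOneForm_projTensor (D : AffineConnection n M)
    (σ : Π x : M, Tan n x →L[ℝ] ℝ) (U : Set M) :
    ProjEquivOn D (D.addOneForm fun x => projTensor (σ x)) U := by
  refine ⟨σ, fun x _ u v => ?_⟩
  simp only [diffTensor, addOneForm_extendVec, projTensor_apply]
  module

theorem connCoeff_addOneForm_projTensor (D : AffineConnection n M) (σ : Π x : M, Tan n x →L[ℝ] ℝ)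
    {p z : M} (hz : z ∈ (chartAt (EuclideanSpace ℝ (Fin n)) p).source)
    (w a : EuclideanSpace ℝ (Fin n)) :
    connCoeff (D.addOneForm fun x => projTensor (σ x)) p z w a = connCoeff D p z w a
      + (σ z (fromCoord p z a) • w + σ z (fromCoord p z w) • a) := by
  have h : (D.addOneForm fun x => projTensor (σ x)) (coordField p w) z
      = D (coordField p w) z + projTensor (σ z) (fromCoord p z w) := rfl
  rw [connCoeff_apply _ hz, connCoeff_apply _ hz, h, add_apply, projTensor_apply, map_add, map_add,
    map_smul, map_smul, toCoord_fromCoord hz, toCoord_fromCoord hz]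

/-- The one-form s lives in the chart around x, while smoothness is wanted in the chart around p;
the transition matrix carries it over. -/
theorem contMDiffAt_connCoeff_projective {D : AffineConnection n M} (hD : HasSmoothCoeff D)
    {x : M} {s : EuclideanSpace ℝ (Fin n) → EuclideanSpace ℝ (Fin n) →L[ℝ] ℝ} {y p : M}
    (hy : y ∈ (chartAt (EuclideanSpace ℝ (Fin n)) x).source)
    (hp : y ∈ (chartAt (EuclideanSpace ℝ (Fin n)) p).source)
    (hs : ContDiffAt ℝ ∞ s (extChartAt (𝓡 n) x y)) :
    ContMDiffAt (𝓡 n) 𝓘(ℝ, EuclideanSpace ℝ (Fin n) →L[ℝ] EuclideanSpace ℝ (Fin n) →L[ℝ]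
      EuclideanSpace ℝ (Fin n)) ∞ (connCoeff (D.addOneForm fun z =>
        projTensor ((s (extChartAt (𝓡 n) x z)).comp (toCoord x z))) p) y := by
  refine contMDiffAt_of_apply₂ fun w a => ?_
  have hsm : ContMDiffAt (𝓡 n) 𝓘(ℝ, EuclideanSpace ℝ (Fin n) →L[ℝ] ℝ) ∞
      (fun z => s (extChartAt (𝓡 n) x z)) y := contMDiffAt_comp_extChartAt le_rfl hy hs
  have ht : ∀ b : EuclideanSpace ℝ (Fin n), ContMDiffAt (𝓡 n) 𝓘(ℝ, ℝ) ∞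
      (fun z => s (extChartAt (𝓡 n) x z) (coordChange p x z b)) y := fun b =>
    hsm.clm_apply ((contMDiffAt_coordChange hp hy).clm_apply contMDiffAt_const)
  have hc : ContMDiffAt (𝓡 n) 𝓘(ℝ, EuclideanSpace ℝ (Fin n)) ∞ (fun z => connCoeff D p z w a) y := by
    have h1 : ContMDiffAt (𝓡 n) 𝓘(ℝ, EuclideanSpace ℝ (Fin n) →L[ℝ] EuclideanSpace ℝ (Fin n)) ∞
      (fun z => connCoeff D p z w) y := (hD p y hp).clm_apply contMDiffAt_const
    exact h1.clm_apply contMDiffAt_const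
  refine (hc.add (((ht a).smul (contMDiffAt_const (c := w))).add
    ((ht w).smul (contMDiffAt_const (c := a))))).congr_of_eventuallyEq ?_
  filter_upwards [eventually_mem_source hp] with z hz
  exact connCoeff_addOneForm_projTensor D _ hz w a

theorem symm_mem_source_of_mem_target {x : M} {q : EuclideanSpace ℝ (Fin n)}
    (hq : q ∈ (extChartAt (𝓡 n) x).target) :
    (extChartAt (𝓡 n) x).symm q ∈ (chartAt (EuclideanSpace ℝ (Fin n)) x).source := by
  rw [← extChartAt_source (𝓡 n)]
  exact (extChartAt (𝓡 n) x).map_target hq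

theorem contDiffOn_inChart {V : Type*} [NormedAddCommGroup V] [NormedSpace ℝ V] {x : M} {g : M → V}
    (hg : ∀ y ∈ (chartAt (EuclideanSpace ℝ (Fin n)) x).source, ContMDiffAt (𝓡 n) 𝓘(ℝ, V) ∞ g y) :
    ContDiffOn ℝ ∞ (inChart x g) (extChartAt (𝓡 n) x).target := by
  intro q hq
  have h := contDiffAt_inChart le_rfl (symm_mem_source_of_mem_target hq)
    (hg _ (symm_mem_source_of_mem_target hq))
  rw [(extChartAt (𝓡 n) x).right_inv hq] at h
  exact h.contDiffWithinAt

-- In the chart around x the curvature and Codazzi hypotheses make the Hessian system integrable.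
-- The logarithmic derivative of a nonvanishing solution then defines the projective change to a
-- flat connection.
set_option synthInstance.maxHeartbeats 200000 in
set_option maxHeartbeats 1000000 in
theorem exists_flat_of_isCodazzi {D : AffineConnection n M} {h : PseudoRiemannianMetric n M} {c : ℝ}
    (hD : HasSmoothCoeff D) (ht : D.torsion = 0) (hC : IsCodazzi D h)
    (hR : ∀ (x : M) (u v w : Tan n x),
      curvature D x u v w = c • (h.inner x v w • u - h.inner x u w • v)) (x : M) :
    ∃ U : Set M, IsOpen U ∧ x ∈ U ∧ ∃ D', IsFlatOn D' U ∧ ProjEquivOn D D' U := by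
  set T : Set (EuclideanSpace ℝ (Fin n)) := (extChartAt (𝓡 n) x).target with hT
  have hTo : IsOpen T := isOpen_extChartAt_target (I := 𝓡 n) x
  set Γ := inChart (n := n) x (connCoeff D x) with hΓdef
  set H := inChart (n := n) x (formCoord h x) with hHdef
  have hΓ : ContDiffOn ℝ ∞ Γ T := contDiffOn_inChart fun y hy => hD x y hy
  have hH : ContDiffOn ℝ ∞ H T := contDiffOn_inChart fun y hy => contMDiffAt_formCoord h hy
  have hΓs : ∀ q ∈ T, ∀ v w, Γ q v w = Γ q w v := fun q hq v w =>
    connCoeff_comm ht (symm_mem_source_of_mem_target hq) v w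
  have hHs : ∀ q, ∀ v w : EuclideanSpace ℝ (Fin n), H q v w = H q w v := fun q v w => formCoord_symm h x _ v w
  have hmd : ∀ y ∈ (chartAt (EuclideanSpace ℝ (Fin n)) x).source, MDifferentiableAt (𝓡 n)
      𝓘(ℝ, EuclideanSpace ℝ (Fin n) →L[ℝ] EuclideanSpace ℝ (Fin n) →L[ℝ]
      EuclideanSpace ℝ (Fin n)) (connCoeff D x) y := fun y hy =>
    (hD x y hy).mdifferentiableAt (by simp)
  have hcurv : ∀ q ∈ T, ∀ u v w,
      fderiv ℝ Γ q u w v - fderiv ℝ Γ q v w u + Γ q (Γ q w v) u - Γ q (Γ q w u) v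
        = c • (H q v w • u - H q u w • v) := by
    intro q hq u v w
    have hy := symm_mem_source_of_mem_target hq
    have h1 := toCoord_curvature_fromCoord (hD.hasSmoothCoeffAt _) hy (hmd _ hy) u v w
    rw [hR, map_smul, map_sub, map_smul, map_smul, toCoord_fromCoord hy, toCoord_fromCoord hy,
      mvfderiv_fromCoord hy (hmd _ hy), mvfderiv_fromCoord hy (hmd _ hy),
      (extChartAt (𝓡 n) x).right_inv hq] at h1
    rw [← formCoord_apply, ← formCoord_apply] at h1
    exact h1.symm
  have hcod : ∀ q ∈ T, ∀ u v w, fderiv ℝ H q u v w - H q v (Γ q w u)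
      = fderiv ℝ H q v u w - H q u (Γ q w v) := by
    intro q hq u v w
    have hy := symm_mem_source_of_mem_target hq
    have h1 := hC x _ hy u v w
    rw [mvfderiv_fromCoord hy (mdifferentiableAt_formCoord h hy),
      mvfderiv_fromCoord hy (mdifferentiableAt_formCoord h hy),
      (extChartAt (𝓡 n) x).right_inv hq] at h1
    exact h1
  obtain ⟨W, hWo, hxW, hWT, s, hs, hds⟩ := exists_projective_factor hTo
    (mem_extChartAt_target (I := 𝓡 n) x) hΓ hH (c := c) fun q hq =>
      isIntegrableAt_hessSystem hTo hΓ hH hq (hΓs q hq) (hHs q) (hcurv q hq) (hcod q hq)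
  -- The connection is defined on all of M, but the one-form is meaningful only over W inside the
  -- chart; smoothness and flatness are claimed only on U.
  set D' : AffineConnection n M := D.addOneForm fun z =>
    projTensor ((s (extChartAt (𝓡 n) x z)).comp (toCoord x z)) with hD'
  set U : Set M := (chartAt (EuclideanSpace ℝ (Fin n)) x).source ∩ extChartAt (𝓡 n) x ⁻¹' W with hU
  have hUo : IsOpen U := isOpen_extChartAt_preimage x hWo
  have hsm : ∀ y ∈ U, ∀ p : M, y ∈ (chartAt (EuclideanSpace ℝ (Fin n)) p).source →
      ContMDiffAt (𝓡 n) 𝓘(ℝ, EuclideanSpace ℝ (Fin n) →L[ℝ] EuclideanSpace ℝ (Fin n) →L[ℝ]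
      EuclideanSpace ℝ (Fin n)) ∞ (connCoeff D' p) y := fun y hy p hp =>
    contMDiffAt_connCoeff_projective hD hy.1 hp (hs.contDiffAt (hWo.mem_nhds hy.2))
  have hsm' : ∀ y ∈ U, HasSmoothCoeffAt D' y := fun y hy => hsm y hy y (mem_source_self (n := n) y)
  refine ⟨U, hUo, ⟨mem_source_self (n := n) x, hxW⟩, D', ⟨?_, ?_, ?_⟩,
    projEquivOn_addOneForm_projTensor D _ U⟩
  · exact contMDiffCovariantDerivativeOn_of_connCoeff hUo hsm'
  · intro y hy
    refine torsion_eq_zero_at fun u v => ?_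
    rw [hD', addOneForm_extendVec, addOneForm_extendVec, connection_extendVec_comm ht,
      projTensor_apply, projTensor_apply, add_comm (_ • v)]
  · intro y hy u v w
    have hys : y ∈ (chartAt (EuclideanSpace ℝ (Fin n)) x).source := hy.1
    set q := extChartAt (𝓡 n) x y with hq
    have hqW : q ∈ W := hy.2
    have hqT : q ∈ T := hWT hqW
    have hmd' := (hsm y hy x hys).mdifferentiableAt (by simp)
    have hev : ∀ᶠ r in nhds q, ∀ w a, inChart (n := n) x (connCoeff D' x) r w a
        = Γ r w a + (s r a • w + s r w • a) := by
      filter_upwards [hTo.mem_nhds hqT] with r hr w a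
      have hz := symm_mem_source_of_mem_target hr
      have h1 := connCoeff_addOneForm_projTensor D
        (fun z => (s (extChartAt (𝓡 n) x z)).comp (toCoord x z)) hz w a
      rw [ContinuousLinearMap.comp_apply, ContinuousLinearMap.comp_apply, toCoord_fromCoord hz,
        toCoord_fromCoord hz, (extChartAt (𝓡 n) x).right_inv hr] at h1
      exact h1
    have h0 := projective_change_flat (Γ := Γ) (Γ' := inChart (n := n) x (connCoeff D' x)) (H := H q) (c := c)
      (s := s) (q := q) (differentiableAt_inChart hys (hmd y hys))
      (differentiableAt_inChart hys hmd')
      ((hs.contDiffAt (hWo.mem_nhds hqW)).differentiableAt (by simp)) hev (hΓs q hqT) (hHs q)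
      (hds q hqW) (hcurv q hqT) (toCoord x y u) (toCoord x y v) (toCoord x y w)
    have h1 := toCoord_curvature_fromCoord (hsm' y hy) hys hmd' (toCoord x y u) (toCoord x y v)
      (toCoord x y w)
    rw [fromCoord_toCoord hys, fromCoord_toCoord hys, fromCoord_toCoord hys,
      mvfderiv_eq_fderiv_toCoord hys hmd', mvfderiv_eq_fderiv_toCoord hys hmd',
      ← inChart_apply hys (connCoeff D' x)] at h1
    refine toCoord_injective hys ?_
    rw [map_zero]
    exact h1.trans h0

end ProjectivelyFlat

/-! ### Lagrangian immersions into para-complex space forms -/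

section SpaceForms

variable {n d : ℕ} {M : Type*} [TopologicalSpace M] [ChartedSpace (EuclideanSpace ℝ (Fin n)) M]
  [IsManifold (𝓡 n) ∞ M]
  {N : Type*} [TopologicalSpace N] [ChartedSpace (EuclideanSpace ℝ (Fin d)) N]
  [IsManifold (𝓡 d) ∞ N]
  {g : PseudoRiemannianMetric d N} {D : AffineConnection d N}
  {A : Π p : N, Tan d p →L[ℝ] Tan d p} {c : ℝ} {f : M → N} {h : PseudoRiemannianMetric n M}
  {D' : AffineConnection n M}

theorem endoCoord_neg (A : Π p : N, Tan d p →L[ℝ] Tan d p) (p : N) :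
    endoCoord (fun q => -A q) p = -endoCoord A p := by
  funext q
  ext1 v
  exact map_neg (toCoord p q) _

theorem IsSmoothEndo.neg (hA : IsSmoothEndo A) : IsSmoothEndo fun p => -A p := by
  intro p
  rw [endoCoord_neg]
  exact (hA p).neg

theorem IsParallelEndo.neg (hP : IsParallelEndo D A) :
    IsParallelEndo D fun p => -A p := by
  intro p a w
  have h0 := hP p a w
  unfold endoDeriv at h0 ⊢
  have h1 : mvfderiv (𝓡 d) (-endoCoord A p) p = -mvfderiv (𝓡 d) (endoCoord A p) p :=
    mvfderiv_neg
  rw [endoCoord_neg, h1]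
  simp only [Pi.neg_apply, neg_apply, map_neg]
  rw [← neg_zero, ← h0]
  abel

/-- Every term of the curvature contains A an even number of times, and the remaining conditions are
insensitive to its sign. Passing to -A exchanges T⁺ and T⁻, which is how conjugation is handled. -/
theorem IsParaComplexSpaceForm.neg (hK : IsParaComplexSpaceForm g D A c) :
    IsParaComplexSpaceForm g D (fun p => -A p) c where
  metric := hK.metric
  torsion := hK.torsion
  smooth := hK.smooth.neg
  parallel := hK.parallel.neg
  sq p v := by simp [hK.sq]
  skew p v w := by simp [hK.skew p v w]
  curv p u v w := by
    rw [hK.curv]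
    simp only [neg_apply, map_neg, neg_smul, smul_neg, neg_neg, mul_neg]

theorem IsLagrangian.neg (hL : IsLagrangian g A f h) : IsLagrangian g (fun p => -A p) f h where
  smooth := hL.smooth
  isometric := hL.isometric
  isotropic x v w := by simp [hL.isotropic x v w]
  spanning x p h1 h2 := hL.spanning x p h1 fun z => by simpa using h2 z

theorem ParaKahlerStructure.isParaComplexSpaceForm (K : ParaKahlerStructure d N)
    (hK : K.HasConstantParaHolomorphicSectionalCurvature (4 * c)) :
    IsParaComplexSpaceForm K.G K.connection K.A c where
  metric := isMetricConnection_leviCivita K.G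
  torsion := torsion_leviCivita K.G
  smooth := K.isSmoothEndo
  parallel := K.isParallelEndo
  sq := K.A_A
  skew := K.skew
  curv p u v w := by
    rw [hK p u v w, mul_div_cancel_left₀ c (by norm_num : (4 : ℝ) ≠ 0)]
    rfl

end SpaceForms

/-! ### Lagrangian immersions satisfy the abstract hypotheses -/

section Immersions

variable {n : ℕ} {M : Type*} [TopologicalSpace M] [ChartedSpace (EuclideanSpace ℝ (Fin n)) M]
  [IsManifold (𝓡 n) ∞ M]
  {N : Type*} [TopologicalSpace N] [ChartedSpace (EuclideanSpace ℝ (Fin (2 * n))) N]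
  [IsManifold (𝓡 (2 * n)) ∞ N] {K : ParaKahlerStructure (2 * n) N} {f : M → N}

/-- A df(TM) is orthogonal to df(TM) by isotropy, so nondegeneracy of h makes their sum direct; the
two ranks n add up to the dimension 2n. -/
theorem IsLagrangianImmersion.exists_decomposition (hf : IsLagrangianImmersion K f)
    (hnd : IsNondegenerateImmersion K f) (x : M) (p : Tan (2 * n) (f x)) :
    ∃ a b : Tan n x, p = mfderiv (𝓡 n) (𝓡 (2 * n)) f x a
      + K.A (f x) (mfderiv (𝓡 n) (𝓡 (2 * n)) f x b) := by
  let L : Tan n x × Tan n x →ₗ[ℝ] Tan (2 * n) (f x) :=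
    LinearMap.coprod (mfderiv (𝓡 n) (𝓡 (2 * n)) f x).toLinearMap
      ((K.A (f x)).comp (mfderiv (𝓡 n) (𝓡 (2 * n)) f x)).toLinearMap
  have hL : ∀ a b, L (a, b) = mfderiv (𝓡 n) (𝓡 (2 * n)) f x a
      + K.A (f x) (mfderiv (𝓡 n) (𝓡 (2 * n)) f x b) := fun a b => rfl
  have hinj : Function.Injective L := by
    rw [injective_iff_map_eq_zero]
    rintro ⟨a, b⟩ h0
    rw [hL] at h0
    have ha : a = 0 := by
      refine hnd x a fun w => ?_
      have h1 := congrArg (fun p => K.G.inner (f x) p (mfderiv (𝓡 n) (𝓡 (2 * n)) f x w)) h0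
      have h2 := hf.isotropic x b w
      unfold ParaKahlerStructure.form at h2
      simp only [map_add, add_apply, h2, add_zero, map_zero, zero_apply] at h1
      exact h1
    rw [ha, map_zero, zero_add] at h0
    have h1 := congrArg (K.A (f x)) h0
    rw [K.A_A, map_zero] at h1
    have hb : b = 0 := hf.injective_mfderiv x (h1.trans (map_zero _).symm)
    rw [ha, hb]
    rfl
  have hn : Module.finrank ℝ (Tan n x) = n := finrank_euclideanSpace_fin (𝕜 := ℝ) (n := n)
  have hN : Module.finrank ℝ (Tan (2 * n) (f x)) = 2 * n :=
    finrank_euclideanSpace_fin (𝕜 := ℝ) (n := 2 * n)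
  have hdim : Module.finrank ℝ (Tan n x × Tan n x) = Module.finrank ℝ (Tan (2 * n) (f x)) := by
    rw [Module.finrank_prod, hn, hN, two_mul]
  obtain ⟨⟨a, b⟩, hab⟩ := (LinearMap.injective_iff_surjective_of_finrank_eq_finrank hdim).1 hinj p
  exact ⟨a, b, hab.symm⟩

theorem IsLagrangianImmersion.isLagrangian (hf : IsLagrangianImmersion K f)
    (hnd : IsNondegenerateImmersion K f) :
    IsLagrangian K.G K.A f (inducedMetric K f hf hnd) where
  smooth := hf.smooth
  isometric _ _ _ := rfl
  isotropic := hf.isotropic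
  spanning x p h1 h2 := by
    refine K.G.nondegenerate (f x) p fun q => ?_
    obtain ⟨a, b, rfl⟩ := hf.exists_decomposition hnd x q
    rw [map_add, h1, h2, add_zero]

/-- Write the ambient derivative as df(a) + m with m in T⁻, so that a is the induced derivative. In
the sum of the two pairings m cancels because A m = -m, and A df(a) is orthogonal to df(z). -/
theorem IsLagrangianImmersion.isProjected (hf : IsLagrangianImmersion K f)
    (hnd : IsNondegenerateImmersion K f) :
    IsProjected K.G K.connection K.A f (inducedMetric K f hf hnd)
      (inducedConnection K.connection f hf.smooth hf.injective_mfderiv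
        (fun x => K.minusSpace (f x)) (isCompl_minusSpace K f hf hnd)) := by
  intro x Y _ u z
  set w := alongDeriv n K.connection f (pushAlong n (2 * n) f Y) x u with hw
  have hc := isCompl_minusSpace K f hf hnd x
  obtain ⟨_, ⟨a, rfl⟩, m, hm, hsum⟩ := Submodule.mem_sup.1 (hc.sup_eq_top.ge (Submodule.mem_top (x := w)))
  have hD : inducedConnection K.connection f hf.smooth hf.injective_mfderiv
      (fun x => K.minusSpace (f x)) (isCompl_minusSpace K f hf hnd) Y x u = a := by
    change LinearMap.linearProjOfIsCompl (K.minusSpace (f x))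
      (mfderiv (𝓡 n) (𝓡 (2 * n)) f x).toLinearMap (hf.injective_mfderiv x) hc w = a
    rw [← hsum, map_add, LinearMap.linearProjOfIsCompl_apply_left,
      LinearMap.linearProjOfIsCompl_apply_right' _ _ _ _ _ hm, add_zero]
  have hAm : K.A (f x) m = -m := eq_neg_of_add_eq_zero_left hm
  have hi := hf.isotropic x a z
  unfold ParaKahlerStructure.form at hi
  have hiso : (inducedMetric K f hf hnd).inner x a z = K.G.inner (f x)
      (mfderiv (𝓡 n) (𝓡 (2 * n)) f x a) (mfderiv (𝓡 n) (𝓡 (2 * n)) f x z) := rfl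
  rw [hD, hiso, ← hsum]
  simp only [map_add, add_apply, hAm, map_neg, neg_apply]
  linear_combination -hi

end Immersions

/-! ### The determinant of a metric -/

section Determinant

/-- Jacobi's formula. -/
theorem hasFDerivAt_matrix_det {E : Type*} [NormedAddCommGroup E] [NormedSpace ℝ E] {n : ℕ}
    {A : E → Matrix (Fin n) (Fin n) ℝ} {A' : Fin n → Fin n → E →L[ℝ] ℝ} {q : E}
    (h : ∀ i j, HasFDerivAt (fun r => A r i j) (A' i j) q) :
    HasFDerivAt (fun r => (A r).det) (∑ i, ∑ k, (A q).adjugate i k • A' k i) q := by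
  have h1 : HasFDerivAt (fun r => (A r).det) (∑ σ : Equiv.Perm (Fin n),
      ((Equiv.Perm.sign σ : ℤ) : ℝ) • ∑ i, (∏ j ∈ Finset.univ.erase i, A q (σ j) j) • A' (σ i) i)
      q := by
    simp only [Matrix.det_apply']
    exact HasFDerivAt.fun_sum fun σ _ =>
      (HasFDerivAt.finsetProd fun i _ => h (σ i) i).const_mul _
  refine h1.congr_fderiv ?_
  ext v
  simp only [sum_apply, smul_apply, smul_eq_mul, Finset.mul_sum]
  rw [Finset.sum_comm]
  refine Finset.sum_congr rfl fun i _ => ?_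
  -- Cramer's rule: a row of the adjugate applied to a column is the determinant with that column
  -- substituted.
  have h2 : ∑ k, (A q).adjugate i k * A' k i v
      = ((A q).updateCol i fun k => A' k i v).det := by
    rw [← Matrix.cramer_apply, Matrix.cramer_eq_adjugate_mulVec]
    rfl
  rw [h2, Matrix.det_apply']
  refine Finset.sum_congr rfl fun σ _ => ?_
  rw [← Finset.mul_prod_erase Finset.univ _ (Finset.mem_univ i), Matrix.updateCol_self]
  have h3 : ∏ j ∈ Finset.univ.erase i, ((A q).updateCol i fun k => A' k i v) (σ j) j
      = ∏ j ∈ Finset.univ.erase i, A q (σ j) j :=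
    Finset.prod_congr rfl fun j hj => Matrix.updateCol_ne (Finset.ne_of_mem_erase hj)
  rw [h3]
  ring

variable {n : ℕ} {M : Type*} [TopologicalSpace M] [ChartedSpace (EuclideanSpace ℝ (Fin n)) M]
  [IsManifold (𝓡 n) ∞ M]

theorem sum_coord_smul (x : M) (v : Tan n x) : ∑ l, coord x l v • coordVec x l = v :=
  (euclidean_eq_sum (n := n) v).symm

theorem coord_coordVec (x : M) (i l : Fin n) : coord x l (coordVec x i) = if l = i then 1 else 0 := by
  rw [coord_eq_toCoord, toCoord_coordVec]
  simp

theorem inner_eq_sum (h : PseudoRiemannianMetric n M) (x : M) (v : Tan n x) (k : Fin n) :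
    h.inner x v (coordVec x k) = ∑ l, coord x l v * lower h x l k := by
  conv_lhs => rw [← sum_coord_smul x v]
  simp only [map_sum, map_smul, sum_apply, smul_apply, smul_eq_mul, lower_eq_inner]

theorem contMDiffAt_gram (h : PseudoRiemannianMetric n M) (x : M) (i j : Fin n) :
    ContMDiffAt (𝓡 n) 𝓘(ℝ, ℝ) ∞ (fun y => gram h x y i j) x := by
  have h1 : ContMDiffAt (𝓡 n) 𝓘(ℝ, EuclideanSpace ℝ (Fin n) →L[ℝ] ℝ) ∞
      (fun y => formCoord h x y (EuclideanSpace.single i (1 : ℝ))) x :=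
    (contMDiffAt_formCoord h (mem_source_self x)).clm_apply contMDiffAt_const
  refine (h1.clm_apply (contMDiffAt_const (c := EuclideanSpace.single j (1 : ℝ)))).congr_of_eventuallyEq
    ?_
  filter_upwards [eventually_mem_source (mem_source_self (n := n) x)] with y hy
  exact gram_eq h hy i j

theorem hasFDerivAt_inChart {V : Type*} [NormedAddCommGroup V] [NormedSpace ℝ V] {x : M} {g : M → V}
    (hg : ContMDiffAt (𝓡 n) 𝓘(ℝ, V) ∞ g x) :
    HasFDerivAt (inChart x g) (fderiv ℝ (inChart x g) (extChartAt (𝓡 n) x x))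
      (extChartAt (𝓡 n) x x) :=
  (differentiableAt_inChart (mem_source_self x) (hg.mdifferentiableAt (by simp))).hasFDerivAt

theorem pderiv_eq_fderiv {x : M} {g : M → ℝ} (hg : MDifferentiableAt (𝓡 n) 𝓘(ℝ, ℝ) g x)
    (i : Fin n) :
    pderiv g x i = fderiv ℝ (inChart x g) (extChartAt (𝓡 n) x x)
      (EuclideanSpace.single i (1 : ℝ)) := by
  unfold pderiv
  rw [coordVec_eq_fromCoord]
  exact mvfderiv_fromCoord (mem_source_self x) hg _

theorem contMDiffAt_det_gram (h : PseudoRiemannianMetric n M) (x : M) :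
    ContMDiffAt (𝓡 n) 𝓘(ℝ, ℝ) ∞ (fun y => (gram h x y).det) x := by
  simp only [Matrix.det_apply']
  exact ContMDiffAt.sum fun σ _ => contMDiffAt_const.mul
    (contMDiffAt_finsetProd fun i _ => contMDiffAt_gram h x _ _)

theorem pderiv_comp {x : M} {g : M → ℝ} {φ : ℝ → ℝ} {φ' : ℝ}
    (hg : MDifferentiableAt (𝓡 n) 𝓘(ℝ, ℝ) g x) (hφ : HasDerivAt φ φ' (g x)) (i : Fin n) :
    pderiv (fun y => φ (g y)) x i = φ' * pderiv g x i := by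
  have h1 : MDifferentiableAt (𝓡 n) 𝓘(ℝ, ℝ) (fun y => φ (g y)) x :=
    hφ.differentiableAt.mdifferentiableAt.comp x hg
  rw [pderiv_eq_fderiv h1, pderiv_eq_fderiv hg]
  have hx : inChart x g (extChartAt (𝓡 n) x x) = g x := inChart_apply (mem_source_self x) g
  rw [← hx] at hφ
  have h2 := hφ.comp_hasFDerivAt _ (differentiableAt_inChart (mem_source_self x) hg).hasFDerivAt
  exact congrArg (fun L => L (EuclideanSpace.single i (1 : ℝ))) h2.fderiv

/-- Jacobi's formula with the adjugate replaced by determinant times inverse, which is legitimate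
because h is nondegenerate. -/
theorem pderiv_det_gram (h : PseudoRiemannianMetric n M) (x : M) (i : Fin n) :
    pderiv (fun y => (gram h x y).det) x i
      = (gram h x x).det * ∑ j, ∑ k, upper h x j k * pderiv (fun y => gram h x y k j) x i := by
  rw [pderiv_eq_fderiv ((contMDiffAt_det_gram h x).mdifferentiableAt (by simp))]
  have hq : gram h x ((extChartAt (𝓡 n) x).symm (extChartAt (𝓡 n) x x)) = gram h x x := by
    rw [extChartAt_to_inv]
  have h1 := hasFDerivAt_matrix_det
    (A := fun q => gram h x ((extChartAt (𝓡 n) x).symm q)) (q := extChartAt (𝓡 n) x x)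
    fun j k => hasFDerivAt_inChart (contMDiffAt_gram h x j k)
  refine (congrArg (fun L => L (EuclideanSpace.single i (1 : ℝ))) h1.fderiv).trans ?_
  have hu : IsUnit (gram h x x).det := isUnit_det_gram h (mem_source_self x)
  simp only [sum_apply, smul_apply, smul_eq_mul, Finset.mul_sum, hq]
  refine Finset.sum_congr rfl fun j _ => Finset.sum_congr rfl fun k _ => ?_
  rw [pderiv_eq_fderiv ((contMDiffAt_gram h x k j).mdifferentiableAt (by simp)), upper,
    Matrix.inv_def, Matrix.smul_apply, smul_eq_mul, ← mul_assoc, ← mul_assoc,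
    Ring.mul_inverse_cancel _ hu, one_mul]

theorem pderiv_gram_eq (D : AffineConnection n M) (h : PseudoRiemannianMetric n M) (x : M)
    (i j k : Fin n) :
    pderiv (fun y => gram h x y j k) x i = nablaMetric D h x i j k
      + ∑ l, coord x l (D (frame x j) x (coordVec x i)) * lower h x l k
      + ∑ l, coord x l (D (frame x k) x (coordVec x i)) * lower h x l j := by
  have h1 : nablaMetric D h x i j k = pderiv (fun y => gram h x y j k) x i
      - h.inner x (D (frame x j) x (coordVec x i)) (coordVec x k)
      - h.inner x (coordVec x j) (D (frame x k) x (coordVec x i)) := rfl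
  rw [h1, h.symm x (coordVec x j), inner_eq_sum, inner_eq_sum]
  ring

theorem sum_upper_mul_sum_lower (h : PseudoRiemannianMetric n M) (x : M) (G : Fin n → Fin n → ℝ) :
    ∑ j, ∑ k, upper h x j k * ∑ l, G j l * lower h x l k = ∑ j, G j j := by
  refine Finset.sum_congr rfl fun j _ => ?_
  simp only [Finset.mul_sum]
  rw [Finset.sum_comm]
  have h1 : ∀ l, ∑ k, upper h x j k * (G j l * lower h x l k) = G j l * if l = j then 1 else 0 := by
    intro l
    rw [← sum_lower_mul_upper h x l j, Finset.mul_sum]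
    refine Finset.sum_congr rfl fun k _ => ?_
    rw [upper_symm h x j k]
    ring
  simp [h1]

/-- Substituting ∂h = ∇h + Γ-terms in Jacobi's formula, the trace of ∇h disappears and each of the
two Γ-terms contributes one trace of Γ. -/
theorem pderiv_det_gram_of_trace {D : AffineConnection n M} {h : PseudoRiemannianMetric n M} {x : M}
    {i : Fin n} (ht : ∑ p, ∑ q, upper h x p q * nablaMetric D h x i p q = 0) :
    pderiv (fun y => (gram h x y).det) x i
      = 2 * (∑ p, coord x p (D (frame x p) x (coordVec x i))) * (gram h x x).det := by
  have h1 := sum_upper_mul_sum_lower h x fun j l => coord x l (D (frame x j) x (coordVec x i))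
  have h2 : ∑ j, ∑ k, upper h x j k * ∑ l, coord x l (D (frame x k) x (coordVec x i)) * lower h x l j
      = ∑ p, coord x p (D (frame x p) x (coordVec x i)) := by
    rw [← h1, Finset.sum_comm]
    refine Finset.sum_congr rfl fun j _ => Finset.sum_congr rfl fun k _ => ?_
    rw [upper_symm]
  have h3 : ∑ j, ∑ k, upper h x j k * nablaMetric D h x i k j = 0 := by
    rw [← ht, Finset.sum_comm]
    refine Finset.sum_congr rfl fun j _ => Finset.sum_congr rfl fun k _ => ?_
    rw [upper_symm]
  rw [pderiv_det_gram]
  simp only [pderiv_gram_eq D h x i, mul_add, Finset.sum_add_distrib]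
  rw [h1, h2, h3]
  ring

theorem covDerivDensity_abs_det {D : AffineConnection n M} {h : PseudoRiemannianMetric n M} {x : M}
    {i : Fin n} (ht : ∑ p, ∑ q, upper h x p q * nablaMetric D h x i p q = 0) :
    covDerivDensity D 2 (fun y => |(gram h x y).det|) x i = 0 := by
  have hu : (gram h x x).det ≠ 0 := (isUnit_det_gram h (mem_source_self x)).ne_zero
  unfold covDerivDensity
  rw [pderiv_comp ((contMDiffAt_det_gram h x).mdifferentiableAt (by simp)) (hasDerivAt_abs hu),
    pderiv_det_gram_of_trace ht]
  beta_reduce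
  rcases lt_or_gt_of_ne hu with hlt | hgt
  · rw [abs_of_neg hlt, sign_neg hlt]
    simp
  · rw [abs_of_pos hgt, sign_pos hgt]
    simp

theorem mdifferentiableAt_abs_det_gram (h : PseudoRiemannianMetric n M) (x : M) :
    MDifferentiableAt (𝓡 n) 𝓘(ℝ, ℝ) (fun y => |(gram h x y).det|) x :=
  (hasDerivAt_abs (isUnit_det_gram h (mem_source_self x)).ne_zero).differentiableAt.mdifferentiableAt.comp
    x ((contMDiffAt_det_gram h x).mdifferentiableAt (by simp))

theorem abs_det_gram_pos (h : PseudoRiemannianMetric n M) (x : M) : 0 < |(gram h x x).det| :=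
  abs_pos.2 (isUnit_det_gram h (mem_source_self x)).ne_zero

theorem mdifferentiableAt_detRoot (h : PseudoRiemannianMetric n M) (x : M) :
    MDifferentiableAt (𝓡 n) 𝓘(ℝ, ℝ) (detRoot h x) x :=
  (Real.hasDerivAt_rpow_const (p := 1 / (n : ℝ))
    (Or.inl (abs_det_gram_pos h x).ne')).differentiableAt.mdifferentiableAt.comp x
      (mdifferentiableAt_abs_det_gram h x)

/-- The 1/n-th power of a parallel positive density of weight 2 is parallel of weight 2/n, by the
chain rule. -/
theorem covDerivDensity_detRoot {D : AffineConnection n M} {h : PseudoRiemannianMetric n M} {x : M}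
    {i : Fin n} (ht : ∑ p, ∑ q, upper h x p q * nablaMetric D h x i p q = 0) :
    covDerivDensity D (2 / (n : ℝ)) (detRoot h x) x i = 0 := by
  have hpos := abs_det_gram_pos h x
  have h0 := covDerivDensity_abs_det ht
  unfold covDerivDensity at h0 ⊢
  have h1 := pderiv_comp (mdifferentiableAt_abs_det_gram h x)
    (Real.hasDerivAt_rpow_const (p := 1 / (n : ℝ)) (Or.inl hpos.ne')) i
  have h2 : pderiv (detRoot h x) x i = _ := h1
  rw [h2, sub_eq_zero.1 h0, detRoot, Real.rpow_sub_one hpos.ne']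
  field_simp
  ring

end Determinant

/-! ### Tensors of connections of constant curvature -/

section ConstantCurvature

variable {n : ℕ} {M : Type*} [TopologicalSpace M] [ChartedSpace (EuclideanSpace ℝ (Fin n)) M]
  [IsManifold (𝓡 n) ∞ M]

/-- The curvature of the connection is `c (h(v, w) u - h(u, w) v)`. -/
def HasConstantCurvature (D : AffineConnection n M) (h : PseudoRiemannianMetric n M) (c : ℝ) :
    Prop :=
  ∀ (x : M) (u v w : Tan n x), curvature D x u v w = c • (h.inner x v w • u - h.inner x u w • v)

variable {D : AffineConnection n M} {h : PseudoRiemannianMetric n M} {c : ℝ}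

theorem HasConstantCurvature.riem (hR : HasConstantCurvature D h c) (x : M) (i j k l : Fin n) :
    riem D x i j k l = c * ((if i = l then 1 else 0) * lower h x j k
      - (if j = l then 1 else 0) * lower h x i k) := by
  unfold _root_.riem
  rw [hR, map_smul, map_sub, map_smul, map_smul, coord_coordVec, coord_coordVec, ← lower_eq_inner,
    ← lower_eq_inner, smul_eq_mul, smul_eq_mul, smul_eq_mul]
  simp only [eq_comm (a := l)]
  ring

theorem HasConstantCurvature.riemLower (hR : HasConstantCurvature D h c) (x : M)
    (i j k l : Fin n) :
    riemLower D h x i j k l = c * (lower h x j k * lower h x i l - lower h x i k * lower h x j l) := by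
  unfold _root_.riemLower
  simp only [hR.riem, mul_assoc, sub_mul, Finset.sum_sub_distrib, ← Finset.mul_sum, ite_mul, one_mul,
    zero_mul, Finset.sum_ite_eq, Finset.mem_univ, if_true]

theorem sum_coord_mul_inner (h : PseudoRiemannianMetric n M) (x : M) (v w : Tan n x) :
    ∑ p, coord x p v * h.inner x (coordVec x p) w = h.inner x v w := by
  conv_rhs => rw [← sum_coord_smul x v]
  simp only [map_sum, map_smul, sum_apply, smul_apply, smul_eq_mul]

theorem HasConstantCurvature.ricci (hR : HasConstantCurvature D h c) (x : M) (v w : Tan n x) :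
    ricci D x v w = c * (n - 1) * h.inner x v w := by
  unfold _root_.ricci
  have h1 : ∀ p, coord x p (curvature D x (coordVec x p) v w)
      = c * h.inner x v w - c * (coord x p v * h.inner x (coordVec x p) w) := by
    intro p
    rw [hR, map_smul, map_sub, map_smul, map_smul, coord_coordVec, if_pos rfl, smul_eq_mul,
      smul_eq_mul, smul_eq_mul]
    ring
  simp only [h1, Finset.sum_sub_distrib, ← Finset.mul_sum, sum_coord_mul_inner, Finset.sum_const,
    Finset.card_univ, Fintype.card_fin, nsmul_eq_mul]
  ring

theorem HasConstantCurvature.ricciComp (hR : HasConstantCurvature D h c) (x : M) (i j : Fin n) :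
    ricciComp D x i j = c * (n - 1) * lower h x i j := by
  rw [_root_.ricciComp, hR.ricci, lower_eq_inner]

/-- The trace of R(u, v) is a multiple of h(u, v) - h(v, u). -/
theorem HasConstantCurvature.faraday (hR : HasConstantCurvature D h c) (x : M) (u v : Tan n x) :
    faraday D x u v = 0 := by
  unfold _root_.faraday
  have h1 : ∀ p, coord x p (curvature D x u v (coordVec x p))
      = c * (coord x p u * h.inner x (coordVec x p) v)
        - c * (coord x p v * h.inner x (coordVec x p) u) := by
    intro p
    rw [hR, map_smul, map_sub, map_smul, map_smul, smul_eq_mul, smul_eq_mul, smul_eq_mul,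
      h.symm x v, h.symm x u]
    ring
  simp only [h1, Finset.sum_sub_distrib, ← Finset.mul_sum, sum_coord_mul_inner]
  rw [h.symm x u v]
  ring

theorem sum_upper_mul_lower_self (h : PseudoRiemannianMetric n M) (x : M) :
    ∑ p, ∑ q, upper h x p q * lower h x p q = n := by
  have h1 : ∀ p, ∑ q, upper h x p q * lower h x p q = 1 := by
    intro p
    simp only [lower_symm h x p, sum_upper_mul_lower, if_true]
  simp [h1]

theorem sum_upper_contract (h : PseudoRiemannianMetric n M) (x : M) (a b : Fin n) :
    ∑ p, ∑ q, upper h x p q * (lower h x a q * lower h x p b) = lower h x a b := by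
  have h1 : ∀ p, ∑ q, upper h x p q * (lower h x a q * lower h x p b)
      = (if p = a then 1 else 0) * lower h x p b := by
    intro p
    rw [← sum_upper_mul_lower h x p a, Finset.sum_mul]
    refine Finset.sum_congr rfl fun q _ => ?_
    rw [lower_symm h x a q]
    ring
  simp [h1]

theorem HasConstantCurvature.secondRicci (hR : HasConstantCurvature D h c) (x : M) (i j : Fin n) :
    secondRicci D h x i j = c * (n - 1) * lower h x i j := by
  unfold _root_.secondRicci
  have h1 : ∀ p q, upper h x p q * _root_.riemLower D h x i p q j
      = c * lower h x i j * (upper h x p q * lower h x p q)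
        - c * (upper h x p q * (lower h x i q * lower h x p j)) := by
    intro p q
    rw [hR.riemLower]
    ring
  simp only [h1, Finset.sum_sub_distrib, ← Finset.mul_sum, sum_upper_mul_lower_self,
    sum_upper_contract]
  ring

theorem tracefreeSym_smul_lower (hn : n ≠ 0) (h : PseudoRiemannianMetric n M) (x : M) {r : ℝ}
    {Z : Fin n → Fin n → ℝ} (hZ : ∀ i j, Z i j = r * lower h x i j) (i j : Fin n) :
    tracefreeSym h x Z i j = 0 := by
  have hn' : (n : ℝ) ≠ 0 := Nat.cast_ne_zero.2 hn
  unfold tracefreeSym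
  have h1 : ∀ p q, upper h x p q * Z p q = r * (upper h x p q * lower h x p q) := by
    intro p q
    rw [hZ]
    ring
  have h2 : ∑ p, ∑ q, upper h x p q * Z p q = r * n := by
    simp only [h1, ← Finset.mul_sum, sum_upper_mul_lower_self]
  rw [h2, hZ, hZ, lower_symm h x j i]
  field_simp
  ring

/-- The lowered curvature is already skew in each pair and symmetric under exchange of pairs, so T
is the curvature itself. -/
theorem HasConstantCurvature.tTensor (hR : HasConstantCurvature D h c) (x : M)
    (i j k l : Fin n) :
    tTensor D h x i j k l = c * ((if i = l then 1 else 0) * lower h x j k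
      - (if j = l then 1 else 0) * lower h x i k) := by
  unfold _root_.tTensor tTensorLower
  have h1 : ∀ p, upper h x l p * (1 / 2 * ((_root_.riemLower D h x i j k p
        - _root_.riemLower D h x i j p k) / 2
        + (_root_.riemLower D h x k p i j - _root_.riemLower D h x k p j i) / 2))
      = c * lower h x j k * (upper h x l p * lower h x p i)
        - c * lower h x i k * (upper h x l p * lower h x p j) := by
    intro p
    simp only [hR.riemLower]
    rw [lower_symm h x i p, lower_symm h x j p, lower_symm h x k j, lower_symm h x k i]
    ring
  simp only [h1, Finset.sum_sub_distrib, ← Finset.mul_sum, sum_upper_mul_lower, eq_comm (a := l)]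
  ring

/-- As F = 0, only the curvature enters, and symmetrizing over its last three indices makes its two
terms h_{jk}h_{il} and h_{ik}h_{jl} equal, with opposite signs. -/
theorem HasConstantCurvature.uTensor (hR : HasConstantCurvature D h c) (x : M)
    (i j k l : Fin n) : uTensor D h x i j k l = 0 := by
  have hF : ∀ i j, faradayComp D x i j = 0 := fun i j => hR.faraday x _ _
  simp only [_root_.uTensor, hF, hR.riemLower, sym3]
  ring

theorem HasConstantCurvature.eTensor (hR : HasConstantCurvature D h c) (x : M)
    (i j k l : Fin n) : eTensor D h x i j k l = 0 := by
  simp [_root_.eTensor, eTrace, hR.uTensor]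

/-- Needed throughout the chart and not only at its centre, since the Einstein condition
differentiates the scalar curvature. -/
theorem HasConstantCurvature.weightedScalar (hR : HasConstantCurvature D h c) {x y : M}
    (hy : y ∈ (chartAt (EuclideanSpace ℝ (Fin n)) x).source) :
    weightedScalar D h x y = n * (n - 1) * c * detRoot h x y := by
  have hu : IsUnit (gram h x y).det := isUnit_det_gram h hy
  have h1 : ∀ i, ∑ j, (gram h x y)⁻¹ i j * gram h x y j i = 1 := by
    intro i
    have h2 := congrFun (congrFun (Matrix.nonsing_inv_mul _ hu) i) i
    rwa [Matrix.mul_apply, Matrix.one_apply_eq] at h2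
  have h3 : ∀ i j, (gram h x y)⁻¹ i j * _root_.ricci D y (frame x i y) (frame x j y)
      = c * (n - 1) * ((gram h x y)⁻¹ i j * gram h x y j i) := by
    intro i j
    have h4 : h.inner y (frame x i y) (frame x j y) = gram h x y j i := h.symm _ _ _
    rw [hR.ricci, h4]
    ring
  unfold _root_.weightedScalar
  simp only [h3, ← Finset.mul_sum, h1, Finset.sum_const, Finset.card_univ, Fintype.card_fin,
    nsmul_eq_mul]
  ring

theorem covDerivDensity_const_mul (D : AffineConnection n M) (a r : ℝ) {ρ ρ' : M → ℝ} {x : M}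
    (h : ρ =ᶠ[nhds x] fun y => r * ρ' y) (hρ : MDifferentiableAt (𝓡 n) 𝓘(ℝ, ℝ) ρ' x) (i : Fin n) :
    covDerivDensity D a ρ x i = r * covDerivDensity D a ρ' x i := by
  have h1 : pderiv ρ x i = pderiv (fun y => r * ρ' y) x i :=
    congrArg (fun L => L (coordVec x i)) (mvfderiv_congr h)
  unfold covDerivDensity
  rw [h1, pderiv_comp hρ (hasDerivAt_const_mul r), h.self_of_nhds]
  ring

theorem covDerivForm_zero {B : Π y : M, Tan n y → Tan n y → ℝ} (hB : ∀ y v w, B y v w = 0)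
    (x : M) (u v w : Tan n x) : covDerivForm D B x u v w = 0 := by
  unfold covDerivForm
  have h1 : (fun y => B y (extendVec v y) (extendVec w y)) = fun _ => (0 : ℝ) :=
    funext fun y => hB y _ _
  rw [h1, hB, hB]
  simp [mvfderiv_const]

end ConstantCurvature

/-! ### Consequences of a totally symmetric, trace-free ∇h -/

section CubicTorsion

variable {n : ℕ} {M : Type*} [TopologicalSpace M] [ChartedSpace (EuclideanSpace ℝ (Fin n)) M]
  [IsManifold (𝓡 n) ∞ M]

/-- `∇ h` is completely symmetric and trace-free. -/
structure HasTracefreeCubicForm (D : AffineConnection n M) (h : PseudoRiemannianMetric n M) :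
    Prop where
  comm : ∀ x i j k, nablaMetric D h x i j k = nablaMetric D h x j i k
  comm_right : ∀ x i j k, nablaMetric D h x i j k = nablaMetric D h x i k j
  trace : ∀ x i, ∑ p, ∑ q, upper h x p q * nablaMetric D h x i p q = 0

variable {D : AffineConnection n M} {h : PseudoRiemannianMetric n M}

theorem HasTracefreeCubicForm.trace' (hS : HasTracefreeCubicForm D h) (x : M) (i : Fin n) :
    ∑ p, ∑ q, upper h x p q * nablaMetric D h x p i q = 0 := by
  simp only [hS.comm x _ i, hS.trace]

theorem HasTracefreeCubicForm.trace'' (hS : HasTracefreeCubicForm D h) (x : M) (i : Fin n) :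
    ∑ p, ∑ q, upper h x p q * nablaMetric D h x p q i = 0 := by
  simp only [hS.comm_right x _ _ i, hS.trace']

theorem HasTracefreeCubicForm.isAligned (hS : HasTracefreeCubicForm D h) : IsAligned D h := by
  intro x i
  rw [hS.trace, hS.trace'', mul_zero]

/-- The skew part of ∇h vanishes by symmetry, and so do the traces that correct it. -/
theorem HasTracefreeCubicForm.conformalTorsionLower (hS : HasTracefreeCubicForm D h) (x : M)
    (i j k : Fin n) : conformalTorsionLower D h x i j k = 0 := by
  simp only [_root_.conformalTorsionLower, mul_sub, Finset.sum_sub_distrib, hS.trace, hS.trace']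
  rw [hS.comm x i j k]
  ring

theorem HasTracefreeCubicForm.sym3 (hS : HasTracefreeCubicForm D h) (x : M) (i j k : Fin n) :
    sym3 (nablaMetric D h x) i j k = nablaMetric D h x i j k := by
  unfold _root_.sym3
  rw [hS.comm_right x i k j, hS.comm x j i k, hS.comm_right x j k i, hS.comm x j i k,
    hS.comm x k i j, hS.comm_right x i k j, hS.comm_right x k j i, hS.comm x k i j,
    hS.comm_right x i k j]
  ring

/-- Neither the symmetrization nor the removal of traces changes anything. -/
theorem HasTracefreeCubicForm.cubicTorsionLower (hS : HasTracefreeCubicForm D h) (x : M)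
    (i j k : Fin n) : cubicTorsionLower D h x i j k = nablaMetric D h x i j k := by
  simp only [_root_.cubicTorsionLower, hS.sym3, hS.trace]
  ring

theorem HasTracefreeCubicForm.inner_cubicTorsion (hS : HasTracefreeCubicForm D h) (x : M)
    (i j k : Fin n) :
    h.inner x (bilinOfCoeff x (cubicTorsion D h x) (coordVec x j) (coordVec x i)) (coordVec x k)
      = nablaMetric D h x i j k := by
  rw [bilinOfCoeff_coordVec]
  simp only [map_sum, map_smul, sum_apply, smul_apply, smul_eq_mul, ← lower_eq_inner]
  simp only [cubicTorsion, hS.cubicTorsionLower, Finset.sum_mul]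
  rw [Finset.sum_comm]
  have h1 : ∀ p, ∑ l, upper h x l p * nablaMetric D h x i j p * lower h x l k
      = nablaMetric D h x i j p * if p = k then 1 else 0 := by
    intro p
    rw [← sum_upper_mul_lower h x p k, Finset.mul_sum]
    refine Finset.sum_congr rfl fun l _ => ?_
    rw [upper_symm h x l p]
    ring
  simp [h1]

end CubicTorsion

/-! ### The conjugate connection -/

section Conjugate

variable {n d : ℕ} {M : Type*} [TopologicalSpace M] [ChartedSpace (EuclideanSpace ℝ (Fin n)) M]
  [IsManifold (𝓡 n) ∞ M]
  {N : Type*} [TopologicalSpace N] [ChartedSpace (EuclideanSpace ℝ (Fin d)) N]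
  [IsManifold (𝓡 d) ∞ N]
  {g : PseudoRiemannianMetric d N} {D : AffineConnection d N}
  {A : Π p : N, Tan d p →L[ℝ] Tan d p} {c : ℝ} {f : M → N} {h : PseudoRiemannianMetric n M}
  {D' : AffineConnection n M}

theorem IsProjected.nablaMetric (hK : IsParaComplexSpaceForm g D A c) (hL : IsLagrangian g A f h)
    (hP : IsProjected g D A f h D') (x : M) (i j k : Fin n) :
    nablaMetric D' h x i j k = -2 * sff g D A f x (coordVec x i) (coordVec x j) (coordVec x k) :=
  hP.covDerivForm hK hL x _ _ _

/-- Translates the symmetries of Π and the vanishing of the mean curvature through ∇h = -2Π. -/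
theorem IsProjected.hasTracefreeCubicForm (hK : IsParaComplexSpaceForm g D A c)
    (hL : IsLagrangian g A f h) (hP : IsProjected g D A f h D')
    (hH : ∀ (x : M) (i : Fin n), ∑ j, ∑ k, upper h x j k *
      sff g D A f x (coordVec x i) (coordVec x j) (coordVec x k) = 0) :
    HasTracefreeCubicForm D' h where
  comm x i j k := by
    rw [hP.nablaMetric hK hL, hP.nablaMetric hK hL, sff_comm hK.torsion hL.smooth]
  comm_right x i j k := by
    rw [hP.nablaMetric hK hL, hP.nablaMetric hK hL, sff_comm_right hK hL]
  trace x i := by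
    simp only [hP.nablaMetric hK hL, mul_left_comm _ (-2 : ℝ), ← Finset.mul_sum, hH, mul_zero]

theorem sff_add_left (x : M) (u u' v w : Tan n x) :
    sff g D A f x (u + u') v w = sff g D A f x u v w + sff g D A f x u' v w := by
  simp only [sff, map_add, add_apply]

theorem sff_smul_left (x : M) (r : ℝ) (u v w : Tan n x) :
    sff g D A f x (r • u) v w = r * sff g D A f x u v w := by
  simp only [sff, map_smul, smul_apply, smul_eq_mul]

theorem sff_add_right (x : M) (u v w w' : Tan n x) :
    sff g D A f x u v (w + w') = sff g D A f x u v w + sff g D A f x u v w' := by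
  simp only [sff, map_add]

theorem sff_smul_right (x : M) (r : ℝ) (u v w : Tan n x) :
    sff g D A f x u v (r • w) = r * sff g D A f x u v w := by
  simp only [sff, map_smul, smul_eq_mul]

theorem IsProjected.inner_cubicTorsion (hK : IsParaComplexSpaceForm g D A c)
    (hL : IsLagrangian g A f h) (hP : IsProjected g D A f h D')
    (hS : HasTracefreeCubicForm D' h) (x : M) (u v w : Tan n x) :
    h.inner x (bilinOfCoeff x (cubicTorsion D' h x) v u) w = -2 * sff g D A f x u v w := by
  -- The middle slot of Π enters through a locally extended vector field, so linearity there is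
  -- obtained by moving it to the first slot.
  have hs := sff_comm (g := g) (A := A) (f := f) hK.torsion hL.smooth x
  have key := euclidean_trilinear_ext (n := n) (T := fun u v w =>
    h.inner x (bilinOfCoeff x (cubicTorsion D' h x) (fromCoord x x v) (fromCoord x x u))
      (fromCoord x x w)
      + 2 * sff g D A f x (fromCoord x x u) (fromCoord x x v) (fromCoord x x w))
    (by intro u u' v w; simp only [map_add, add_apply, sff_add_left]; ring)
    (by intro r u v w; simp only [map_smul, smul_apply, smul_eq_mul, sff_smul_left]; ring)
    (by
      intro u v v' w
      simp only [map_add, add_apply, hs (fromCoord x x u), sff_add_left]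
      ring)
    (by
      intro r u v w
      simp only [map_smul, smul_apply, smul_eq_mul, hs (fromCoord x x u), sff_smul_left]
      ring)
    (by intro u v w w'; simp only [map_add, sff_add_right]; ring)
    (by intro r u v w; simp only [map_smul, smul_eq_mul, sff_smul_right]; ring)
    (by
      intro i j k
      simp only [← coordVec_eq_fromCoord]
      rw [hS.inner_cubicTorsion, hP.nablaMetric hK hL]
      ring)
    (toCoord x x u) (toCoord x x v) (toCoord x x w)
  simp only [fromCoord_toCoord_self] at key
  linear_combination key

/-- The conjugate connection is the projection of the ambient connection along the `+1` eigenbundle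
of `A`. -/
theorem IsProjected.conjugate (hK : IsParaComplexSpaceForm g D A c)
    (hL : IsLagrangian g A f h) (hP : IsProjected g D A f h D')
    (hS : HasTracefreeCubicForm D' h) :
    IsProjected g D (fun p => -A p) f h
      (D'.addOneForm fun x => bilinOfCoeff x (cubicTorsion D' h x)) := by
  intro x Y hY u z
  have h1 : (D'.addOneForm fun x => bilinOfCoeff x (cubicTorsion D' h x)) Y x u
      = D' Y x u + bilinOfCoeff x (cubicTorsion D' h x) (Y x) u := rfl
  -- Both Y and the extension of Y x give the same value of Ω(∇̂_u df(·), df(z)), since each equals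
  -- an expression depending only on Y x. Subtracting twice this value flips the sign of the A-term.
  have h2 := hL.inner_endo_comm hK hY (vDiffAt_extendVec z) u
  have h3 := hL.inner_endo_comm hK (vDiffAt_extendVec (Y x)) (vDiffAt_extendVec z) u
  rw [extendVec_self] at h2 h3
  rw [extendVec_self] at h3
  rw [h1, map_add, add_apply, hP x Y hY, hP.inner_cubicTorsion hK hL hS, sff]
  simp only [neg_apply, map_neg]
  linear_combination -2 * h3 + 2 * h2

end Conjugate

/-! ### Properties of the induced AH structure -/

section InducedStructures

variable {n d : ℕ} {M : Type*} [TopologicalSpace M] [ChartedSpace (EuclideanSpace ℝ (Fin n)) M]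
  [IsManifold (𝓡 n) ∞ M]
  {N : Type*} [TopologicalSpace N] [ChartedSpace (EuclideanSpace ℝ (Fin d)) N]
  [IsManifold (𝓡 d) ∞ N]
  {g : PseudoRiemannianMetric d N} {D : AffineConnection d N}
  {A : Π p : N, Tan d p →L[ℝ] Tan d p} {c : ℝ} {f : M → N} {h : PseudoRiemannianMetric n M}
  {D' : AffineConnection n M}

theorem IsProjected.contMDiffCovariantDerivative (hK : IsParaComplexSpaceForm g D A c)
    (hL : IsLagrangian g A f h) (hP : IsProjected g D A f h D') :
    CovariantDerivative.ContMDiffCovariantDerivative D' ∞ :=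
  CovariantDerivative.contMDiffCovariantDerivativeOn_univ_iff.1
    (contMDiffCovariantDerivativeOn_of_connCoeff isOpen_univ
      fun x _ => (hP.hasSmoothCoeff hK hL).hasSmoothCoeffAt x)

/-- Both inputs, the Gauss curvature formula and the Codazzi equation, hold for any Lagrangian in a
space form, with no condition on the mean curvature. -/
theorem IsProjected.isProjectivelyFlat (hK : IsParaComplexSpaceForm g D A c)
    (hL : IsLagrangian g A f h) (hP : IsProjected g D A f h D') :
    (CPPair.generatedBy D' h).IsProjectivelyFlat :=
  ⟨D', rfl, hP.contMDiffCovariantDerivative hK hL,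
    exists_flat_of_isCodazzi (hP.hasSmoothCoeff hK hL) (hP.torsion hK hL) (hP.isCodazzi hK hL)
      (hP.curvature hK hL)⟩

theorem IsProjected.isRepresentedBy (hK : IsParaComplexSpaceForm g D A c)
    (hL : IsLagrangian g A f h) (hP : IsProjected g D A f h D') (hS : HasTracefreeCubicForm D' h) :
    (CPPair.generatedBy D' h).IsRepresentedBy D' h where
  smooth := hP.contMDiffCovariantDerivative hK hL
  torsionFree := hP.torsion hK hL
  aligned := hS.isAligned
  generates := rfl

/-- The conjugate connection is the projected connection for -A, so the projective flatness result
applies to it unchanged. -/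
theorem CPPair.IsRepresentedBy.isConjugateProjectivelyFlat (hK : IsParaComplexSpaceForm g D A c)
    (hL : IsLagrangian g A f h) (hP : IsProjected g D A f h D') (hS : HasTracefreeCubicForm D' h)
    {S : CPPair n M} (hR : S.IsRepresentedBy D' h) : S.IsConjugateProjectivelyFlat :=
  ⟨_, ⟨D', h, hR, rfl⟩, (hP.conjugate hK hL hS).isProjectivelyFlat hK.neg hL.neg⟩

variable {S : CPPair n M}

theorem CPPair.IsRepresentedBy.isAH (hR : S.IsRepresentedBy D' h)
    (hS : HasTracefreeCubicForm D' h) : S.IsAH :=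
  ⟨D', h, hR, hS.conformalTorsionLower⟩

theorem CPPair.IsRepresentedBy.isDistinguished (hR : S.IsRepresentedBy D' h)
    (hS : HasTracefreeCubicForm D' h) : S.IsDistinguished h :=
  ⟨D', hR, fun x i => covDerivDensity_abs_det (hS.trace x i)⟩

/-- Both Ricci traces are multiples of h. The scalar curvature is a constant times the parallel
density |det h|^{1/n}, and F vanishes, so both terms of the differential condition are zero
separately. -/
theorem CPPair.IsRepresentedBy.isEinstein (hn : n ≠ 0) (hR : S.IsRepresentedBy D' h)
    (hS : HasTracefreeCubicForm D' h) (hC : HasConstantCurvature D' h c) : S.IsEinstein := by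
  refine ⟨hR.isAH hS, D', h, hR, fun x => tracefreeSym_smul_lower hn h x (hC.ricciComp x),
    fun x => tracefreeSym_smul_lower hn h x (hC.secondRicci x), fun x i => ?_⟩
  have hev : weightedScalar D' h x =ᶠ[nhds x] fun y => n * (n - 1) * c * detRoot h x y := by
    filter_upwards [eventually_mem_source (mem_source_self (n := n) x)] with y hy
    exact hC.weightedScalar hy
  rw [covDerivDensity_const_mul D' _ _ hev (mdifferentiableAt_detRoot h x),
    covDerivDensity_detRoot (hS.trace x i)]
  simp [covDerivForm_zero hC.faraday]

end InducedStructures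

end

theorem mainTheorem10 (n : ℕ) (hn : 2 ≤ n)
    {M : Type*} [TopologicalSpace M] [ChartedSpace (EuclideanSpace ℝ (Fin n)) M]
    [IsManifold (𝓡 n) ∞ M] [T2Space M] [SecondCountableTopology M]
    {N : Type*} [TopologicalSpace N] [ChartedSpace (EuclideanSpace ℝ (Fin (2 * n))) N]
    [IsManifold (𝓡 (2 * n)) ∞ N] [T2Space N] [SecondCountableTopology N]
    (K : ParaKahlerStructure (2 * n) N) (c : ℝ)
    (hK : K.HasConstantParaHolomorphicSectionalCurvature (4 * c))
    (f : M → N) (hf : IsLagrangianImmersion K f) (hpos : IsPositiveDefiniteImmersion K f)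
    (hH : HasZeroMeanCurvature K f hf hpos.nondegenerate) :
    (inducedAHStructure K f hf hpos.nondegenerate).IsAH ∧
    (inducedAHStructure K f hf hpos.nondegenerate).IsExact ∧
    (inducedAHStructure K f hf hpos.nondegenerate).IsEinstein ∧
    (inducedAHStructure K f hf hpos.nondegenerate).IsDistinguished
      (inducedMetric K f hf hpos.nondegenerate) ∧
    (∃ D, (inducedAHStructure K f hf hpos.nondegenerate).IsRepresentedBy D
        (inducedMetric K f hf hpos.nondegenerate) ∧
      (∀ x : M, weightedScalar D (inducedMetric K f hf hpos.nondegenerate) x x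
        = n * (n - 1) * c * detRoot (inducedMetric K f hf hpos.nondegenerate) x x) ∧
      (∀ (x : M) (i j k l : Fin n), tTensor D (inducedMetric K f hf hpos.nondegenerate) x i j k l
        = c * ((if i = l then 1 else 0) * lower (inducedMetric K f hf hpos.nondegenerate) x j k
          - (if j = l then 1 else 0) * lower (inducedMetric K f hf hpos.nondegenerate) x i k)) ∧
      (∀ (x : M) (i j k l : Fin n),
        eTensor D (inducedMetric K f hf hpos.nondegenerate) x i j k l = 0)) ∧
    (2 < n → (inducedAHStructure K f hf hpos.nondegenerate).IsProjectivelyFlat ∧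
      (inducedAHStructure K f hf hpos.nondegenerate).IsConjugateProjectivelyFlat) := by
  have hK' := K.isParaComplexSpaceForm hK
  have hL := hf.isLagrangian hpos.nondegenerate
  have hP := hf.isProjected hpos.nondegenerate
  -- Zero mean curvature enters the proof only here, through the trace of the cubic form.
  have hS := hP.hasTracefreeCubicForm hK' hL hH
  have hC : HasConstantCurvature _ _ c := hP.curvature hK' hL
  have hR : (inducedAHStructure K f hf hpos.nondegenerate).IsRepresentedBy _ _ :=
    hP.isRepresentedBy hK' hL hS
  have hd := hR.isDistinguished hS
  exact ⟨hR.isAH hS, ⟨_, hd⟩, hR.isEinstein (by omega) hS hC, hd,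
    ⟨_, hR, fun x => hC.weightedScalar (mem_source_self x), hC.tTensor, hC.eTensor⟩,
    fun _ => ⟨hP.isProjectivelyFlat hK' hL, hR.isConjugateProjectivelyFlat hK' hL hP hS⟩⟩
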